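/- Let $p\ge 1$, $q\ge 0$, and let $M$ be a smooth manifold (without boundary, Hausdorff) of dimension $p+q$. Let $(X_1,\dots,X_p,F_1,\dots,F_q)$ be an integrable system of type $(p,q)$ on $M$: $X_1,\dots,X_p$ are smooth vector fields, $F_1,\dots,F_q$ are smooth real functions, $[X_i,X_j]=0$ and $X_i(F_j)=0$ for all $i,j$, and $X_1\wedge\dots\wedge X_p\neq 0$, $dF_1\wedge\dots\wedge dF_q\ne 0$ almost everywhere on $M$. Let $N=\{F_1=c_1,\dots,F_q=c_q\}$ be a (non-empty) connected compact regular level set, i.e. $X_1\wedge\dots\wedge X_p(x)\neq 0$ and $dF_1\wedge\dots\wedge dF_q(x)\neq0$ for every $x\in N$. A Liouville chart near $N$ is a diffeomorphism from an open neighbourhood $\mathcal U$ of $N$ onto $\mathbb T^p\times B^q$, where $\mathbb T^p=\mathbb R^p/\mathbb Z^p$ and $B^q$ is the open unit ball of $\mathbb R^q$, with coordinates $(\theta,r)$, in which $X_i=\sum_{j} a_{ij}(r)\,\partial/\partial\theta_j$ and $F_j=f_j(r)$ do not depend on $\theta$. The corresponding action $\rho\cdot(\theta,r)=(\rho+\theta,r)$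 of $\mathbb T^p$ on $\mathcal U$ is called a Liouville torus action near $N$. Let $\Lambda$ be a linear differential operator on $M$ (of finite order, with smooth real coefficients). Then Liouville charts near $N$ exist. Moreover, for every Liouville chart near $N$, if at least one of the following two conditions holds: (i) $\Lambda$ is invariant with respect to $X_1,\dots,X_p$, i.e. $X_i\circ\Lambda-\Lambda\circ X_i=0$ for all $i$; (ii) $\Lambda$ is invariant with respect to $X_1$, and, near $N$, the orbit of $X_1$ is dense in a dense family of orbits of the Liouville $\mathbb T^p$-action (that is, the union of the $\mathbb T^p$-orbits in which the orbits of $X_1$ are dense is dense in some neighbourhood of $N$); then $\Lambda$ is invariant with respect to the Liouville $\mathbb T^p$-action in a neighbourhood of $N$: there is a $\mathbb T^p$-invariant open set $V$ with $N\subseteq V\subseteq\mathcal U$ such that $\rho^*\circ\Lambda=\Lambda\circ\rho^*$ on $V$ for every $\rho\in\mathbb T^p$. -/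

import Mathlib

open Set Filter Topology Metric
open scoped Manifold ContDiff

noncomputable section

namespace LiouvilleTorus

/-- Smooth vector fields on an `n`-dimensional smooth manifold `M`. -/
abbrev SmoothVF (n : ℕ) (M : Type*) [TopologicalSpace M]
    [ChartedSpace (EuclideanSpace ℝ (Fin n)) M] [IsManifold (𝓡 n) ∞ M] : Type _ :=
  ContMDiffSection (𝓡 n) (EuclideanSpace ℝ (Fin n)) ∞ (TangentSpace (𝓡 n) : M → Type _)

/-- Smooth real functions on `M`. -/
abbrev SmoothFun (n : ℕ) (M : Type*) [TopologicalSpace M]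
    [ChartedSpace (EuclideanSpace ℝ (Fin n)) M] : Type _ :=
  ContMDiffMap (𝓡 n) 𝓘(ℝ, ℝ) M ℝ ∞

section Basic

variable {n : ℕ} {M : Type*} [TopologicalSpace M]
  [ChartedSpace (EuclideanSpace ℝ (Fin n)) M] [IsManifold (𝓡 n) ∞ M]

/-- The differential `df(x)`, a linear form on `T_x M`. -/
def differential (f : SmoothFun n M) (x : M) : TangentSpace (𝓡 n) x →L[ℝ] ℝ :=
  mfderiv (𝓡 n) 𝓘(ℝ, ℝ) f x

/-- `X(f) = df(X)` is smooth. -/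
theorem contMDiff_differential_apply (X : SmoothVF n M) (f : SmoothFun n M) :
    ContMDiff (𝓡 n) 𝓘(ℝ, ℝ) ∞ (fun x => differential f x (X x)) := by
  have h1 : ContMDiff (𝓡 n).tangent 𝓘(ℝ, ℝ).tangent ∞ (tangentMap (𝓡 n) 𝓘(ℝ, ℝ) f) :=
    f.contMDiff.contMDiff_tangentMap (by simp)
  have h2 := h1.comp X.contMDiff_toFun
  intro x
  have h3 := Bundle.contMDiffAt_totalSpace.1 (h2 x)
  have h4 := h3.2
  simp [tangentMap, Function.comp_def] at h4
  exact h4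

/-- A vector field as a first-order operator `f ↦ X(f)` on smooth functions. -/
def applyVF (X : SmoothVF n M) (f : SmoothFun n M) : SmoothFun n M :=
  ⟨fun x => differential f x (X x), contMDiff_differential_apply X f⟩

/-- `P` holds almost everywhere on `M`: its failure set is Lebesgue-null in every smooth chart. -/
def AlmostEverywhere (P : M → Prop) : Prop :=
  ∀ e ∈ IsManifold.maximalAtlas (𝓡 n) ∞ M,
    MeasureTheory.volume {y | y ∈ e.target ∧ ¬ P (e.symm y)} = 0

/-- The linear operator `Λ` on smooth functions is a linear differential operator of order at
most `m`: in every smooth chart it has the form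
`∑_{k ≤ m} ∑_{j₁,…,j_k} c_{j₁…j_k}(y) ∂_{j₁} ⋯ ∂_{j_k}` with smooth coefficients. -/
def HasOrderLE (Λ : SmoothFun n M →ₗ[ℝ] SmoothFun n M) (m : ℕ) : Prop :=
  ∀ e ∈ IsManifold.maximalAtlas (𝓡 n) ∞ M,
    ∃ c : (k : ℕ) → (Fin k → Fin n) → EuclideanSpace ℝ (Fin n) → ℝ,
      (∀ k J, ContDiffOn ℝ ∞ (c k J) e.target) ∧
      ∀ f : SmoothFun n M, ∀ y ∈ e.target,
        Λ f (e.symm y) = ∑ k ∈ Finset.range (m + 1), ∑ J : Fin k → Fin n,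
          c k J y * iteratedFDeriv ℝ k (fun z => f (e.symm z)) y
            (fun i => EuclideanSpace.single (J i) (1 : ℝ))

/-- Linear differential operators (with smooth real coefficients, of some finite order). -/
def IsDiffOp (Λ : SmoothFun n M →ₗ[ℝ] SmoothFun n M) : Prop :=
  ∃ m : ℕ, HasOrderLE Λ m

/-- `Λ` is invariant with respect to the vector field `X`: `X ∘ Λ - Λ ∘ X = 0`. -/
def InvariantUnderVF (Λ : SmoothFun n M →ₗ[ℝ] SmoothFun n M) (X : SmoothVF n M) : Prop :=
  ∀ f : SmoothFun n M, applyVF X (Λ f) - Λ (applyVF X f) = 0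

/-- The orbit of the (possibly incomplete) vector field `X` through `x`: all points reached from
`x` along integral curves of `X` defined on open intervals around `0`. -/
def vfOrbit (X : SmoothVF n M) (x : M) : Set M :=
  {y | ∃ (γ : ℝ → M) (a b t : ℝ), a < 0 ∧ 0 < b ∧ t ∈ Ioo a b ∧
    IsMIntegralCurveOn (I := 𝓡 n) γ (fun z => X z) (Ioo a b) ∧ γ 0 = x ∧ γ t = y}

end Basic

section System

variable {p q : ℕ} {M : Type*} [TopologicalSpace M]
  [ChartedSpace (EuclideanSpace ℝ (Fin (p + q))) M] [IsManifold (𝓡 (p + q)) ∞ M]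

/-- `X₁ ∧ ⋯ ∧ X_p (x) ≠ 0` and `dF₁ ∧ ⋯ ∧ dF_q (x) ≠ 0`. -/
def IsRegularPoint (X : Fin p → SmoothVF (p + q) M) (F : Fin q → SmoothFun (p + q) M)
    (x : M) : Prop :=
  LinearIndependent ℝ (fun i => X i x) ∧ LinearIndependent ℝ (fun j => differential (F j) x)

/-- `(X₁,…,X_p,F₁,…,F_q)` is an integrable system of type `(p,q)` on the `(p+q)`-dimensional
manifold `M`. -/
structure IsIntegrableSystem (X : Fin p → SmoothVF (p + q) M)
    (F : Fin q → SmoothFun (p + q) M) : Prop where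
  one_le : 1 ≤ p
  commute : ∀ i j x, VectorField.mlieBracket (𝓡 (p + q)) (X i) (X j) x = 0
  firstIntegral : ∀ i j, applyVF (X i) (F j) = 0
  independent : AlmostEverywhere (n := p + q) (IsRegularPoint X F)

/-- The level set `{F₁ = c₁, …, F_q = c_q}`. -/
def levelSet (F : Fin q → SmoothFun (p + q) M) (c : Fin q → ℝ) : Set M :=
  {x | ∀ j, F j x = c j}

/-- The inverse of a chart with values in `𝕋^p × ℝ^q`, `𝕋 = ℝ/ℤ`, lifted to `ℝ^p × ℝ^q`. -/
def coverLift (e : OpenPartialHomeomorph M (UnitAddTorus (Fin p) × EuclideanSpace ℝ (Fin q)))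
    (z : (Fin p → ℝ) × EuclideanSpace ℝ (Fin q)) : M :=
  e.symm (fun i => (z.1 i : UnitAddCircle), z.2)

/-- The coordinate system of a Liouville torus action near `N`: a diffeomorphism from an open
neighbourhood of `N` (the `source`) onto `𝕋^p × B^q`, `𝕋 = ℝ/ℤ`, with coordinates `(θ, r)`, in
which `X_i = ∑_j a_{ij}(r) ∂/∂θ_j` and `F_j = f_j(r)`. Smoothness in both directions is expressed
on the universal cover `ℝ^p × B^q`, from which `𝕋^p × B^q` has its smooth structure. -/
structure LiouvilleChart (X : Fin p → SmoothVF (p + q) M) (F : Fin q → SmoothFun (p + q) M)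
    (N : Set M) extends
    OpenPartialHomeomorph M (UnitAddTorus (Fin p) × EuclideanSpace ℝ (Fin q)) where
  subset_source : N ⊆ source
  target_eq : target = univ ×ˢ ball (0 : EuclideanSpace ℝ (Fin q)) 1
  isLocalDiffeomorphOn_lift :
    IsLocalDiffeomorphOn 𝓘(ℝ, (Fin p → ℝ) × EuclideanSpace ℝ (Fin q)) (𝓡 (p + q)) ∞
      (coverLift toOpenPartialHomeomorph)
      (univ ×ˢ ball (0 : EuclideanSpace ℝ (Fin q)) 1)
  vectorField_eq : ∃ a : Fin p → Fin p → EuclideanSpace ℝ (Fin q) → ℝ,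
    ∀ i θ, ∀ r ∈ ball (0 : EuclideanSpace ℝ (Fin q)) 1,
      X i (coverLift toOpenPartialHomeomorph (θ, r)) = ∑ j, a i j r •
        (mfderiv 𝓘(ℝ, (Fin p → ℝ) × EuclideanSpace ℝ (Fin q)) (𝓡 (p + q))
          (coverLift toOpenPartialHomeomorph) (θ, r)
          (Pi.single j (1 : ℝ), (0 : EuclideanSpace ℝ (Fin q))) :
            TangentSpace (𝓡 (p + q)) (coverLift toOpenPartialHomeomorph (θ, r)))
  firstIntegral_eq : ∃ f : Fin q → EuclideanSpace ℝ (Fin q) → ℝ,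
    ∀ j θ, ∀ r ∈ ball (0 : EuclideanSpace ℝ (Fin q)) 1,
      F j (coverLift toOpenPartialHomeomorph (θ, r)) = f j r

namespace LiouvilleChart

variable {X : Fin p → SmoothVF (p + q) M} {F : Fin q → SmoothFun (p + q) M} {N : Set M}

/-- The Liouville torus action `(ρ, (θ, r)) ↦ (ρ + θ, r)` on the domain of the chart. (It is only
meaningful at points of `L.source`.) -/
def act (L : LiouvilleChart X F N) (ρ : UnitAddTorus (Fin p)) (x : M) : M :=
  L.toOpenPartialHomeomorph.symm
    (ρ + (L.toOpenPartialHomeomorph x).1, (L.toOpenPartialHomeomorph x).2)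

/-- The `𝕋^p`-orbit of a point of `L.source`. -/
def orbit (L : LiouvilleChart X F N) (x : M) : Set M :=
  range (fun ρ : UnitAddTorus (Fin p) => L.act ρ x)

/-- Near `N`, the orbit of the vector field `Z` is dense in a dense family of orbits of the
Liouville action: the union of those `𝕋^p`-orbits in which the orbits of `Z` are dense is itself
dense in some neighbourhood of `N`. -/
def DenseOrbitsNear (L : LiouvilleChart X F N) (Z : SmoothVF (p + q) M) : Prop :=
  ∃ W : Set M, IsOpen W ∧ N ⊆ W ∧ W ⊆ L.source ∧
    W ⊆ closure {x | x ∈ L.source ∧ L.orbit x ⊆ closure (vfOrbit Z x)}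

/-- `Λ` is invariant under the Liouville action in a neighbourhood `V` of `N` (an invariant open
subset of the domain of the action): for every `ρ`, `Λ (ρ^* f) = ρ^* (Λ f)` on `V`. Since `ρ^* f`
is only defined near `N`, the equality is stated for germs: if `g = ρ^* f` near `x ∈ V` then
`(Λ g)(x) = (Λ f)(ρ · x)`. -/
def InvariantNear (L : LiouvilleChart X F N)
    (Λ : SmoothFun (p + q) M →ₗ[ℝ] SmoothFun (p + q) M) : Prop :=
  ∃ V : Set M, IsOpen V ∧ N ⊆ V ∧ V ⊆ L.source ∧
    (∀ ρ, ∀ x ∈ V, L.act ρ x ∈ V) ∧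
    ∀ ρ, ∀ x ∈ V, ∀ f g : SmoothFun (p + q) M,
      (∀ᶠ y in 𝓝 x, g y = f (L.act ρ y)) → Λ g x = Λ f (L.act ρ x)

end LiouvilleChart

end System

end LiouvilleTorus

end

/-! Existence of charts. Dualising the commuting frame gives a coframe along the leaves of `F`.
Vanishing brackets make it closed, and the parametric Poincaré lemma integrates it to flow boxes,
where X_i = ∂/∂t_i and F_j = r_j (`exists_isFlowBox`). Uniqueness of integral curves makes
translations agree between boxes. Near the compact set N they have a uniform size, so they extend to
an action `A` of ℝ^p on a neighbourhood of N, with no completeness assumption (`exists_action`). By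
connectedness N is a single orbit, and its isotropy group is discrete and cocompact, hence a
lattice. A basis of this lattice continues smoothly to periods `P r` of nearby orbits, and
compactness of the unit cube excludes any further periods (`exists_period_family`,
`exists_ball_forall_period_iff`). With σ a section transverse to the orbits, the map (θ, w) ↦ A (P
(c + ρw) θ) (σ (c + ρw)) then descends to 𝕋^p × B^q and is inverse to a chart.

Invariance. Lift to coordinates (θ, r). For a smooth test function h let G_h(z) be `Λ` applied to h
translated from 0 to z, evaluated at z (`germValue`). It equals ∑ C(z) ∂h(0), where the C are the
coefficients of `Λ`, so torus invariance means that every G_h is independent of θ. If `Λ` commutes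
with Z = ∑ a_j(r) ∂/∂θ_j, then the derivative of G_h along a(r) at (θ, r) is G_{Th}, where Th(u) is
the derivative of h at u in the direction (b(u.2), 0), with b(y) = a(r + y) - a(r) near 0
(`fderiv_germValue_apply`). This error term appears because Z varies from torus to torus. Since b(0)
= 0, T raises by one the order of vanishing of h along {r = 0}, while G_h = 0 once that order
exceeds the order of `Λ`. Descending induction on the order of vanishing shows that G_{Th} is
constant along the lines θ + t a(r). Hence G_h is affine on them; being ℤ^p-periodic it is bounded,
so it is constant (`germValue_add_smul`).

Under (i) the vectors a_i(r) span ℝ^p for r near its value on N, so G_h is independent of θ there.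
Under (ii) G_h is constant on the tori with a dense orbit, by continuity, and these tori are dense
near N. -/

noncomputable section

namespace LiouvilleTorus

/-! ### Parametric Poincaré lemma. -/

section Poincare

universe u

/-- Differentiation under the integral sign for a `C¹` integrand. -/
theorem hasFDerivAt_intervalIntegral_of_contDiff {E F : Type u}
    [NormedAddCommGroup E] [NormedSpace ℝ E] [FiniteDimensional ℝ E]
    [NormedAddCommGroup F] [NormedSpace ℝ F]
    {f : E × ℝ → F} (hf : ContDiff ℝ 1 f) (x₀ : E) :
    HasFDerivAt (fun x => ∫ s in (0 : ℝ)..1, f (x, s))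
      (∫ s in (0 : ℝ)..1, (fderiv ℝ f (x₀, s)).comp (ContinuousLinearMap.inl ℝ E ℝ)) x₀ := by
  have hf' : Continuous fun z : E × ℝ => (fderiv ℝ f z).comp (ContinuousLinearMap.inl ℝ E ℝ) :=
    (hf.continuous_fderiv one_ne_zero).clm_comp continuous_const
  obtain ⟨C, hC⟩ := ((isCompact_closedBall x₀ 1).prod (isCompact_Icc (a := (0 : ℝ)) (b := 1))).exists_bound_of_continuousOn
    hf'.continuousOn
  refine intervalIntegral.hasFDerivAt_integral_of_dominated_of_fderiv_le
    (F := fun x s => f (x, s))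
    (F' := fun x s => (fderiv ℝ f (x, s)).comp (ContinuousLinearMap.inl ℝ E ℝ))
    (s := closedBall x₀ 1) (bound := fun _ => C)
    (closedBall_mem_nhds x₀ one_pos) ?_ ?_ ?_ ?_ ?_ ?_
  · refine Eventually.of_forall fun x => ?_
    exact (hf.continuous.comp (Continuous.prodMk_right x)).aestronglyMeasurable
  · exact (hf.continuous.comp (Continuous.prodMk_right x₀)).intervalIntegrable _ _
  · exact (hf'.comp (Continuous.prodMk_right x₀)).aestronglyMeasurable
  · refine Eventually.of_forall fun s hs x hx => hC (x, s) ⟨hx, ?_⟩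
    rw [uIoc_of_le zero_le_one] at hs
    exact ⟨hs.1.le, hs.2⟩
  · exact intervalIntegrable_const
  · refine Eventually.of_forall fun s _ x _ => ?_
    have h1 := (hf.differentiable one_ne_zero (x, s)).hasFDerivAt
    exact h1.comp x (hasFDerivAt_prodMk_left x s)

/-- Integrals of smooth functions depend smoothly on parameters. -/
theorem contDiff_intervalIntegral {E F : Type u}
    [NormedAddCommGroup E] [NormedSpace ℝ E] [FiniteDimensional ℝ E]
    [NormedAddCommGroup F] [NormedSpace ℝ F]
    {f : E × ℝ → F} (hf : ContDiff ℝ ∞ f) :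
    ContDiff ℝ ∞ (fun x => ∫ s in (0 : ℝ)..1, f (x, s)) := by
  rw [contDiff_infty]
  intro n
  -- The derivative is an integral of the same kind with values in `E →L[ℝ] F`; hence the
  -- generalization over `F`, and one universe for `E` and `F`.
  induction n generalizing F with
  | zero =>
    rw [Nat.cast_zero, contDiff_zero]
    exact intervalIntegral.continuous_parametric_intervalIntegral_of_continuous
      (f := fun x s => f (x, s)) hf.continuous continuous_const
  | succ n ih =>
    push_cast
    rw [contDiff_succ_iff_hasFDerivAt]
    refine ⟨fun x => ∫ s in (0 : ℝ)..1,
      (fderiv ℝ f (x, s)).comp (ContinuousLinearMap.inl ℝ E ℝ), ?_, fun x => ?_⟩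
    · refine ih (f := fun z => (fderiv ℝ f z).comp (ContinuousLinearMap.inl ℝ E ℝ)) ?_
      exact (hf.fderiv_right (by simp)).clm_comp contDiff_const
    · exact hasFDerivAt_intervalIntegral_of_contDiff (hf.of_le (by simp)) x

/-- Poincaré lemma for `1`-forms along the first factor, smooth in the parameter. -/
theorem exists_contDiff_primitive_fst {V R G : Type}
    [NormedAddCommGroup V] [NormedSpace ℝ V] [FiniteDimensional ℝ V]
    [NormedAddCommGroup R] [NormedSpace ℝ R] [FiniteDimensional ℝ R]
    [NormedAddCommGroup G] [NormedSpace ℝ G] [CompleteSpace G]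
    {W : Set (V × R)} (hW : IsOpen W) {z₀ : V × R} (hz₀ : z₀ ∈ W)
    {α : V × R → V →L[ℝ] G} (hα : ContDiffOn ℝ ∞ α W)
    (hclosed : ∀ z ∈ W, ∀ v w : V, fderiv ℝ α z (v, 0) w = fderiv ℝ α z (w, 0) v) :
    ∃ T : V × R → G, ContDiff ℝ ∞ T ∧
      ∀ᶠ z in 𝓝 z₀, ∀ v : V, fderiv ℝ T z (v, 0) = α z v := by
  obtain ⟨δ, hδ, hδW⟩ := Metric.isOpen_iff.1 hW z₀ hz₀
  -- The cutoff makes the integrand smooth on the whole space while leaving `α` unchanged on the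
  -- ball of radius δ/3; its support has radius δ/2, inside `W`.
  let χ : ContDiffBump z₀ := ⟨δ / 3, δ / 2, by positivity, by linarith⟩
  have hχα : ContDiff ℝ ∞ (fun z => χ z • α z) := by
    rw [contDiff_iff_contDiffAt]
    intro z
    by_cases hz : z ∈ W
    · exact χ.contDiff.contDiffAt.smul (hα.contDiffAt (hW.mem_nhds hz))
    · have : (fun z => χ z • α z) =ᶠ[𝓝 z] fun _ => 0 := by
        have hz' : z ∈ (tsupport χ)ᶜ := by
          intro h
          rw [χ.tsupport_eq] at h
          refine hz (hδW ?_)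
          have : dist z z₀ ≤ δ / 2 := h
          rw [mem_ball]; linarith
        filter_upwards [(isClosed_tsupport χ).isOpen_compl.mem_nhds hz'] with y hy
        rw [image_eq_zero_of_notMem_tsupport hy, zero_smul]
      exact contDiffAt_const.congr_of_eventuallyEq this
  set β : V × R → V →L[ℝ] G := fun z => χ z • α z with hβ
  have hβα : ∀ z ∈ ball z₀ (δ / 3), β z = α z := fun z hz => by
    simp only [hβ]
    rw [χ.one_of_mem_closedBall (ball_subset_closedBall hz), one_smul]
  -- Integral of the form along the segment from `z₀.1` to `z.1`, the second component being a fixed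
  -- parameter.
  let T : V × R → G := fun z => ∫ s in (0 : ℝ)..1,
    β (AffineMap.lineMap z₀.1 z.1 s, z.2) (z.1 - z₀.1)
  have hT : ContDiff ℝ ∞ T := by
    refine contDiff_intervalIntegral
      (f := fun w : (V × R) × ℝ => β (AffineMap.lineMap z₀.1 w.1.1 w.2, w.1.2) (w.1.1 - z₀.1)) ?_
    refine ContDiff.clm_apply (hχα.comp ?_) ?_
    · simp only [AffineMap.lineMap_apply, vsub_eq_sub, vadd_eq_add]
      fun_prop
    · fun_prop
  refine ⟨T, hT, ?_⟩
  filter_upwards [ball_mem_nhds z₀ (show 0 < δ / 3 by positivity)] with z hz v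
  have hball : ∀ {x : V}, x ∈ ball z₀.1 (δ / 3) → (x, z.2) ∈ ball z₀ (δ / 3) := by
    intro x hx
    rw [mem_ball, Prod.dist_eq] at hz ⊢
    exact max_lt hx ((le_max_right _ _).trans_lt hz)
  have hz1 : z.1 ∈ ball z₀.1 (δ / 3) := by
    rw [mem_ball, Prod.dist_eq] at hz
    exact (le_max_left _ _).trans_lt hz
  have hnear : ∀ {x : V}, x ∈ ball z₀.1 (δ / 3) → (x, z.2) ∈ W := fun {x} hx =>
    hδW (ball_subset_ball (by linarith) (hball hx))
  have hprim : (∀ x ∈ ball z₀.1 (δ / 3), HasFDerivWithinAt (fun x => β (x, z.2))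
      ((fderiv ℝ α (x, z.2)).comp (ContinuousLinearMap.inl ℝ V R)) (ball z₀.1 (δ / 3)) x) → _ →
      HasFDerivWithinAt (fun x => curveIntegral (fun x => β (x, z.2)) (.segment z₀.1 x)) (β z)
        (ball z₀.1 (δ / 3)) z.1 := fun h1 h2 =>
    (convex_ball z₀.1 (δ / 3)).hasFDerivWithinAt_curveIntegral_segment_of_hasFDerivWithinAt_symmetric
    (dω := fun x => (fderiv ℝ α (x, z.2)).comp (ContinuousLinearMap.inl ℝ V R))
    (a := z₀.1) (b := z.1) h1 h2 (mem_ball_self (by positivity)) hz1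
  have hprim' := hprim ?_ ?_
  · have h1 : HasFDerivAt (fun x => T (x, z.2)) (β z) z.1 := by
      have := hprim'.hasFDerivAt (isOpen_ball.mem_nhds hz1)
      refine this.congr_of_eventuallyEq (Eventually.of_forall fun x => ?_)
      exact (curveIntegral_segment (fun x => β (x, z.2)) z₀.1 x).symm
    have h2 : HasFDerivAt (fun x => T (x, z.2))
        ((fderiv ℝ T z).comp (ContinuousLinearMap.inl ℝ V R)) z.1 := by
      have h3 : HasFDerivAt T (fderiv ℝ T z) (z.1, z.2) :=
        (hT.differentiable (by simp) z).hasFDerivAt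
      exact HasFDerivAt.comp (f := fun e : V => (e, z.2)) z.1 h3 (hasFDerivAt_prodMk_left z.1 z.2)
    have h3 := congrArg (fun A : V →L[ℝ] G => A v) (h2.unique h1)
    rw [← hβα z hz, ← h3]
    rfl
  · intro x hx
    have h1 : HasFDerivAt α (fderiv ℝ α (x, z.2)) (x, z.2) :=
      ((hα.contDiffAt (hW.mem_nhds (hnear hx))).differentiableAt (by simp)).hasFDerivAt
    have h2 := (HasFDerivAt.comp (f := fun e : V => (e, z.2)) x h1
      (hasFDerivAt_prodMk_left x z.2)).hasFDerivWithinAt (s := ball z₀.1 (δ / 3))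
    exact h2.congr (fun y hy => hβα _ (hball hy)) (hβα _ (hball hx))
  · intro x hx v _ w _
    exact hclosed _ (hnear hx) v w

end Poincare

/-! ### The inverse function theorem on manifolds. -/

section InverseFunction

variable {E E' : Type*} [NormedAddCommGroup E] [NormedSpace ℝ E] [CompleteSpace E]
  [NormedAddCommGroup E'] [NormedSpace ℝ E'] [CompleteSpace E']

/-- The smooth inverse function theorem, on an open set where the map is smooth. -/
theorem exists_openPartialHomeomorph_of_bijective_fderiv {g : E → E'} {W : Set E} (hW : IsOpen W)
    (hg : ContDiffOn ℝ ∞ g W) {a : E} (ha : a ∈ W) (hb : Function.Bijective (fderiv ℝ g a)) :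
    ∃ h : OpenPartialHomeomorph E E', a ∈ h.source ∧ h.source ⊆ W ∧ (∀ x, h x = g x) ∧
      ContDiffOn ℝ ∞ h h.source ∧ ContDiffOn ℝ ∞ h.symm h.target := by
  have hga : ContDiffAt ℝ ∞ g a := hg.contDiffAt (hW.mem_nhds ha)
  let f' : E ≃L[ℝ] E' := ContinuousLinearEquiv.ofBijective (fderiv ℝ g a)
    (LinearMap.ker_eq_bot.2 hb.1) (LinearMap.range_eq_top.2 hb.2)
  have hf' : HasFDerivAt g (f' : E →L[ℝ] E') a := (hga.differentiableAt (by simp)).hasFDerivAt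
  let h₀ := hga.toOpenPartialHomeomorph g hf' (by simp)
  have hcont : ContinuousOn (fderiv ℝ g) W := hg.continuousOn_fderiv_of_isOpen hW (by simp)
  -- Restricting to the open set of points where the derivative is invertible makes the inverse
  -- smooth on its whole domain, not only at the image of `a`.
  have hO : IsOpen (W ∩ fderiv ℝ g ⁻¹' range ((↑) : (E ≃L[ℝ] E') → E →L[ℝ] E')) :=
    hcont.isOpen_inter_preimage hW (ContinuousLinearEquiv.isOpen (𝕜 := ℝ))
  have haO : a ∈ W ∩ fderiv ℝ g ⁻¹' range ((↑) : (E ≃L[ℝ] E') → E →L[ℝ] E') := by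
    refine ⟨ha, f', ?_⟩
    exact (hf'.fderiv).symm
  let h := h₀.restrOpen _ hO
  have hsub : h.source ⊆ W := fun x hx => hx.2.1
  refine ⟨h, ⟨hga.mem_toOpenPartialHomeomorph_source hf' (by simp), haO⟩, hsub, fun x => rfl,
    hg.mono hsub, fun y hy => ?_⟩
  have hx := h.map_target hy
  obtain ⟨e, he⟩ := hx.2.2
  have hgx : ContDiffAt ℝ ∞ g (h.symm y) := hg.contDiffAt (hW.mem_nhds (hsub hx))
  refine (h.contDiffAt_symm (f₀' := e) hy ?_ hgx).contDiffWithinAt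
  rw [he]
  exact (hgx.differentiableAt (by simp)).hasFDerivAt

variable {M : Type*} [TopologicalSpace M] [ChartedSpace E M]

/-- `ψ` is a smooth parametrization: it and its inverse are smooth. -/
structure IsSmoothParam (ψ : OpenPartialHomeomorph E' M) : Prop where
  contMDiffOn : ContMDiffOn 𝓘(ℝ, E') 𝓘(ℝ, E) ∞ ψ ψ.source
  contMDiffOn_symm : ContMDiffOn 𝓘(ℝ, E) 𝓘(ℝ, E') ∞ ψ.symm ψ.target

variable [IsManifold 𝓘(ℝ, E) ∞ M]

omit [CompleteSpace E] [CompleteSpace E'] [IsManifold 𝓘(ℝ, E) ∞ M] in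
theorem IsSmoothParam.mdifferentiableAt {ψ : OpenPartialHomeomorph E' M}
    (hψ : IsSmoothParam (E := E) ψ) {z : E'} (hz : z ∈ ψ.source) :
    MDifferentiableAt 𝓘(ℝ, E') 𝓘(ℝ, E) ψ z :=
  (hψ.contMDiffOn.contMDiffAt (ψ.open_source.mem_nhds hz)).mdifferentiableAt (by simp)

/-- The inverse function theorem read through the chart at `x₀`. It turns a choice of coordinate
functions `f` into a parametrization whose inverse is `f`. -/
theorem exists_isSmoothParam_of_bijective_mfderiv {f : M → E'} {O : Set M} (hO : IsOpen O)
    (hf : ContMDiffOn 𝓘(ℝ, E) 𝓘(ℝ, E') ∞ f O) {x₀ : M} (hx₀ : x₀ ∈ O)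
    (hb : Function.Bijective (mfderiv 𝓘(ℝ, E) 𝓘(ℝ, E') f x₀)) :
    ∃ ψ : OpenPartialHomeomorph E' M, IsSmoothParam (E := E) ψ ∧ x₀ ∈ ψ.target ∧
      ψ.target ⊆ O ∧ ∀ x ∈ ψ.target, ψ.symm x = f x := by
  let c := chartAt E x₀
  have hcs : ContMDiffOn 𝓘(ℝ, E) 𝓘(ℝ, E) ∞ c.symm c.target := contMDiffOn_chart_symm
  have hcc : ContMDiffOn 𝓘(ℝ, E) 𝓘(ℝ, E) ∞ c c.source := contMDiffOn_chart
  have hxc : x₀ ∈ c.source := mem_chart_source E x₀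
  have hW : IsOpen (c.target ∩ c.symm ⁻¹' O) := c.isOpen_inter_preimage_symm hO
  have hg : ContDiffOn ℝ ∞ (f ∘ c.symm) (c.target ∩ c.symm ⁻¹' O) := by
    rw [← contMDiffOn_iff_contDiffOn]
    exact hf.comp (hcs.mono inter_subset_left) fun x hx => hx.2
  have ha : c x₀ ∈ c.target ∩ c.symm ⁻¹' O := ⟨c.map_source hxc, by
    rw [mem_preimage, c.left_inv hxc]; exact hx₀⟩
  have hb' : Function.Bijective (fderiv ℝ (f ∘ c.symm) (c x₀)) := by
    have h1 : mfderiv 𝓘(ℝ, E) 𝓘(ℝ, E') (f ∘ c.symm) (c x₀) =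
        (mfderiv 𝓘(ℝ, E) 𝓘(ℝ, E') f x₀).comp (mfderiv 𝓘(ℝ, E) 𝓘(ℝ, E) c.symm (c x₀)) := by
      have h2 := mfderiv_comp (I := 𝓘(ℝ, E)) (I' := 𝓘(ℝ, E)) (I'' := 𝓘(ℝ, E')) (c x₀)
        (g := f) (f := c.symm) ?_
        ((hcs.contMDiffAt (c.open_target.mem_nhds ha.1)).mdifferentiableAt (by simp))
      · rw [c.left_inv hxc] at h2
        exact h2
      · rw [c.left_inv hxc]
        exact (hf.contMDiffAt (hO.mem_nhds hx₀)).mdifferentiableAt (by simp)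
    rw [← mfderiv_eq_fderiv, h1]
    have h3 : IsLocalDiffeomorphAt 𝓘(ℝ, E) 𝓘(ℝ, E) ∞ c.symm (c x₀) :=
      ⟨⟨c.symm.toPartialEquiv, c.open_target, c.open_source, hcs, hcc⟩, ha.1, fun _ _ => rfl⟩
    exact hb.comp (h3.mfderivToContinuousLinearEquiv (by simp)).bijective
  obtain ⟨h, hah, hhW, hhg, hh1, hh2⟩ := exists_openPartialHomeomorph_of_bijective_fderiv hW hg ha hb'
  refine ⟨h.symm.trans c.symm, ⟨?_, ?_⟩, ?_, ?_, ?_⟩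
  · refine hcs.comp ((contMDiffOn_iff_contDiffOn.2 hh2).mono fun x hx => hx.1) fun x hx => hx.2
  · refine (contMDiffOn_iff_contDiffOn.2 hh1).comp (hcc.mono fun x hx => hx.1) fun x hx => hx.2
  · exact ⟨hxc, hah⟩
  · intro x hx
    have := (hhW hx.2).2
    rw [mem_preimage] at this
    erw [c.left_inv hx.1] at this
    exact this
  · intro x hx
    change h (c x) = f x
    rw [hhg]
    change f (c.symm (c x)) = f x
    rw [c.left_inv hx.1]

end InverseFunction

/-- Linearly independent linear forms take arbitrary prescribed values. -/
theorem exists_forall_apply_eq_of_linearIndependent {ι E : Type*} [Finite ι] [AddCommGroup E]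
    [Module ℝ E] [TopologicalSpace E] [IsTopologicalAddGroup E] [ContinuousConstSMul ℝ E]
    {φ : ι → E →L[ℝ] ℝ} (h : LinearIndependent ℝ φ) (r : ι → ℝ) :
    ∃ v, ∀ j, φ j v = r j := by
  have h1 : LinearIndependent ℝ (fun j => (φ j : E → ℝ)) := by
    let c : (E →L[ℝ] ℝ) →ₗ[ℝ] (E → ℝ) :=
      { toFun := fun f => f, map_add' := fun _ _ => rfl, map_smul' := fun _ _ => rfl }
    have hc : LinearMap.ker c = ⊥ := LinearMap.ker_eq_bot.2 DFunLike.coe_injective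
    exact h.map' c hc
  -- Independence of finitely many functions says that their vectors of simultaneous values span `ι
  -- → ℝ`; these vectors already form the linear range of `P`.
  have h2 := span_flip_eq_top_iff_linearIndependent.2 h1
  let P : E →ₗ[ℝ] (ι → ℝ) := LinearMap.pi fun j => (φ j : E →ₗ[ℝ] ℝ)
  have h3 : Submodule.span ℝ (range (flip fun j => (φ j : E → ℝ))) ≤ LinearMap.range P := by
    rw [Submodule.span_le]
    rintro _ ⟨v, rfl⟩
    exact ⟨v, rfl⟩
  rw [h2] at h3
  obtain ⟨v, hv⟩ := h3 (Submodule.mem_top (x := r))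
  exact ⟨v, fun j => congrFun hv j⟩

section Param

variable {E E' : Type*} [NormedAddCommGroup E] [NormedSpace ℝ E]
  [NormedAddCommGroup E'] [NormedSpace ℝ E']
  {M : Type*} [TopologicalSpace M] [ChartedSpace E M]

theorem IsSmoothParam.mdifferentiableAt_symm {ψ : OpenPartialHomeomorph E' M}
    (hψ : IsSmoothParam (E := E) ψ) {x : M} (hx : x ∈ ψ.target) :
    MDifferentiableAt 𝓘(ℝ, E) 𝓘(ℝ, E') ψ.symm x :=
  (hψ.contMDiffOn_symm.contMDiffAt (ψ.open_target.mem_nhds hx)).mdifferentiableAt (by simp)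

theorem IsSmoothParam.mfderiv_mfderiv_symm {ψ : OpenPartialHomeomorph E' M}
    (hψ : IsSmoothParam (E := E) ψ) {z : E'} (hz : z ∈ ψ.source)
    (v : TangentSpace 𝓘(ℝ, E) (ψ z)) :
    mfderiv 𝓘(ℝ, E') 𝓘(ℝ, E) ψ z (mfderiv 𝓘(ℝ, E) 𝓘(ℝ, E') ψ.symm (ψ z) v) = v := by
  have h1 := hψ.mdifferentiableAt_symm (ψ.map_source hz)
  have h2 : MDifferentiableAt 𝓘(ℝ, E') 𝓘(ℝ, E) ψ (ψ.symm (ψ z)) := by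
    rw [ψ.left_inv hz]; exact hψ.mdifferentiableAt hz
  have h3 := mfderiv_comp (ψ z) h2 h1
  have h4 : mfderiv 𝓘(ℝ, E) 𝓘(ℝ, E) (ψ ∘ ψ.symm) (ψ z) = ContinuousLinearMap.id ℝ _ := by
    rw [← mfderiv_id]
    refine Filter.EventuallyEq.mfderiv_eq ?_
    filter_upwards [ψ.open_target.mem_nhds (ψ.map_source hz)] with y hy
    exact ψ.right_inv hy
  rw [h4] at h3
  have h5 := congrArg (fun A => A v) h3
  rw [ψ.left_inv hz] at h5
  exact h5.symm

theorem IsSmoothParam.mfderiv_symm_mfderiv {ψ : OpenPartialHomeomorph E' M}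
    (hψ : IsSmoothParam (E := E) ψ) {z : E'} (hz : z ∈ ψ.source) (v : E') :
    mfderiv 𝓘(ℝ, E) 𝓘(ℝ, E') ψ.symm (ψ z) (mfderiv 𝓘(ℝ, E') 𝓘(ℝ, E) ψ z v) = v := by
  have h1 := hψ.mdifferentiableAt_symm (ψ.map_source hz)
  have h3 := mfderiv_comp z h1 (hψ.mdifferentiableAt hz)
  have h4 : mfderiv 𝓘(ℝ, E') 𝓘(ℝ, E') (ψ.symm ∘ ψ) z = ContinuousLinearMap.id ℝ _ := by
    rw [← mfderiv_id]
    refine Filter.EventuallyEq.mfderiv_eq ?_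
    filter_upwards [ψ.open_source.mem_nhds hz] with y hy
    exact ψ.left_inv hy
  rw [h4] at h3
  exact (congrArg (fun A => A v) h3).symm

theorem IsSmoothParam.isInvertible_mfderiv {ψ : OpenPartialHomeomorph E' M}
    (hψ : IsSmoothParam (E := E) ψ) {z : E'} (hz : z ∈ ψ.source) :
    (mfderiv 𝓘(ℝ, E') 𝓘(ℝ, E) ψ z).IsInvertible :=
  ContinuousLinearMap.IsInvertible.of_inverse
    (g := mfderiv 𝓘(ℝ, E) 𝓘(ℝ, E') ψ.symm (ψ z))
    (ContinuousLinearMap.ext fun v => hψ.mfderiv_mfderiv_symm hz v)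
    (ContinuousLinearMap.ext fun v => hψ.mfderiv_symm_mfderiv hz v)

theorem IsSmoothParam.inverse_mfderiv {ψ : OpenPartialHomeomorph E' M}
    (hψ : IsSmoothParam (E := E) ψ) {z : E'} (hz : z ∈ ψ.source) :
    (mfderiv 𝓘(ℝ, E') 𝓘(ℝ, E) ψ z).inverse = mfderiv 𝓘(ℝ, E) 𝓘(ℝ, E') ψ.symm (ψ z) :=
  ContinuousLinearMap.inverse_eq
    (ContinuousLinearMap.ext fun v => hψ.mfderiv_mfderiv_symm hz v)
    (ContinuousLinearMap.ext fun v => hψ.mfderiv_symm_mfderiv hz v)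

end Param

/-- The model space of torus coordinates: angles (lifted to `ℝ^p`) and `q` first integrals. -/
abbrev AngleModel (p q : ℕ) : Type := (Fin p → ℝ) × EuclideanSpace ℝ (Fin q)

/-! ### Flow boxes for the commuting frame and the first integrals. -/

section FlowBox

variable {p q : ℕ} {M : Type*} [TopologicalSpace M]
  [ChartedSpace (EuclideanSpace ℝ (Fin (p + q))) M] [IsManifold (𝓡 (p + q)) ∞ M]

/-- A parametrization in which `X_i = ∂/∂t_i` and `F_j = r_j`. -/
structure IsFlowBox (X : Fin p → SmoothVF (p + q) M) (F : Fin q → SmoothFun (p + q) M)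
    (ψ : OpenPartialHomeomorph (AngleModel p q) M) : Prop extends
    IsSmoothParam (E := EuclideanSpace ℝ (Fin (p + q))) ψ where
  mfderiv_single : ∀ z ∈ ψ.source, ∀ i,
    mfderiv 𝓘(ℝ, AngleModel p q) (𝓡 (p + q)) ψ z (Pi.single i (1 : ℝ), 0) = X i (ψ z)
  integral_eq : ∀ z ∈ ψ.source, ∀ j, F j (ψ z) = z.2 j

variable {X : Fin p → SmoothVF (p + q) M} {F : Fin q → SmoothFun (p + q) M}

/-- The first integrals as one map to `ℝ^q`. -/
def integralMap (F : Fin q → SmoothFun (p + q) M) (x : M) : EuclideanSpace ℝ (Fin q) :=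
  WithLp.toLp 2 fun j => F j x

theorem contMDiff_integralMap (F : Fin q → SmoothFun (p + q) M) :
    ContMDiff (𝓡 (p + q)) 𝓘(ℝ, EuclideanSpace ℝ (Fin q)) ∞ (integralMap F) := by
  have h : ContMDiff (𝓡 (p + q)) 𝓘(ℝ, Fin q → ℝ) ∞ (fun x j => F j x) :=
    contMDiff_pi_space.2 fun j => (F j).contMDiff
  have h2 : ContDiff ℝ ∞ (WithLp.toLp 2 : (Fin q → ℝ) → EuclideanSpace ℝ (Fin q)) :=
    (PiLp.continuousLinearEquiv 2 ℝ fun _ : Fin q => ℝ).symm.contDiff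
  exact h2.contMDiff.comp h

theorem mfderiv_integralMap (F : Fin q → SmoothFun (p + q) M) (x : M)
    (v : TangentSpace (𝓡 (p + q)) x) (j : Fin q) :
    (EuclideanSpace.proj (𝕜 := ℝ) j : EuclideanSpace ℝ (Fin q) →L[ℝ] ℝ)
      (mfderiv (𝓡 (p + q)) 𝓘(ℝ, EuclideanSpace ℝ (Fin q)) (integralMap F) x v) = differential (F j) x v := by
  have h1 : F j = (EuclideanSpace.proj (𝕜 := ℝ) j : EuclideanSpace ℝ (Fin q) →L[ℝ] ℝ) ∘
    integralMap F := rfl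
  have h2 := mfderiv_comp x
    (I' := 𝓘(ℝ, EuclideanSpace ℝ (Fin q))) (I'' := 𝓘(ℝ, ℝ))
    (g := (EuclideanSpace.proj (𝕜 := ℝ) j : EuclideanSpace ℝ (Fin q) →L[ℝ] ℝ))
    (ContinuousLinearMap.differentiableAt _).mdifferentiableAt
    ((contMDiff_integralMap F x).mdifferentiableAt (by simp))
  rw [← h1] at h2
  rw [differential, h2, mfderiv_eq_fderiv, ContinuousLinearMap.fderiv]
  rfl

end FlowBox

/-- The linear map with prescribed values on the standard basis of `ℝ^p`. -/
def columnMap {p : ℕ} {V : Type*} [NormedAddCommGroup V] [NormedSpace ℝ V] (y : Fin p → V) :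
    (Fin p → ℝ) →L[ℝ] V :=
  ∑ i, (ContinuousLinearMap.proj (R := ℝ) (φ := fun _ : Fin p => ℝ) i).smulRight (y i)

theorem columnMap_apply {p : ℕ} {V : Type*} [NormedAddCommGroup V] [NormedSpace ℝ V]
    (y : Fin p → V) (c : Fin p → ℝ) : columnMap y c = ∑ i, c i • y i := by
  simp [columnMap]

theorem columnMap_single {p : ℕ} {V : Type*} [NormedAddCommGroup V] [NormedSpace ℝ V]
    (y : Fin p → V) (i : Fin p) : columnMap y (Pi.single i 1) = y i := by
  rw [columnMap_apply, Finset.sum_eq_single i]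
  · simp
  · intro j _ hj; simp [hj]
  · simp

/-- Commuting vector fields tangent to the first factor, forming a frame there, are the coordinate
fields of a smooth function. -/
theorem exists_straightening_function {p : ℕ} {R : Type} [NormedAddCommGroup R] [NormedSpace ℝ R]
    [FiniteDimensional ℝ R] {W : Set ((Fin p → ℝ) × R)} (hW : IsOpen W) {z₀ : (Fin p → ℝ) × R}
    (hz₀ : z₀ ∈ W) {Y : Fin p → (Fin p → ℝ) × R → (Fin p → ℝ)}
    (hY : ∀ i, ContDiffOn ℝ ∞ (Y i) W)
    (hbr : ∀ z ∈ W, ∀ i j, fderiv ℝ (Y j) z (Y i z, 0) = fderiv ℝ (Y i) z (Y j z, 0))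
    (hind : LinearIndependent ℝ fun i => Y i z₀) :
    ∃ T : (Fin p → ℝ) × R → (Fin p → ℝ), ContDiff ℝ ∞ T ∧
      (∀ᶠ z in 𝓝 z₀, ∀ i, fderiv ℝ T z (Y i z, 0) = Pi.single i 1) := by
  let A : (Fin p → ℝ) × R → (Fin p → ℝ) →L[ℝ] (Fin p → ℝ) := fun z => columnMap fun i => Y i z
  have hA : ContDiffOn ℝ ∞ A W := by
    refine ContDiffOn.sum fun i _ => ?_
    exact ((ContinuousLinearMap.smulRightL ℝ (Fin p → ℝ) (Fin p → ℝ)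
      (ContinuousLinearMap.proj (R := ℝ) (φ := fun _ : Fin p => ℝ) i)).contDiff).comp_contDiffOn (hY i)
  have hAi : ∀ z i, A z (Pi.single i 1) = Y i z := fun z i => columnMap_single _ i
  have hA₀inj : Function.Injective (A z₀) := by
    rw [injective_iff_map_eq_zero]
    intro c hc
    change columnMap _ c = 0 at hc
    rw [columnMap_apply] at hc
    exact funext (Fintype.linearIndependent_iff.1 hind c hc)
  have hA₀surj : Function.Surjective (A z₀) :=
    (LinearMap.injective_iff_surjective (f := (A z₀ : (Fin p → ℝ) →ₗ[ℝ] (Fin p → ℝ)))).1 hA₀inj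
  let e₀ : (Fin p → ℝ) ≃L[ℝ] (Fin p → ℝ) := ContinuousLinearEquiv.ofBijective (A z₀)
    (LinearMap.ker_eq_bot.2 hA₀inj) (LinearMap.range_eq_top.2 hA₀surj)
  set W' := W ∩ A ⁻¹' range ((↑) : ((Fin p → ℝ) ≃L[ℝ] (Fin p → ℝ)) → (Fin p → ℝ) →L[ℝ] (Fin p → ℝ))
    with hW'def
  have hW' : IsOpen W' := hA.continuousOn.isOpen_inter_preimage hW (ContinuousLinearEquiv.isOpen (𝕜 := ℝ))
  have hz₀' : z₀ ∈ W' := ⟨hz₀, e₀, rfl⟩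
  -- `α` is the coframe dual to the `Y i`: any `T` whose differential along the first factor is `α`
  -- straightens the frame.
  let α : (Fin p → ℝ) × R → (Fin p → ℝ) →L[ℝ] (Fin p → ℝ) := fun z => (A z).inverse
  have hα : ContDiffOn ℝ ∞ α W' := by
    rintro z ⟨hz, e, he⟩
    have h1 : ContDiffAt ℝ ∞ ContinuousLinearMap.inverse (A z) := by
      rw [← he]; exact contDiffAt_map_inverse e
    exact (h1.comp z (hA.contDiffAt (hW.mem_nhds hz))).contDiffWithinAt
  have hαA : ∀ z ∈ W', ∀ i, α z (Y i z) = Pi.single i 1 := by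
    rintro z ⟨hz, e, he⟩ i
    have : (A z).IsInvertible := ⟨e, he⟩
    rw [← hAi z i]
    exact this.inverse_apply_self _
  have hAα : ∀ z ∈ W', ∀ v, v = ∑ i, α z v i • Y i z := by
    rintro z ⟨hz, e, he⟩ v
    have : (A z).IsInvertible := ⟨e, he⟩
    rw [← columnMap_apply]
    exact (this.self_apply_inverse v).symm
  -- Differentiate the constant function z ↦ α z (Y i z).
  have hderiv : ∀ z ∈ W', ∀ i, ∀ d, fderiv ℝ α z d (Y i z) = - α z (fderiv ℝ (Y i) z d) := by
    intro z hz i d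
    have h1 : HasFDerivAt (fun z => α z (Y i z)) _ z :=
      ((hα.contDiffAt (hW'.mem_nhds hz)).differentiableAt (by simp)).hasFDerivAt.clm_apply
      (((hY i).contDiffAt (hW.mem_nhds hz.1)).differentiableAt (by simp)).hasFDerivAt
    have h2 : HasFDerivAt (fun z => α z (Y i z)) (0 : (Fin p → ℝ) × R →L[ℝ] (Fin p → ℝ)) z := by
      refine (hasFDerivAt_const (Pi.single i (1 : ℝ) : Fin p → ℝ) z).congr_of_eventuallyEq ?_
      filter_upwards [hW'.mem_nhds hz] with y hy
      exact hαA y hy i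
    have h3 := congrArg (fun B => B d) (h1.unique h2)
    simp at h3
    rw [eq_neg_iff_add_eq_zero, add_comm]
    exact h3
  -- Expanding v and w in the frame reduces closedness to the symmetry in i, j of α(DY_j · Y_i),
  -- which is the vanishing of the brackets.
  have hclosed : ∀ z ∈ W', ∀ v w : Fin p → ℝ, fderiv ℝ α z (v, 0) w = fderiv ℝ α z (w, 0) v := by
    intro z hz v w
    have hlin : ∀ c : Fin p → ℝ, ((∑ i, c i • Y i z, 0) : (Fin p → ℝ) × R) =
        ∑ i, c i • ((Y i z, 0) : (Fin p → ℝ) × R) := fun c => by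
      refine Prod.ext ?_ ?_
      · simp [Prod.fst_sum]
      · simp [Prod.snd_sum]
    have key : ∀ c d : Fin p → ℝ, fderiv ℝ α z (∑ i, c i • Y i z, 0) (∑ j, d j • Y j z) =
        - ∑ i, ∑ j, (c i * d j) • α z (fderiv ℝ (Y j) z (Y i z, 0)) := by
      intro c d
      rw [hlin, map_sum (fderiv ℝ α z), sum_apply, ← Finset.sum_neg_distrib]
      refine Finset.sum_congr rfl fun i _ => ?_
      rw [map_sum, ← Finset.sum_neg_distrib]
      refine Finset.sum_congr rfl fun j _ => ?_
      rw [map_smul, map_smul, smul_apply, hderiv z hz, smul_neg, smul_neg,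
        smul_smul, mul_comm]
    rw [hAα z hz v, hAα z hz w, key, key, Finset.sum_comm]
    congr 1
    refine Finset.sum_congr rfl fun j _ => Finset.sum_congr rfl fun i _ => ?_
    rw [hbr z hz.1 i j, mul_comm]
  obtain ⟨T, hT, hTα⟩ := exists_contDiff_primitive_fst hW' hz₀' hα hclosed
  refine ⟨T, hT, ?_⟩
  filter_upwards [hTα, hW'.mem_nhds hz₀'] with z hz hzW i
  rw [hz, hαA z hzW]

theorem mfderiv_clm_comp {E E' F : Type*} [NormedAddCommGroup E] [NormedSpace ℝ E]
    [NormedAddCommGroup E'] [NormedSpace ℝ E'] [NormedAddCommGroup F] [NormedSpace ℝ F]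
    {M : Type*} [TopologicalSpace M] [ChartedSpace E M] (A : E' →L[ℝ] F) {G : M → E'} {x : M}
    (hG : MDifferentiableAt 𝓘(ℝ, E) 𝓘(ℝ, E') G x) (v : TangentSpace 𝓘(ℝ, E) x) :
    mfderiv 𝓘(ℝ, E) 𝓘(ℝ, F) (fun y => A (G y)) x v =
      A (mfderiv 𝓘(ℝ, E) 𝓘(ℝ, E') G x v) := by
  have h := mfderiv_comp x (I' := 𝓘(ℝ, E')) (I'' := 𝓘(ℝ, F)) (g := A)
    A.differentiableAt.mdifferentiableAt hG
  rw [mfderiv_eq_fderiv, ContinuousLinearMap.fderiv] at h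
  exact congrArg (fun B => B v) h

section FlowBox

variable {p q : ℕ} {M : Type*} [TopologicalSpace M]
  [ChartedSpace (EuclideanSpace ℝ (Fin (p + q))) M] [IsManifold (𝓡 (p + q)) ∞ M]
  {X : Fin p → SmoothVF (p + q) M} {F : Fin q → SmoothFun (p + q) M}

theorem finrank_angleModel : Module.finrank ℝ (EuclideanSpace ℝ (Fin (p + q))) =
    Module.finrank ℝ (AngleModel p q) := by
  simp [AngleModel, Module.finrank_prod]

theorem mfderiv_integralMap_vectorField (hFI : ∀ i j, applyVF (X i) (F j) = 0) (i : Fin p) (x : M) :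
    mfderiv (𝓡 (p + q)) 𝓘(ℝ, EuclideanSpace ℝ (Fin q)) (integralMap F) x (X i x) =
      (0 : EuclideanSpace ℝ (Fin q)) := by
  refine PiLp.ext fun j => ?_
  have h1 := mfderiv_integralMap F x (X i x) j
  have h2 : differential (F j) x (X i x) = 0 := congrArg (fun f : SmoothFun (p + q) M => f x) (hFI i j)
  rw [h2] at h1
  exact h1

/-- Near a regular point, the first integrals can be completed to coordinates. -/
theorem exists_isSmoothParam_integral (hFI : ∀ i j, applyVF (X i) (F j) = 0) {x₀ : M}
    (hx₀ : IsRegularPoint X F x₀) :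
    ∃ g : OpenPartialHomeomorph (AngleModel p q) M,
      IsSmoothParam (E := EuclideanSpace ℝ (Fin (p + q))) g ∧ x₀ ∈ g.target ∧
      ∀ x ∈ g.target, (g.symm x).2 = integralMap F x := by
  let E := EuclideanSpace ℝ (Fin (p + q))
  let c := chartAt E x₀
  have hcc : ContMDiffOn 𝓘(ℝ, E) 𝓘(ℝ, E) ∞ c c.source := contMDiffOn_chart
  have hcs : ContMDiffOn 𝓘(ℝ, E) 𝓘(ℝ, E) ∞ c.symm c.target := contMDiffOn_chart_symm
  have hxc : x₀ ∈ c.source := mem_chart_source E x₀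
  have hloc : IsLocalDiffeomorphAt 𝓘(ℝ, E) 𝓘(ℝ, E) ∞ c x₀ :=
    ⟨⟨c.toPartialEquiv, c.open_source, c.open_target, hcc, hcs⟩, hxc, fun _ _ => rfl⟩
  let D : E →L[ℝ] E := mfderiv 𝓘(ℝ, E) 𝓘(ℝ, E) c x₀
  have hD : Function.Injective D := (hloc.mfderivToContinuousLinearEquiv (by simp)).injective
  let B : (Fin p → ℝ) →L[ℝ] E := columnMap fun i => D (X i x₀)
  have hind : LinearIndependent ℝ fun i => D (X i x₀) :=
    hx₀.1.map' (D : E →ₗ[ℝ] E) (LinearMap.ker_eq_bot.2 hD)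
  have hBinj : Function.Injective B := by
    rw [injective_iff_map_eq_zero]
    intro a ha
    change columnMap _ a = 0 at ha
    rw [columnMap_apply] at ha
    exact funext (Fintype.linearIndependent_iff.1 hind a ha)
  -- `l` recovers the coefficients along the frame at `x₀`; composed with the chart it supplies the
  -- p coordinates missing beside the first integrals.
  obtain ⟨l, hl⟩ := (B : (Fin p → ℝ) →ₗ[ℝ] E).exists_leftInverse_of_injective
    (LinearMap.ker_eq_bot.2 hBinj)
  let lc : E →L[ℝ] (Fin p → ℝ) := LinearMap.toContinuousLinearMap l
  have hlB : ∀ a, lc (B a) = a := fun a => congrArg (fun f => f a) hl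
  let G : M → AngleModel p q := fun x => (lc (c x), integralMap F x)
  have hlc : ContMDiffOn 𝓘(ℝ, E) 𝓘(ℝ, Fin p → ℝ) ∞ (fun x => lc (c x)) c.source :=
    lc.contDiff.contMDiff.comp_contMDiffOn hcc
  have hG : ContMDiffOn 𝓘(ℝ, E) 𝓘(ℝ, AngleModel p q) ∞ G c.source :=
    hlc.prodMk_space (contMDiff_integralMap F).contMDiffOn
  have hGD : ∀ v : E, mfderiv 𝓘(ℝ, E) 𝓘(ℝ, AngleModel p q) G x₀ v =
      ((lc (D v), mfderiv 𝓘(ℝ, E) 𝓘(ℝ, EuclideanSpace ℝ (Fin q)) (integralMap F) x₀ v) :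
        AngleModel p q) := by
    intro v
    have hGx : MDifferentiableAt 𝓘(ℝ, E) 𝓘(ℝ, AngleModel p q) G x₀ :=
      (hG.contMDiffAt (c.open_source.mem_nhds hxc)).mdifferentiableAt (by simp)
    refine Prod.ext ?_ ?_
    · refine (mfderiv_clm_comp (ContinuousLinearMap.fst ℝ _ _) hGx v).symm.trans ?_
      exact mfderiv_clm_comp lc
        ((hcc.contMDiffAt (c.open_source.mem_nhds hxc)).mdifferentiableAt (by simp)) v
    · exact (mfderiv_clm_comp (ContinuousLinearMap.snd ℝ _ _) hGx v).symm
  have hsurj : Function.Surjective (mfderiv 𝓘(ℝ, E) 𝓘(ℝ, AngleModel p q) G x₀) := by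
    rintro ⟨u, r⟩
    obtain ⟨v, hv⟩ := exists_forall_apply_eq_of_linearIndependent
      (E := TangentSpace (𝓡 (p + q)) x₀) hx₀.2 (fun j => r j)
    let v' : E := v
    let y : Fin p → E := fun i => X i x₀
    -- `v` realises the prescribed values of the dF_j. Adding multiples of the X_i corrects the
    -- first p components without changing those values, since dF_j(X_i) = 0.
    let w : E := v' + ∑ i, (u - lc (D v')) i • y i
    refine ⟨w, ?_⟩
    refine (hGD w).trans (Prod.ext ?_ ?_)
    · change lc (D w) = u
      have : D w = D v' + B (u - lc (D v')) := by
        change D (v' + ∑ i, (u - lc (D v')) i • y i) = D v' + columnMap (fun i => D (y i)) _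
        rw [map_add, map_sum, columnMap_apply]
        simp only [map_smul]
      rw [this, map_add, hlB]
      abel
    · refine PiLp.ext fun j => ?_
      have h1 := mfderiv_integralMap F x₀ w j
      refine h1.trans ?_
      have h2 : differential (F j) x₀ w = differential (F j) x₀ v +
          ∑ i, (u - lc (D v')) i • differential (F j) x₀ (X i x₀) := by
        refine (map_add (differential (F j) x₀) _ _).trans ?_
        congr 1
        refine (map_sum (differential (F j) x₀) _ _).trans ?_
        exact Finset.sum_congr rfl fun i _ => map_smul (differential (F j) x₀) _ _
      have h3 : ∀ i, differential (F j) x₀ (X i x₀) = 0 := fun i =>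
        congrArg (fun f : SmoothFun (p + q) M => f x₀) (hFI i j)
      rw [h2, hv j]
      simp [h3]
  have hbij : Function.Bijective (mfderiv 𝓘(ℝ, E) 𝓘(ℝ, AngleModel p q) G x₀) := by
    let A : E →L[ℝ] AngleModel p q := mfderiv 𝓘(ℝ, E) 𝓘(ℝ, AngleModel p q) G x₀
    exact ⟨(LinearMap.injective_iff_surjective_of_finrank_eq_finrank
      (f := (A : E →ₗ[ℝ] AngleModel p q)) finrank_angleModel).2 hsurj, hsurj⟩
  obtain ⟨g, hg, hxg, hgs, hgG⟩ := exists_isSmoothParam_of_bijective_mfderiv c.open_source hG hxc hbij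
  refine ⟨g, hg, hxg, fun x hx => ?_⟩
  rw [hgG x hx]

end FlowBox

section FlowBox

variable {p q : ℕ} {M : Type*} [TopologicalSpace M]
  [ChartedSpace (EuclideanSpace ℝ (Fin (p + q))) M] [IsManifold (𝓡 (p + q)) ∞ M]
  {X : Fin p → SmoothVF (p + q) M} {F : Fin q → SmoothFun (p + q) M}

/-- A vector field on `M` read in a parametrization. -/
def pullVF (g : OpenPartialHomeomorph (AngleModel p q) M) (V : SmoothVF (p + q) M)
    (z : AngleModel p q) : AngleModel p q :=
  VectorField.mpullback 𝓘(ℝ, AngleModel p q) (𝓡 (p + q)) g (fun x => V x) z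

variable {g : OpenPartialHomeomorph (AngleModel p q) M}

theorem pullVF_eq (hg : IsSmoothParam (E := EuclideanSpace ℝ (Fin (p + q))) g)
    (V : SmoothVF (p + q) M) {z : AngleModel p q} (hz : z ∈ g.source) :
    pullVF g V z = mfderiv (𝓡 (p + q)) 𝓘(ℝ, AngleModel p q) g.symm (g z) (V (g z)) := by
  rw [pullVF, VectorField.mpullback_apply, hg.inverse_mfderiv hz]
  rfl

theorem contDiffOn_pullVF (hg : IsSmoothParam (E := EuclideanSpace ℝ (Fin (p + q))) g)
    (V : SmoothVF (p + q) M) : ContDiffOn ℝ ∞ (pullVF g V) g.source := by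
  intro z hz
  refine ContDiffAt.contDiffWithinAt ?_
  refine contMDiffAt_vectorSpace_iff_contDiffAt.1 ?_
  exact ContMDiffAt.mpullback_vectorField_preimage (V.contMDiff_toFun (g z))
    (hg.contMDiffOn.contMDiffAt (g.open_source.mem_nhds hz)) (hg.isInvertible_mfderiv hz) (by simp)

/-- Lie brackets are natural under pullback, and in a vector space a vanishing bracket is exactly
this symmetry of derivatives. -/
theorem fderiv_pullVF_comm (hg : IsSmoothParam (E := EuclideanSpace ℝ (Fin (p + q))) g)
    {V W : SmoothVF (p + q) M} (hVW : ∀ x, VectorField.mlieBracket (𝓡 (p + q)) V W x = 0)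
    {z : AngleModel p q} (hz : z ∈ g.source) :
    fderiv ℝ (pullVF g W) z (pullVF g V z) = fderiv ℝ (pullVF g V) z (pullVF g W z) := by
  have : IsManifold (𝓡 (p + q)) (minSmoothness ℝ 2) M := by
    rw [minSmoothness_of_isRCLikeNormedField]
    exact IsManifold.of_le (n := ∞) (by norm_cast)
  have : IsManifold 𝓘(ℝ, AngleModel p q) (minSmoothness ℝ 2) (AngleModel p q) := by
    infer_instance
  have h := VectorField.mpullback_mlieBracket (n := ∞) (x₀ := z) (f := g)
    (I := 𝓘(ℝ, AngleModel p q)) (I' := 𝓡 (p + q))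
    ((V.contMDiff_toFun (g z)).mdifferentiableAt (by simp))
    ((W.contMDiff_toFun (g z)).mdifferentiableAt (by simp))
    (hg.contMDiffOn.contMDiffAt (g.open_source.mem_nhds hz))
    (by rw [minSmoothness_of_isRCLikeNormedField]; norm_cast)
  rw [VectorField.mpullback_apply] at h
  have h0 : VectorField.mlieBracket (𝓡 (p + q)) (fun x => V x) (fun x => W x) (g z) = 0 := hVW (g z)
  have h1 := h.symm.trans (congrArg (mfderiv 𝓘(ℝ, AngleModel p q) (𝓡 (p + q)) g z).inverse h0)
  rw [map_zero, ← VectorField.mlieBracketWithin_univ,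
    VectorField.mlieBracketWithin_eq_lieBracketWithin] at h1
  have h2 : VectorField.lieBracketWithin ℝ (pullVF g V) (pullVF g W) univ z = 0 := h1
  rw [VectorField.lieBracketWithin_univ, VectorField.lieBracket_eq] at h2
  exact sub_eq_zero.1 h2

/-- The commuting frame can be straightened near a regular point. -/
theorem exists_isFlowBox (hcomm : ∀ i j x, VectorField.mlieBracket (𝓡 (p + q)) (X i) (X j) x = 0)
    (hFI : ∀ i j, applyVF (X i) (F j) = 0) {x₀ : M} (hx₀ : IsRegularPoint X F x₀)
    {O : Set M} (hO : IsOpen O) (hx₀O : x₀ ∈ O) :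
    ∃ ψ : OpenPartialHomeomorph (AngleModel p q) M,
      IsFlowBox X F ψ ∧ x₀ ∈ ψ.target ∧ ψ.target ⊆ O := by
  obtain ⟨g, hg, hxg, hgF⟩ := exists_isSmoothParam_integral hFI hx₀
  let z₀ := g.symm x₀
  have hz₀ : z₀ ∈ g.source := g.map_target hxg
  have hgz₀ : g z₀ = x₀ := g.right_inv hxg
  -- The second component of these coordinates is `integralMap F`, which the X_i annihilate: the
  -- pulled-back fields are tangent to the first factor.
  have hsnd : ∀ i, ∀ z ∈ g.source, (pullVF g (X i) z).2 = 0 := by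
    intro i z hz
    rw [pullVF_eq hg _ hz]
    have h1 := mfderiv_clm_comp (ContinuousLinearMap.snd ℝ (Fin p → ℝ) (EuclideanSpace ℝ (Fin q)))
      (hg.mdifferentiableAt_symm (g.map_source hz)) (X i (g z))
    have h2 : (fun y => ContinuousLinearMap.snd ℝ (Fin p → ℝ) (EuclideanSpace ℝ (Fin q)) (g.symm y))
        =ᶠ[𝓝 (g z)] integralMap F := by
      filter_upwards [g.open_target.mem_nhds (g.map_source hz)] with y hy using hgF y hy
    have h3 := congrArg (fun A : EuclideanSpace ℝ (Fin (p + q)) →L[ℝ] EuclideanSpace ℝ (Fin q) =>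
      A (X i (g z)))
      (h2.mfderiv_eq (I := 𝓡 (p + q)) (I' := 𝓘(ℝ, EuclideanSpace ℝ (Fin q))))
    exact h1.symm.trans (h3.trans (mfderiv_integralMap_vectorField hFI i (g z)))
  have hpair : ∀ i, ∀ z ∈ g.source, pullVF g (X i) z = ((pullVF g (X i) z).1, 0) :=
    fun i z hz => Prod.ext rfl (hsnd i z hz)
  have hsm : ∀ i, ContDiffOn ℝ ∞ (fun z => (pullVF g (X i) z).1) g.source :=
    fun i => contDiff_fst.comp_contDiffOn (contDiffOn_pullVF hg (X i))
  have hfst : ∀ i, ∀ z ∈ g.source, ∀ v, fderiv ℝ (fun z => (pullVF g (X i) z).1) z v =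
      (fderiv ℝ (pullVF g (X i)) z v).1 := by
    intro i z hz v
    have h1 : DifferentiableAt ℝ (pullVF g (X i)) z :=
      ((contDiffOn_pullVF hg (X i)).contDiffAt (g.open_source.mem_nhds hz)).differentiableAt (by simp)
    rw [fderiv.fst h1]
    rfl
  have hind : LinearIndependent ℝ fun i => (pullVF g (X i) z₀).1 := by
    rw [Fintype.linearIndependent_iff]
    intro c hc
    have h0 : LinearIndependent ℝ fun i => X i (g z₀) := by rw [hgz₀]; exact hx₀.1
    refine Fintype.linearIndependent_iff.1 h0 c ?_
    have h1 : ∑ i, c i • pullVF g (X i) z₀ = 0 := by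
      refine Prod.ext ?_ ?_
      · rw [Prod.fst_sum]; exact hc
      · rw [Prod.snd_sum]
        exact Finset.sum_eq_zero fun i _ => by rw [Prod.smul_snd, hsnd i z₀ hz₀, smul_zero]
    let D : AngleModel p q →L[ℝ] EuclideanSpace ℝ (Fin (p + q)) :=
      mfderiv 𝓘(ℝ, AngleModel p q) (𝓡 (p + q)) g z₀
    have h2 := congrArg D h1
    rw [map_zero, map_sum] at h2
    refine Eq.trans (Finset.sum_congr rfl fun i _ => ?_) h2
    rw [map_smul, pullVF_eq hg _ hz₀]
    exact congrArg (fun w : EuclideanSpace ℝ (Fin (p + q)) => c i • w)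
      (hg.mfderiv_mfderiv_symm hz₀ (X i (g z₀))).symm
  obtain ⟨T, hT, hTev⟩ := exists_straightening_function g.open_source hz₀ hsm (by
    intro z hz i j
    rw [← hpair i z hz, ← hpair j z hz, hfst j z hz, hfst i z hz,
      fderiv_pullVF_comm hg (hcomm i j) hz]) hind
  obtain ⟨W, hWsub, hWo, hzW⟩ := _root_.eventually_nhds_iff.1 (hTev.and (g.open_source.mem_nhds hz₀))
  -- Only the first p coordinates are changed, so the first integrals remain coordinates while the
  -- fields become the standard basis vectors.
  let S : AngleModel p q → AngleModel p q := fun z => (T z, z.2)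
  have hS : ContDiff ℝ ∞ S := hT.prodMk contDiff_snd
  have hSD : ∀ z v, fderiv ℝ S z v = (fderiv ℝ T z v, v.2) := by
    intro z v
    have h1 : HasFDerivAt S ((fderiv ℝ T z).prod (ContinuousLinearMap.snd ℝ _ _)) z :=
      ((hT.differentiable (by simp) z).hasFDerivAt).prodMk hasFDerivAt_snd
    rw [h1.fderiv]
    rfl
  have hSY : ∀ z ∈ W, ∀ i, fderiv ℝ S z (pullVF g (X i) z) = (Pi.single i 1, 0) := by
    intro z hz i
    rw [hSD, hsnd i z (hWsub z hz).2]
    refine Prod.ext ?_ rfl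
    rw [hpair i z (hWsub z hz).2]
    exact (hWsub z hz).1 i
  have hSsurj : Function.Surjective (fderiv ℝ S z₀) := by
    rintro ⟨u, r⟩
    let c := u - fderiv ℝ T z₀ (0, r)
    refine ⟨(0, r) + ∑ i, c i • pullVF g (X i) z₀, ?_⟩
    rw [map_add, map_sum]
    simp only [map_smul, hSY z₀ hzW]
    rw [hSD]
    refine Prod.ext ?_ ?_
    · have h1 : ∑ i, c i • (Pi.single i (1 : ℝ) : Fin p → ℝ) = c := by
        exact (pi_eq_sum_univ' c).symm
      rw [Prod.fst_add, Prod.fst_sum]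
      simp only [Prod.smul_fst]
      rw [h1]
      simp [c]
    · simp [Prod.snd_sum]
  have hSbij : Function.Bijective (fderiv ℝ S z₀) :=
    ⟨(LinearMap.injective_iff_surjective
      (f := (fderiv ℝ S z₀ : AngleModel p q →ₗ[ℝ] AngleModel p q))).2 hSsurj, hSsurj⟩
  let f : M → AngleModel p q := fun x => S (g.symm x)
  let O' := O ∩ (g.target ∩ g.symm ⁻¹' W)
  have hO' : IsOpen O' := hO.inter (g.isOpen_inter_preimage_symm hWo)
  have hf : ContMDiffOn (𝓡 (p + q)) 𝓘(ℝ, AngleModel p q) ∞ f O' :=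
    hS.contMDiff.comp_contMDiffOn (hg.contMDiffOn_symm.mono fun x hx => hx.2.1)
  have hfD : ∀ z ∈ g.source, ∀ v, mfderiv (𝓡 (p + q)) 𝓘(ℝ, AngleModel p q) f (g z) v =
      fderiv ℝ S z (mfderiv (𝓡 (p + q)) 𝓘(ℝ, AngleModel p q) g.symm (g z) v) := by
    intro z hz v
    have h := mfderiv_comp (g z) (I' := 𝓘(ℝ, AngleModel p q)) (I'' := 𝓘(ℝ, AngleModel p q)) (g := S)
      (hS.differentiable (by simp) _).mdifferentiableAt
      (hg.mdifferentiableAt_symm (g.map_source hz))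
    rw [mfderiv_eq_fderiv, g.left_inv hz] at h
    exact congrArg (fun B : EuclideanSpace ℝ (Fin (p + q)) →L[ℝ] AngleModel p q => B v) h
  have hbij : Function.Bijective (mfderiv (𝓡 (p + q)) 𝓘(ℝ, AngleModel p q) f x₀) := by
    have h1 : (mfderiv (𝓡 (p + q)) 𝓘(ℝ, AngleModel p q) f (g z₀) :
        EuclideanSpace ℝ (Fin (p + q)) → AngleModel p q) = (fderiv ℝ S z₀) ∘
        (mfderiv (𝓡 (p + q)) 𝓘(ℝ, AngleModel p q) g.symm (g z₀)) := funext fun v => hfD z₀ hz₀ v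
    have h2 : Function.Bijective (mfderiv (𝓡 (p + q)) 𝓘(ℝ, AngleModel p q) g.symm (g z₀)) := by
      rw [← hg.inverse_mfderiv hz₀]
      exact (hg.isInvertible_mfderiv hz₀).inverse.bijective
    have h3 := hSbij.comp h2
    rw [← h1, hgz₀] at h3
    exact h3
  obtain ⟨ψ, hψ, hxψ, hψO, hψf⟩ := exists_isSmoothParam_of_bijective_mfderiv hO' hf
    ⟨hx₀O, hxg, hzW⟩ hbij
  refine ⟨ψ, ⟨hψ, ?_, ?_⟩, hxψ, hψO.trans inter_subset_left⟩
  · intro z hz i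
    have hx := ψ.map_source hz
    obtain ⟨hxg', hxW⟩ := (hψO hx).2
    have h1 : mfderiv (𝓡 (p + q)) 𝓘(ℝ, AngleModel p q) ψ.symm (ψ z) (X i (ψ z)) =
        ((Pi.single i 1, 0) : AngleModel p q) := by
      have h2 : ψ.symm =ᶠ[𝓝 (ψ z)] f := by
        filter_upwards [ψ.open_target.mem_nhds hx] with y hy using hψf y hy
      have h3 := hfD (g.symm (ψ z)) (g.map_target hxg')
      have h4 := hSY _ hxW i
      rw [pullVF_eq hg _ (g.map_target hxg')] at h4
      rw [g.right_inv hxg'] at h3 h4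
      exact (congrArg (fun A : EuclideanSpace ℝ (Fin (p + q)) →L[ℝ] AngleModel p q =>
        A (X i (ψ z)))
        (h2.mfderiv_eq (I := 𝓡 (p + q)) (I' := 𝓘(ℝ, AngleModel p q)))).trans ((h3 _).trans h4)
    rw [← h1]
    exact hψ.mfderiv_mfderiv_symm hz _
  · intro z hz j
    have hx := ψ.map_source hz
    have h1 : (ψ.symm (ψ z)).2 = integralMap F (ψ z) := by
      rw [hψf _ hx]
      exact hgF _ (hψO hx).2.1
    rw [ψ.left_inv hz] at h1
    rw [h1]
    rfl

end FlowBox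

/-! ### Translations in flow boxes as integral curves. -/

section IntegralCurves

variable {p q : ℕ} {M : Type*} [TopologicalSpace M]
  [ChartedSpace (EuclideanSpace ℝ (Fin (p + q))) M] [IsManifold (𝓡 (p + q)) ∞ M]
  {X : Fin p → SmoothVF (p + q) M} {F : Fin q → SmoothFun (p + q) M}

/-- The combination `∑ v_i X_i` with constant coefficients. -/
def combVF (X : Fin p → SmoothVF (p + q) M) (v : Fin p → ℝ) : SmoothVF (p + q) M :=
  ∑ i, v i • X i

theorem combVF_apply (v : Fin p → ℝ) (x : M) : combVF X v x = ∑ i, v i • X i x := by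
  have h : ∀ s : Finset (Fin p), (∑ i ∈ s, v i • X i) x = ∑ i ∈ s, v i • X i x := by
    intro s
    induction s using Finset.induction_on with
    | empty => rfl
    | insert a s ha ih => rw [Finset.sum_insert ha, Finset.sum_insert ha, ← ih]; rfl
  exact h Finset.univ

theorem IsFlowBox.mfderiv_apply {ψ : OpenPartialHomeomorph (AngleModel p q) M}
    (hψ : IsFlowBox X F ψ) {z : AngleModel p q} (hz : z ∈ ψ.source) (v : Fin p → ℝ) :
    mfderiv 𝓘(ℝ, AngleModel p q) (𝓡 (p + q)) ψ z (v, 0) = combVF X v (ψ z) := by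
  rw [combVF_apply]
  let D : AngleModel p q →L[ℝ] EuclideanSpace ℝ (Fin (p + q)) :=
    mfderiv 𝓘(ℝ, AngleModel p q) (𝓡 (p + q)) ψ z
  have h1 : ((v, 0) : AngleModel p q) = ∑ i, v i • ((Pi.single i (1 : ℝ), 0) : AngleModel p q) := by
    refine Prod.ext ?_ ?_
    · rw [Prod.fst_sum]
      exact pi_eq_sum_univ' v
    · simp [Prod.snd_sum]
  have h2 : D (v, 0) = ∑ i, v i • D (Pi.single i (1 : ℝ), 0) := by
    rw [h1, map_sum]
    exact Finset.sum_congr rfl fun i _ => map_smul D _ _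
  refine h2.trans (Finset.sum_congr rfl fun i _ => ?_)
  exact congrArg (fun w : EuclideanSpace ℝ (Fin (p + q)) => v i • w) (hψ.mfderiv_single z hz i)

theorem IsFlowBox.isMIntegralCurveOn {ψ : OpenPartialHomeomorph (AngleModel p q) M}
    (hψ : IsFlowBox X F ψ) {z : AngleModel p q} {v : Fin p → ℝ} {s : Set ℝ}
    (hs : ∀ t ∈ s, z + t • ((v, 0) : AngleModel p q) ∈ ψ.source) :
    IsMIntegralCurveOn (I := 𝓡 (p + q)) (fun t : ℝ => ψ (z + t • ((v, 0) : AngleModel p q)))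
      (fun x => combVF X v x) s := by
  intro t ht
  refine HasMFDerivAt.hasMFDerivWithinAt ?_
  have h1 : HasFDerivAt (fun t : ℝ => z + t • ((v, 0) : AngleModel p q))
      ((1 : ℝ →L[ℝ] ℝ).smulRight ((v, 0) : AngleModel p q)) t :=
    ((hasFDerivAt_id t).smul_const ((v, 0) : AngleModel p q)).const_add z
  have h2 := (hψ.mdifferentiableAt (hs t ht)).hasMFDerivAt.comp t h1.hasMFDerivAt
  have h3 : (mfderiv 𝓘(ℝ, AngleModel p q) (𝓡 (p + q)) ψ
      (z + t • ((v, 0) : AngleModel p q))).comp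
      ((1 : ℝ →L[ℝ] ℝ).smulRight ((v, 0) : AngleModel p q)) = (1 : ℝ →L[ℝ] ℝ).smulRight
        (combVF X v (ψ (z + t • ((v, 0) : AngleModel p q)))) := by
    ext
    change mfderiv 𝓘(ℝ, AngleModel p q) (𝓡 (p + q)) ψ _ ((1 : ℝ) • ((v, 0) : AngleModel p q)) =
      (1 : ℝ) • combVF X v (ψ (z + t • ((v, 0) : AngleModel p q)))
    rw [one_smul, one_smul]
    exact hψ.mfderiv_apply (hs t ht) v
  exact h3 ▸ h2

/-- The translation along `v` is the same in all flow boxes. -/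
theorem IsFlowBox.translate_eq [T2Space M] {ψ ψ' : OpenPartialHomeomorph (AngleModel p q) M}
    (hψ : IsFlowBox X F ψ) (hψ' : IsFlowBox X F ψ') {z z' : AngleModel p q} {v : Fin p → ℝ}
    (hs : ∀ t ∈ Icc (0 : ℝ) 1, z + t • ((v, 0) : AngleModel p q) ∈ ψ.source)
    (hs' : ∀ t ∈ Icc (0 : ℝ) 1, z' + t • ((v, 0) : AngleModel p q) ∈ ψ'.source)
    (h : ψ z = ψ' z') : ψ (z + (v, 0)) = ψ' (z' + (v, 0)) := by
  have hopen : IsOpen {t : ℝ | z + t • ((v, 0) : AngleModel p q) ∈ ψ.source ∧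
      z' + t • ((v, 0) : AngleModel p q) ∈ ψ'.source} :=
    (ψ.open_source.preimage (f := fun t : ℝ => z + t • ((v, 0) : AngleModel p q)) (by fun_prop)).inter
      (ψ'.open_source.preimage (f := fun t : ℝ => z' + t • ((v, 0) : AngleModel p q)) (by fun_prop))
  -- Uniqueness of integral curves is applied on an open interval, so the closed time interval is
  -- thickened by compactness while both curves stay in their boxes.
  obtain ⟨δ, hδ, hδs⟩ := isCompact_Icc.exists_thickening_subset_open hopen
    (fun t ht => ⟨hs t ht, hs' t ht⟩)
  have hsub : ∀ t ∈ Ioo (-δ) (1 + δ), z + t • ((v, 0) : AngleModel p q) ∈ ψ.source ∧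
      z' + t • ((v, 0) : AngleModel p q) ∈ ψ'.source := by
    intro t ht
    apply hδs
    rw [Metric.mem_thickening_iff]
    by_cases h0 : t < 0
    · exact ⟨0, ⟨le_rfl, zero_le_one⟩, by rw [Real.dist_eq, abs_lt]; constructor <;> linarith [ht.1]⟩
    · by_cases h1 : 1 < t
      · exact ⟨1, ⟨zero_le_one, le_rfl⟩, by
          rw [Real.dist_eq, abs_lt]; constructor <;> linarith [ht.2]⟩
      · exact ⟨t, ⟨not_lt.1 h0, not_lt.1 h1⟩, by rwa [dist_self]⟩
  have := isMIntegralCurveOn_Ioo_eqOn_of_contMDiff_boundaryless (I := 𝓡 (p + q)) (t₀ := 0)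
    (a := -δ) (b := 1 + δ) (v := fun x => combVF X v x) ⟨by linarith, by linarith⟩
    ((combVF X v).contMDiff_toFun.of_le (by norm_cast))
    (hψ.isMIntegralCurveOn fun t ht => (hsub t ht).1)
    (hψ'.isMIntegralCurveOn fun t ht => (hsub t ht).2) (by simpa using h)
  have h1 := this (x := 1) ⟨by linarith, by linarith⟩
  simpa using h1

theorem IsFlowBox.restr {ψ : OpenPartialHomeomorph (AngleModel p q) M} (hψ : IsFlowBox X F ψ)
    {O : Set M} (hO : IsOpen O) :
    ∃ ψ' : OpenPartialHomeomorph (AngleModel p q) M, IsFlowBox X F ψ' ∧ ψ'.target = ψ.target ∩ O := by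
  have ho : IsOpen (ψ.source ∩ ψ ⁻¹' O) := ψ.isOpen_inter_preimage hO
  refine ⟨ψ.restrOpen _ ho, ⟨⟨?_, ?_⟩, ?_, ?_⟩, ?_⟩
  · exact hψ.contMDiffOn.mono fun z hz => hz.1
  · exact hψ.contMDiffOn_symm.mono fun z hz => hz.1
  · exact fun z hz i => hψ.mfderiv_single z hz.1 i
  · exact fun z hz j => hψ.integral_eq z hz.1 j
  · ext x
    constructor
    · intro hx
      have h1 : x ∈ ψ.target := hx.1
      have h2 : ψ (ψ.symm x) ∈ O := hx.2.2
      rw [ψ.right_inv h1] at h2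
      exact ⟨h1, h2⟩
    · rintro ⟨h1, h2⟩
      refine ⟨h1, ψ.map_target h1, ?_⟩
      change ψ (ψ.symm x) ∈ O
      rwa [ψ.right_inv h1]

end IntegralCurves

/-! ### From small vectors to all vectors. -/

/-- A property of vectors stable under sums holds for all vectors if it holds for small ones. -/
theorem forall_of_forall_norm_lt {V : Type*} [NormedAddCommGroup V] [NormedSpace ℝ V] {ε : ℝ}
    (hε : 0 < ε) {P : V → Prop} (hsmall : ∀ t, ‖t‖ < ε → P t) (hadd : ∀ s t, P s → P t → P (s + t))
    (t : V) : P t := by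
  have h1 : ∀ (n : ℕ) (t : V), ‖t‖ < ε → P ((n : ℝ) • t) := by
    intro n t ht
    induction n with
    | zero => exact hsmall _ (by simpa using hε)
    | succ n ih =>
      push_cast
      rw [add_smul, one_smul]
      exact hadd _ _ ih (hsmall t ht)
  obtain ⟨n, hn⟩ := exists_nat_gt (‖t‖ / ε)
  have hn0 : (0 : ℝ) < n := lt_of_le_of_lt (by positivity) hn
  have h2 := h1 n ((n : ℝ)⁻¹ • t) (by
    rw [norm_smul, norm_inv, Real.norm_natCast, inv_mul_lt_iff₀ hn0]
    exact (div_lt_iff₀ hε).1 hn)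
  rwa [smul_smul, mul_inv_cancel₀ hn0.ne', one_smul] at h2

/-- A local homomorphism from a normed space to a monoid extends to a homomorphism. -/
theorem exists_monoidHom_extending {V G : Type*} [NormedAddCommGroup V] [NormedSpace ℝ V] [Monoid G]
    {ε : ℝ} (hε : 0 < ε) {g : V → G} (g_zero : g 0 = 1)
    (g_add : ∀ s t, ‖s‖ < ε → ‖t‖ < ε → ‖s + t‖ < ε → g (s + t) = g s * g t) :
    ∃ A : V → G, (∀ s t, A (s + t) = A s * A t) ∧ ∀ t, ‖t‖ < ε → A t = g t := by
  have hpow : ∀ (n : ℕ) (t : V), ‖(n : ℝ) • t‖ < ε → ‖t‖ < ε → g ((n : ℝ) • t) = g t ^ n := by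
    intro n
    induction n with
    | zero => intro t _ _; simp [g_zero]
    | succ n ih =>
      intro t hn ht
      have h1 : ‖(n : ℝ) • t‖ < ε := by
        refine lt_of_le_of_lt ?_ hn
        rw [norm_smul, norm_smul, Real.norm_natCast, Real.norm_natCast]
        gcongr
        simp
      have h2 : ((n + 1 : ℕ) : ℝ) • t = (n : ℝ) • t + t := by push_cast; rw [add_smul, one_smul]
      rw [h2, g_add _ _ h1 ht (by rwa [← h2]), ih t h1 ht, pow_succ]
  have hsmall : ∀ t : V, ∃ n₀ : ℕ, ∀ n ≥ n₀, 0 < n ∧ ‖(n : ℝ)⁻¹ • t‖ < ε := by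
    intro t
    obtain ⟨m, hm⟩ := exists_nat_gt (‖t‖ / ε)
    refine ⟨m + 1, fun n hn => ⟨by omega, ?_⟩⟩
    have hn0 : (0 : ℝ) < n := by exact_mod_cast (by omega : 0 < n)
    rw [norm_smul, norm_inv, Real.norm_natCast, inv_mul_lt_iff₀ hn0]
    have : (m : ℝ) < n := by exact_mod_cast (by omega : m < n)
    calc ‖t‖ < m * ε := (div_lt_iff₀ hε).1 hm
      _ ≤ n * ε := by gcongr
  -- The power g(t/n)^n does not depend on n: compare m and n with the common refinement mn.
  have hind : ∀ (t : V) (m n : ℕ), 0 < m → 0 < n → ‖(m : ℝ)⁻¹ • t‖ < ε → ‖(n : ℝ)⁻¹ • t‖ < ε →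
      g ((m : ℝ)⁻¹ • t) ^ m = g ((n : ℝ)⁻¹ • t) ^ n := by
    have key : ∀ (t : V) (m n : ℕ), 0 < m → 0 < n → ‖(m : ℝ)⁻¹ • t‖ < ε →
        g ((m : ℝ)⁻¹ • t) ^ m = g (((m * n : ℕ) : ℝ)⁻¹ • t) ^ (m * n) := by
      intro t m n hm hn h
      have hm0 : (m : ℝ) ≠ 0 := by positivity
      have hn0 : (n : ℝ) ≠ 0 := by positivity
      have h1 : (m : ℝ)⁻¹ • t = (n : ℝ) • (((m * n : ℕ) : ℝ)⁻¹ • t) := by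
        rw [smul_smul]
        congr 1
        push_cast
        field_simp
      have h2 : ‖((m * n : ℕ) : ℝ)⁻¹ • t‖ < ε := by
        refine lt_of_le_of_lt ?_ h
        rw [h1, norm_smul (n : ℝ), Real.norm_natCast]
        exact le_mul_of_one_le_left (norm_nonneg _) (by exact_mod_cast hn)
      rw [h1, hpow n _ (by rwa [← h1]) h2, ← pow_mul, mul_comm]
    intro t m n hm hn h1 h2
    rw [key t m n hm hn h1, key t n m hn hm h2, mul_comm]
  choose n₀ hn₀ using hsmall
  have hA : ∀ (t : V) (n : ℕ), n₀ t ≤ n →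
      g ((n₀ t : ℝ)⁻¹ • t) ^ (n₀ t) = g ((n : ℝ)⁻¹ • t) ^ n := fun t n hn =>
    hind t _ _ (hn₀ t _ le_rfl).1 (hn₀ t n hn).1 (hn₀ t _ le_rfl).2 (hn₀ t n hn).2
  refine ⟨fun t => g ((n₀ t : ℝ)⁻¹ • t) ^ (n₀ t), fun s t => ?_, fun t ht => ?_⟩
  · let n := max (n₀ (s + t)) (max (n₀ s) (n₀ t))
    have hst := hn₀ (s + t) n (le_max_left _ _)
    have hs := hn₀ s n ((le_max_left _ _).trans (le_max_right _ _))
    have ht := hn₀ t n ((le_max_right _ _).trans (le_max_right _ _))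
    beta_reduce
    rw [hA _ n (le_max_left _ _), hA s n ((le_max_left _ _).trans (le_max_right _ _)),
      hA t n ((le_max_right _ _).trans (le_max_right _ _))]
    rw [smul_add] at hst ⊢
    -- `g_add` in both orders makes g(s/n) and g(t/n) commute, so that the n-th power of their
    -- product splits even though `G` is not assumed commutative.
    have h1 := g_add _ _ hs.2 ht.2 hst.2
    have h2 := g_add _ _ ht.2 hs.2 (by rw [add_comm]; exact hst.2)
    rw [add_comm] at h2
    rw [h1]
    exact Commute.mul_pow (h1.symm.trans h2) n
  · have h := hind t _ 1 (hn₀ t _ le_rfl).1 one_pos (hn₀ t _ le_rfl).2 (by simpa using ht)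
    simpa using h

/-! ### The action of ℝ^p near a compact level set. -/

section Action

variable {p q : ℕ} {M : Type*} [TopologicalSpace M] [T2Space M]
  [ChartedSpace (EuclideanSpace ℝ (Fin (p + q))) M] [IsManifold (𝓡 (p + q)) ∞ M]
  {X : Fin p → SmoothVF (p + q) M} {F : Fin q → SmoothFun (p + q) M}

omit [T2Space M] in
theorem IsFlowBox.integralMap_eq {ψ : OpenPartialHomeomorph (AngleModel p q) M}
    (hψ : IsFlowBox X F ψ) {z : AngleModel p q} (hz : z ∈ ψ.source) :
    integralMap F (ψ z) = z.2 :=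
  PiLp.ext fun j => hψ.integral_eq z hz j

/-- A translation of size less than `ε` can be performed in one flow box contained in `O`,
uniformly near `x`. -/
def HasFlowBoxOfSize (X : Fin p → SmoothVF (p + q) M) (F : Fin q → SmoothFun (p + q) M)
    (O : Set M) (ε : ℝ) (x : M) : Prop :=
  ∃ ψ : OpenPartialHomeomorph (AngleModel p q) M, IsFlowBox X F ψ ∧ ψ.target ⊆ O ∧
    ∀ᶠ y in 𝓝 x, y ∈ ψ.target ∧ ∀ v : Fin p → ℝ, ‖v‖ < ε → ψ.symm y + (v, 0) ∈ ψ.source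

omit [T2Space M] in
theorem HasFlowBoxOfSize.mono {O : Set M} {ε ε' : ℝ} {x : M} (h : HasFlowBoxOfSize X F O ε x)
    (hε : ε' ≤ ε) : HasFlowBoxOfSize X F O ε' x := by
  obtain ⟨ψ, h1, h2, h3⟩ := h
  exact ⟨ψ, h1, h2, h3.mono fun y hy => ⟨hy.1, fun v hv => hy.2 v (hv.trans_le hε)⟩⟩

-- A Lebesgue number argument: if a box contains the r-ball around the coordinates of x, then points
-- with coordinates within r/2 can be translated by less than r/2. Compactness makes the size
-- uniform.
omit [T2Space M] in
theorem exists_hasFlowBoxOfSize {O K : Set M} (hO : IsOpen O) (hK : IsCompact K) (hKO : K ⊆ O)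
    (hbox : ∀ x ∈ O, ∃ ψ : OpenPartialHomeomorph (AngleModel p q) M, IsFlowBox X F ψ ∧ x ∈ ψ.target) :
    ∃ ε > 0, ∀ x ∈ K, HasFlowBoxOfSize X F O ε x := by
  refine hK.induction_on (p := fun S => ∃ ε > 0, ∀ x ∈ S, HasFlowBoxOfSize X F O ε x)
    ⟨1, one_pos, by simp⟩ ?_ ?_ ?_
  · rintro s t hst ⟨ε, hε, h⟩
    exact ⟨ε, hε, fun x hx => h x (hst hx)⟩
  · rintro s t ⟨ε, hε, h⟩ ⟨ε', hε', h'⟩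
    refine ⟨min ε ε', lt_min hε hε', fun x hx => ?_⟩
    rcases hx with hx | hx
    · exact (h x hx).mono (min_le_left _ _)
    · exact (h' x hx).mono (min_le_right _ _)
  · intro x hx
    obtain ⟨ψ₀, hψ₀, hxψ₀⟩ := hbox x (hKO hx)
    obtain ⟨ψ, hψ, hψt⟩ := hψ₀.restr hO
    have hxψ : x ∈ ψ.target := hψt ▸ ⟨hxψ₀, hKO hx⟩
    obtain ⟨r, hr, hrs⟩ := Metric.isOpen_iff.1 ψ.open_source _ (ψ.map_target hxψ)
    have ho : IsOpen (ψ.target ∩ ψ.symm ⁻¹' ball (ψ.symm x) (r / 2)) :=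
      ψ.isOpen_inter_preimage_symm isOpen_ball
    refine ⟨_, mem_nhdsWithin_of_mem_nhds (ho.mem_nhds ⟨hxψ, mem_ball_self (by positivity)⟩),
      r / 2, by positivity, fun y hy => ⟨ψ, hψ, hψt ▸ inter_subset_right, ?_⟩⟩
    filter_upwards [ho.mem_nhds hy] with y' hy'
    refine ⟨hy'.1, fun v hv => hrs ?_⟩
    have h1 : dist (ψ.symm y') (ψ.symm x) < r / 2 := hy'.2
    have h2 : dist (ψ.symm y' + (v, 0)) (ψ.symm y') < r / 2 := by
      rw [dist_eq_norm, add_sub_cancel_left, Prod.norm_mk, norm_zero, max_eq_left (norm_nonneg _)]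
      exact hv
    rw [mem_ball]
    linarith [dist_triangle (ψ.symm y' + (v, 0)) (ψ.symm y') (ψ.symm x)]

/-- `A` is an action of `ℝ^p`, on an open set `U` it preserves, which translates by vectors of size
less than `ε` in suitable flow boxes. -/
structure IsLocalFlow (X : Fin p → SmoothVF (p + q) M) (F : Fin q → SmoothFun (p + q) M)
    (U : Set M) (ε : ℝ) (A : (Fin p → ℝ) → M → M) : Prop where
  isOpen : IsOpen U
  pos : 0 < ε
  zero : ∀ x, A 0 x = x
  add : ∀ s t x, A (s + t) x = A s (A t x)
  mapsTo : ∀ t, ∀ x ∈ U, A t x ∈ U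
  exists_box : ∀ x ∈ U, ∃ ψ : OpenPartialHomeomorph (AngleModel p q) M, IsFlowBox X F ψ ∧
    ∀ᶠ y in 𝓝 x, y ∈ ψ.target ∧ ∀ v : Fin p → ℝ, ‖v‖ < ε →
      ψ.symm y + (v, 0) ∈ ψ.source ∧ A v y = ψ (ψ.symm y + (v, 0))

/-- A compact level set consisting of points with flow boxes has a neighbourhood on which the
vector fields generate an action of `ℝ^p`. -/
theorem exists_action (hbox : ∀ x, IsRegularPoint X F x →
      ∃ ψ : OpenPartialHomeomorph (AngleModel p q) M, IsFlowBox X F ψ ∧ x ∈ ψ.target)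
    {c : EuclideanSpace ℝ (Fin q)} (hNc : IsCompact {x | integralMap F x = c})
    (hNr : ∀ x, integralMap F x = c → IsRegularPoint X F x) (hNne : ∃ x, integralMap F x = c) :
    ∃ (U : Set M) (ε : ℝ) (A : (Fin p → ℝ) → M → M),
      IsLocalFlow X F U ε A ∧ ∀ x, integralMap F x = c → x ∈ U := by
  set N := {x | integralMap F x = c} with hN
  have : LocallyCompactSpace M := ChartedSpace.locallyCompactSpace (EuclideanSpace ℝ (Fin (p + q))) M
  have hIc : Continuous (integralMap F) := (contMDiff_integralMap F).continuous
  let B : Set M := {x | ∃ ψ : OpenPartialHomeomorph (AngleModel p q) M, IsFlowBox X F ψ ∧ x ∈ ψ.target}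
  have hB : IsOpen B := by
    rw [isOpen_iff_mem_nhds]
    rintro x ⟨ψ, hψ, hx⟩
    filter_upwards [ψ.open_target.mem_nhds hx] with y hy using ⟨ψ, hψ, hy⟩
  obtain ⟨O, hO, hNO, hOB, hOc⟩ := exists_open_between_and_isCompact_closure hNc hB
    fun x hx => hbox x (hNr x hx)
  -- The boundary of `O` is compact and misses the level set, so `integralMap F` stays away from c
  -- there. Points of the closure with nearby values therefore lie inside `O`.
  obtain ⟨δ, hδ, hδO⟩ : ∃ δ > 0, ∀ x ∈ closure O, x ∉ O → δ ≤ dist (integralMap F x) c := by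
    have hfc : IsCompact (closure O \ O) := hOc.diff hO
    rcases (closure O \ O).eq_empty_or_nonempty with h | h
    · refine ⟨1, one_pos, fun x hx hx' => ?_⟩
      have : x ∈ closure O \ O := ⟨hx, hx'⟩
      rw [h] at this
      exact this.elim
    · obtain ⟨x₁, hx₁, hmin⟩ := hfc.exists_isMinOn h
        (f := fun x => dist (integralMap F x) c) (by fun_prop)
      refine ⟨dist (integralMap F x₁) c, ?_, fun x hx hx' => hmin ⟨hx, hx'⟩⟩
      rw [gt_iff_lt, dist_pos]
      exact fun h => hx₁.2 (hNO h)
  have hKO : ∀ x ∈ closure O, dist (integralMap F x) c ≤ δ / 2 → x ∈ O := fun x hx h => by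
    by_contra hxO
    linarith [hδO x hx hxO]
  have hK : IsCompact (closure O ∩ {x | dist (integralMap F x) c ≤ δ / 2}) :=
    hOc.inter_right (isClosed_le (by fun_prop) continuous_const)
  obtain ⟨ε, hε, hKε⟩ := exists_hasFlowBoxOfSize hO hK (fun x hx => hKO x hx.1 hx.2)
    fun x hx => hOB (subset_closure hx)
  -- Small translations preserve `U`: the boxes used lie in `O`, and translations do not change the
  -- first integrals.
  let U : Set M := O ∩ {x | dist (integralMap F x) c < δ / 2}
  have hUo : IsOpen U := hO.inter (isOpen_lt (by fun_prop) continuous_const)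
  have hUbox : ∀ x ∈ U, HasFlowBoxOfSize X F O ε x := fun x hx =>
    hKε x ⟨subset_closure hx.1, show dist (integralMap F x) c ≤ δ / 2 from le_of_lt hx.2⟩
  have : Nonempty (OpenPartialHomeomorph (AngleModel p q) M) := by
    obtain ⟨x, hx⟩ := hNne
    exact ⟨(hbox x (hNr x hx)).choose⟩
  choose! box hbox1 hbox2 hbox3 using hUbox
  classical
  -- The identity as default value keeps the local addition law valid at points outside `U`, so that
  -- it holds as an identity of self-maps of `M`.
  let τ : (Fin p → ℝ) → M → M := fun v x =>
    if x ∈ U ∧ ‖v‖ < ε then box x ((box x).symm x + (v, 0)) else x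
  have hself : ∀ x ∈ U, x ∈ (box x).target ∧ ∀ v : Fin p → ℝ, ‖v‖ < ε →
    (box x).symm x + (v, 0) ∈ (box x).source := fun x hx => (hbox3 x hx).self_of_nhds
  have hτ : ∀ {ψ : OpenPartialHomeomorph (AngleModel p q) M}, IsFlowBox X F ψ → ∀ {z v},
      ψ z ∈ U → ‖v‖ < ε → (∀ t ∈ Icc (0 : ℝ) 1, z + t • ((v, 0) : AngleModel p q) ∈ ψ.source) →
      τ v (ψ z) = ψ (z + (v, 0)) := by
    intro ψ hψ z v hz hv hseg
    simp only [τ, hz, hv, and_self, if_true]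
    refine (hbox1 _ hz).translate_eq hψ (fun t ht => ?_) hseg ((box (ψ z)).right_inv (hself _ hz).1)
    have h1 := (hself _ hz).2 (t • v) (by
      rw [norm_smul, Real.norm_of_nonneg ht.1]
      exact (mul_le_of_le_one_left (norm_nonneg _) ht.2).trans_lt hv)
    simpa using h1
  have hτU : ∀ v, ∀ x ∈ U, τ v x ∈ U := by
    intro v x hx
    by_cases hv : ‖v‖ < ε
    · have hs := (hself x hx).2 v hv
      simp only [τ, hx, hv, and_self, if_true]
      refine ⟨hbox2 x hx ((box x).map_source hs), ?_⟩
      rw [mem_ofPred_eq, (hbox1 x hx).integralMap_eq hs, Prod.snd_add]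
      have h2 := (hbox1 x hx).integralMap_eq ((box x).map_target (hself x hx).1)
      rw [(box x).right_inv (hself x hx).1] at h2
      simp only [add_zero]
      rw [← h2]
      exact hx.2
    · simp only [τ, hv, and_false, if_false]
      exact hx
  have hτ0 : ∀ x, τ 0 x = x := by
    intro x
    simp only [τ, norm_zero]
    split_ifs with h
    · rw [Prod.mk_zero_zero, add_zero, (box x).right_inv (hself x h.1).1]
    · rfl
  have hτadd : ∀ s t : Fin p → ℝ, ‖s‖ < ε → ‖t‖ < ε → ‖s + t‖ < ε → ∀ x, τ (s + t) x = τ s (τ t x) := by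
    intro s t hs ht hst x
    by_cases hx : x ∈ U
    · have h1 : τ t x = box x ((box x).symm x + (t, 0)) := by
        simp only [τ, hx, ht, and_self, if_true]
      have h2 : τ (s + t) x = box x ((box x).symm x + (s + t, 0)) := by
        simp only [τ, hx, hst, and_self, if_true]
      have hU1 := hτU t x hx
      rw [h1] at hU1
      rw [h1, h2, hτ (hbox1 x hx) hU1 hs]
      · have h5 : ((s + t, 0) : AngleModel p q) = (t, 0) + (s, 0) := by
          rw [Prod.mk_add_mk, add_zero, add_comm s t]
        rw [h5, add_assoc]
      · intro u hu
        -- The segment from t to s + t stays in the convex ball, so both successive translations can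
        -- be read in the single box at x.
        have h3 : ‖t + u • s‖ < ε := by
          have : t + u • s = (1 - u) • t + u • (s + t) := by module
          have hc := (convex_ball (0 : Fin p → ℝ) ε) (mem_ball_zero_iff.2 ht) (mem_ball_zero_iff.2 hst)
            (sub_nonneg.2 hu.2) hu.1 (by ring)
          rw [this]
          exact mem_ball_zero_iff.1 hc
        have h4 := (hself x hx).2 _ h3
        rw [add_assoc]
        simpa using h4
    · simp only [τ, hx, false_and, if_false]
  -- The target monoid consists of the self-maps of `M` under composition.
  obtain ⟨A, hA, hAτ⟩ := exists_monoidHom_extending (G := Function.End M) hε (g := τ)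
    (funext hτ0) fun s t hs ht hst => funext (hτadd s t hs ht hst)
  have hA0 : ∀ x, A 0 x = x := fun x => by
    rw [hAτ 0 (by simpa using hε)]; exact hτ0 x
  have hAadd : ∀ s t x, A (s + t) x = A s (A t x) := fun s t x => congrFun (hA s t) x
  have hAU : ∀ t, ∀ x ∈ U, A t x ∈ U := by
    refine forall_of_forall_norm_lt hε (fun t ht x hx => ?_) fun s t hs ht x hx => ?_
    · rw [hAτ t ht]
      exact hτU _ _ hx
    · rw [hAadd]
      exact hs _ (ht x hx)
  refine ⟨U, ε, A, ⟨hUo, hε, hA0, hAadd, hAU, fun x hx => ⟨box x, hbox1 x hx, ?_⟩⟩,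
    fun x hx => ⟨hNO hx, ?_⟩⟩
  · filter_upwards [hbox3 x hx, hUo.mem_nhds hx] with y hy hyU
    refine ⟨hy.1, fun v hv => ⟨hy.2 v hv, ?_⟩⟩
    rw [hAτ v hv]
    have h1 := hτ (hbox1 x hx) (z := (box x).symm y) (v := v)
    rw [(box x).right_inv hy.1] at h1
    refine h1 hyU hv fun t ht => ?_
    have h2 := hy.2 (t • v) (by
      rw [norm_smul, Real.norm_of_nonneg ht.1]
      exact (mul_le_of_le_one_left (norm_nonneg _) ht.2).trans_lt hv)
    simpa using h2
  · have h : integralMap F x = c := hx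
    rw [mem_ofPred_eq, h, dist_self]
    positivity

end Action

section Fiberwise

variable {V R : Type*} [NormedAddCommGroup V] [NormedSpace ℝ V]
  [NormedAddCommGroup R] [NormedSpace ℝ R]

/-- Fibrewise homeomorphism `(t, r) ↦ (f (t, r), r)` over an open set of parameters. -/
def fiberwiseHomeomorph {S : Set R} (hS : IsOpen S) (f g : V × R → V)
    (hf : ContDiffOn ℝ ∞ f (univ ×ˢ S)) (hg : ContDiffOn ℝ ∞ g (univ ×ˢ S))
    (hgf : ∀ t, ∀ r ∈ S, g (f (t, r), r) = t) (hfg : ∀ t, ∀ r ∈ S, f (g (t, r), r) = t) :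
    OpenPartialHomeomorph (V × R) (V × R) where
  toFun z := (f z, z.2)
  invFun z := (g z, z.2)
  source := univ ×ˢ S
  target := univ ×ˢ S
  map_source' _ hz := ⟨mem_univ _, hz.2⟩
  map_target' _ hz := ⟨mem_univ _, hz.2⟩
  left_inv' z hz := Prod.ext (hgf z.1 z.2 hz.2) rfl
  right_inv' z hz := Prod.ext (hfg z.1 z.2 hz.2) rfl
  open_source := isOpen_univ.prod hS
  open_target := isOpen_univ.prod hS
  continuousOn_toFun := hf.continuousOn.prodMk continuousOn_snd
  continuousOn_invFun := hg.continuousOn.prodMk continuousOn_snd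

end Fiberwise

section Param

variable {E E' E'' : Type*} [NormedAddCommGroup E] [NormedSpace ℝ E]
  [NormedAddCommGroup E'] [NormedSpace ℝ E'] [NormedAddCommGroup E''] [NormedSpace ℝ E'']
  {M : Type*} [TopologicalSpace M] [ChartedSpace E M]

theorem IsSmoothParam.comp {ψ : OpenPartialHomeomorph E' M} (hψ : IsSmoothParam (E := E) ψ)
    {s : OpenPartialHomeomorph E'' E'} (hs : ContDiffOn ℝ ∞ s s.source)
    (hs' : ContDiffOn ℝ ∞ s.symm s.target) : IsSmoothParam (E := E) (s.trans ψ) := by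
  constructor
  · exact hψ.contMDiffOn.comp (contMDiffOn_iff_contDiffOn.2 hs |>.mono fun z hz => hz.1)
      fun z hz => hz.2
  · exact (contMDiffOn_iff_contDiffOn.2 hs').comp (hψ.contMDiffOn_symm.mono fun z hz => hz.1)
      fun z hz => hz.2

theorem IsSmoothParam.restrOpen {ψ : OpenPartialHomeomorph E' M} (hψ : IsSmoothParam (E := E) ψ)
    {W : Set E'} (hW : IsOpen W) : IsSmoothParam (E := E) (ψ.restrOpen W hW) :=
  ⟨hψ.contMDiffOn.mono fun _ hz => hz.1, hψ.contMDiffOn_symm.mono fun _ hz => hz.1⟩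

end Param

/-! ### Properties of the action and of its orbit maps. -/

section LocalFlow

variable {p q : ℕ} {M : Type*} [TopologicalSpace M]
  [ChartedSpace (EuclideanSpace ℝ (Fin (p + q))) M] [IsManifold (𝓡 (p + q)) ∞ M]
  {X : Fin p → SmoothVF (p + q) M} {F : Fin q → SmoothFun (p + q) M}

theorem IsFlowBox.restrOpen {ψ : OpenPartialHomeomorph (AngleModel p q) M}
    (hψ : IsFlowBox X F ψ) {W : Set (AngleModel p q)} (hW : IsOpen W) :
    IsFlowBox X F (ψ.restrOpen W hW) :=
  ⟨hψ.toIsSmoothParam.restrOpen hW, fun z hz i => hψ.mfderiv_single z hz.1 i,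
    fun z hz j => hψ.integral_eq z hz.1 j⟩

theorem IsFlowBox.symm_snd {ψ : OpenPartialHomeomorph (AngleModel p q) M}
    (hψ : IsFlowBox X F ψ) {x : M} (hx : x ∈ ψ.target) : (ψ.symm x).2 = integralMap F x := by
  rw [← hψ.integralMap_eq (ψ.map_target hx), ψ.right_inv hx]

variable {U : Set M} {ε : ℝ} {A : (Fin p → ℝ) → M → M}

theorem IsLocalFlow.neg_apply (hA : IsLocalFlow X F U ε A) (t : Fin p → ℝ) (x : M) :
    A (-t) (A t x) = x := by
  rw [← hA.add, neg_add_cancel, hA.zero]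

/-- A small translation leaves the second component of box coordinates unchanged; arbitrary vectors
are sums of small ones. -/
theorem IsLocalFlow.integralMap_apply (hA : IsLocalFlow X F U ε A) (t : Fin p → ℝ) {x : M}
    (hx : x ∈ U) : integralMap F (A t x) = integralMap F x := by
  refine forall_of_forall_norm_lt (P := fun t => ∀ x ∈ U, integralMap F (A t x) = integralMap F x)
    hA.pos (fun t ht x hx => ?_) (fun s t hs ht x hx => ?_) t x hx
  · obtain ⟨ψ, hψ, hev⟩ := hA.exists_box x hx
    obtain ⟨h1, h2⟩ := hev.self_of_nhds
    obtain ⟨h3, h4⟩ := h2 t ht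
    rw [h4, hψ.integralMap_eq h3, ← hψ.symm_snd h1]
    simp
  · rw [hA.add, hs _ (hA.mapsTo t x hx), ht x hx]

theorem IsLocalFlow.contMDiffAt (hA : IsLocalFlow X F U ε A) (t : Fin p → ℝ) {x : M}
    (hx : x ∈ U) : ContMDiffAt (𝓡 (p + q)) (𝓡 (p + q)) ∞ (A t) x := by
  refine forall_of_forall_norm_lt (P := fun t => ∀ x ∈ U,
    ContMDiffAt (𝓡 (p + q)) (𝓡 (p + q)) ∞ (A t) x) hA.pos (fun t ht x hx => ?_)
    (fun s t hs ht x hx => ?_) t x hx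
  · obtain ⟨ψ, hψ, hev⟩ := hA.exists_box x hx
    have h0 := hev.self_of_nhds
    have h1 : A t =ᶠ[𝓝 x] fun y => ψ (ψ.symm y + (t, 0)) := hev.mono fun y hy => (hy.2 t ht).2
    refine ContMDiffAt.congr_of_eventuallyEq ?_ h1
    have h2 : ContMDiffAt (𝓡 (p + q)) 𝓘(ℝ, AngleModel p q) ∞
        (fun y => ψ.symm y + ((t, 0) : AngleModel p q)) x :=
      (hψ.contMDiffOn_symm.contMDiffAt (ψ.open_target.mem_nhds h0.1)).add contMDiffAt_const
    exact (hψ.contMDiffOn.contMDiffAt (ψ.open_source.mem_nhds (h0.2 t ht).1)).comp x h2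
  · have h1 : A (s + t) = A s ∘ A t := funext fun y => hA.add s t y
    rw [h1]
    exact (hs _ (hA.mapsTo t x hx)).comp x (ht x hx)

/-- In a box, a nearby point on the same level differs only in its first component, hence by a small
translation. This makes orbits open in their level sets. -/
theorem IsLocalFlow.eventually_mem_orbit (hA : IsLocalFlow X F U ε A) {x : M} (hx : x ∈ U) :
    ∀ᶠ y in 𝓝 x, integralMap F y = integralMap F x → ∃ v : Fin p → ℝ, ‖v‖ < ε ∧ A v x = y := by
  obtain ⟨ψ, hψ, hev⟩ := hA.exists_box x hx
  have h0 := hev.self_of_nhds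
  have hc : ContinuousAt ψ.symm x := ψ.continuousAt_symm h0.1
  filter_upwards [ψ.open_target.mem_nhds h0.1, hc (ball_mem_nhds (ψ.symm x) hA.pos)] with y hy hyb hF
  have hsnd : (ψ.symm y).2 = (ψ.symm x).2 := by rw [hψ.symm_snd hy, hψ.symm_snd h0.1, hF]
  have hv : ‖(ψ.symm y).1 - (ψ.symm x).1‖ < ε := by
    have h1 : ‖ψ.symm y - ψ.symm x‖ < ε := mem_ball_iff_norm.1 hyb
    exact (norm_fst_le (ψ.symm y - ψ.symm x)).trans_lt h1
  refine ⟨_, hv, ?_⟩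
  rw [(h0.2 _ hv).2]
  have h2 : ψ.symm x + ((ψ.symm y).1 - (ψ.symm x).1, 0) = ψ.symm y :=
    Prod.ext (by simp) (by simp [hsnd])
  rw [h2, ψ.right_inv hy]

/-- Translations within one box are injective. This gives discreteness of the isotropy groups, with
the same `ε` at every point of `U`. -/
theorem IsLocalFlow.eq_zero_of_apply_eq (hA : IsLocalFlow X F U ε A) {x : M} (hx : x ∈ U)
    {v : Fin p → ℝ} (hv : ‖v‖ < ε) (h : A v x = x) : v = 0 := by
  obtain ⟨ψ, hψ, hev⟩ := hA.exists_box x hx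
  have h0 := hev.self_of_nhds
  obtain ⟨h1, h2⟩ := h0.2 v hv
  rw [h2] at h
  have h3 := congrArg ψ.symm h
  rw [ψ.left_inv h1] at h3
  exact congrArg Prod.fst (add_eq_left.1 h3)

/-- The orbit map over a section contained in a flow box is, everywhere, locally a flow box. -/
theorem IsLocalFlow.exists_isFlowBox_orbitMap (hA : IsLocalFlow X F U ε A)
    {ψ₀ : OpenPartialHomeomorph (AngleModel p q) M} (hψ₀ : IsFlowBox X F ψ₀) {s₀ : Fin p → ℝ}
    {r₀ : EuclideanSpace ℝ (Fin q)} (hr₀ : (s₀, r₀) ∈ ψ₀.source) (hr₀U : ψ₀ (s₀, r₀) ∈ U)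
    (t₀ : Fin p → ℝ) :
    ∃ ψ : OpenPartialHomeomorph (AngleModel p q) M, IsFlowBox X F ψ ∧ (t₀, r₀) ∈ ψ.source ∧
      ∀ z ∈ ψ.source, ψ z = A z.1 (ψ₀ (s₀, z.2)) := by
  let σ : EuclideanSpace ℝ (Fin q) → M := fun r => ψ₀ (s₀, r)
  let S₀ : Set (EuclideanSpace ℝ (Fin q)) := {r | (s₀, r) ∈ ψ₀.source}
  have hS₀ : IsOpen S₀ := ψ₀.open_source.preimage (Continuous.prodMk_right s₀)
  have hσ : ContMDiffOn 𝓘(ℝ, EuclideanSpace ℝ (Fin q)) (𝓡 (p + q)) ∞ σ S₀ :=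
    hψ₀.contMDiffOn.comp ((contMDiff_iff_contDiff.2 (contDiff_prodMk_right s₀)).contMDiffOn)
      fun r hr => hr
  obtain ⟨ψ, hψ, hev⟩ := hA.exists_box _ (hA.mapsTo t₀ _ hr₀U)
  obtain ⟨V, hV, hVo, hyV⟩ := _root_.eventually_nhds_iff.1 hev
  have hS₁ : IsOpen (S₀ ∩ σ ⁻¹' U) := hσ.continuousOn.isOpen_inter_preimage hS₀ hA.isOpen
  have hAσ : ContMDiffOn 𝓘(ℝ, EuclideanSpace ℝ (Fin q)) (𝓡 (p + q)) ∞ (fun r => A t₀ (σ r))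
      (S₀ ∩ σ ⁻¹' U) := fun r hr =>
    ((hA.contMDiffAt t₀ hr.2).comp r (hσ.contMDiffAt (hS₀.mem_nhds hr.1))).contMDiffWithinAt
  let S : Set (EuclideanSpace ℝ (Fin q)) := (S₀ ∩ σ ⁻¹' U) ∩ (fun r => A t₀ (σ r)) ⁻¹' V
  have hS : IsOpen S := hAσ.continuousOn.isOpen_inter_preimage hS₁ hVo
  -- The image section r ↦ A t₀ (σ r) has first box coordinate t₀ + k r. Shearing by `k`, which
  -- depends on r alone, turns the box into the orbit map and keeps the fields ∂/∂t_i.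
  let k : EuclideanSpace ℝ (Fin q) → (Fin p → ℝ) := fun r => (ψ.symm (A t₀ (σ r))).1 - t₀
  have hk : ContDiffOn ℝ ∞ k S := by
    refine ContDiffOn.sub ?_ contDiffOn_const
    refine contDiff_fst.comp_contDiffOn ?_
    rw [← contMDiffOn_iff_contDiffOn]
    exact hψ.contMDiffOn_symm.comp (hAσ.mono inter_subset_left) fun r hr => (hV _ hr.2).1
  have hk' : ContDiffOn ℝ ∞ (fun z : AngleModel p q => k z.2) (univ ×ˢ S) :=
    hk.comp contDiffOn_snd fun z hz => hz.2
  let s := fiberwiseHomeomorph hS (fun z : AngleModel p q => z.1 + k z.2)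
    (fun z : AngleModel p q => z.1 - k z.2)
    (contDiffOn_fst.add hk') (contDiffOn_fst.sub hk') (by simp) (by simp)
  have hs1 : ContDiffOn ℝ ∞ s s.source := (contDiffOn_fst.add hk').prodMk contDiffOn_snd
  have hs2 : ContDiffOn ℝ ∞ s.symm s.target := (contDiffOn_fst.sub hk').prodMk contDiffOn_snd
  have hparam := hψ.toIsSmoothParam.comp hs1 hs2
  have hbox : IsFlowBox X F (s.trans ψ) := by
    refine ⟨hparam, fun z hz i => ?_, fun z hz j => hψ.integral_eq (s z) hz.2 j⟩
    have hkz : HasFDerivAt (fun z : AngleModel p q => k z.2)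
        ((fderiv ℝ k z.2).comp (ContinuousLinearMap.snd ℝ _ _)) z :=
      HasFDerivAt.comp (f := fun z : AngleModel p q => z.2) z
        ((hk.contDiffAt (hS.mem_nhds hz.1.2)).differentiableAt (by simp)).hasFDerivAt hasFDerivAt_snd
    have hsz : HasFDerivAt s (((ContinuousLinearMap.fst ℝ _ _) +
        (fderiv ℝ k z.2).comp (ContinuousLinearMap.snd ℝ _ _)).prod (ContinuousLinearMap.snd ℝ _ _)) z :=
      (hasFDerivAt_fst.add hkz).prodMk hasFDerivAt_snd
    have h1 := ((hψ.mdifferentiableAt hz.2).hasMFDerivAt.comp z hsz.hasMFDerivAt).mfderiv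
    have h2 := congrArg (fun B : AngleModel p q →L[ℝ] EuclideanSpace ℝ (Fin (p + q)) =>
      B (Pi.single i 1, 0)) h1
    refine h2.trans ?_
    refine Eq.trans ?_ (hψ.mfderiv_single (s z) hz.2 i)
    refine congrArg (mfderiv 𝓘(ℝ, AngleModel p q) (𝓡 (p + q)) ψ (s z)) ?_
    refine Prod.ext ?_ rfl
    change Pi.single i 1 + fderiv ℝ k z.2 0 = Pi.single i 1
    rw [map_zero, add_zero]
  -- On this set A z.1 is A (z.1 - t₀) after A t₀, and the vector z.1 - t₀ is small enough to act
  -- inside the box.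
  have hWo : IsOpen {z : AngleModel p q | ‖z.1 - t₀‖ < ε} := isOpen_lt (by fun_prop) continuous_const
  refine ⟨(s.trans ψ).restrOpen _ hWo, hbox.restrOpen hWo, ?_, ?_⟩
  · have h0 := hV _ hyV
    refine ⟨⟨⟨mem_univ _, ⟨hr₀, hr₀U⟩, hyV⟩, ?_⟩, ?_⟩
    · have h1 : s (t₀, r₀) = ψ.symm (A t₀ (σ r₀)) := by
        refine Prod.ext ?_ ?_
        · change t₀ + ((ψ.symm (A t₀ (σ r₀))).1 - t₀) = _
          abel
        · rw [hψ.symm_snd h0.1, hA.integralMap_apply _ hr₀U, hψ₀.integralMap_eq hr₀]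
          rfl
      change s (t₀, r₀) ∈ ψ.source
      rw [h1]
      exact ψ.map_target h0.1
    · change ‖t₀ - t₀‖ < ε
      simpa using hA.pos
  · rintro z ⟨⟨hz1, hz2⟩, hz3⟩
    have hzS : z.2 ∈ S := hz1.2
    have h0 := hV _ hzS.2
    have h1 : A z.1 (σ z.2) = A (z.1 - t₀) (A t₀ (σ z.2)) := by rw [← hA.add, sub_add_cancel]
    change ψ (s z) = A z.1 (σ z.2)
    rw [h1, (h0.2 (z.1 - t₀) hz3).2]
    congr 1
    refine Prod.ext ?_ ?_
    · change z.1 + ((ψ.symm (A t₀ (σ z.2))).1 - t₀) = (ψ.symm (A t₀ (σ z.2))).1 + (z.1 - t₀)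
      abel
    · change z.2 = (ψ.symm (A t₀ (σ z.2))).2 + 0
      rw [hψ.symm_snd h0.1, hA.integralMap_apply _ hzS.1.2, hψ₀.integralMap_eq hzS.1.1, add_zero]

end LocalFlow

/-! ### Lattices of periods. -/

/-- A discrete cocompact subgroup of `ℝ^p` is the group of integer combinations of a basis. -/
theorem exists_basis_of_discrete_cocompact {p : ℕ} (L : AddSubgroup (Fin p → ℝ)) {ε R : ℝ}
    (hε : 0 < ε) (hdisc : ∀ l ∈ L, ‖l‖ < ε → l = 0) (hcoc : ∀ t, ∃ l ∈ L, ‖t - l‖ ≤ R) :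
    ∃ b : Module.Basis (Fin p) ℝ (Fin p → ℝ), ∀ t, t ∈ L ↔ ∃ k : Fin p → ℤ, t = ∑ i, (k i : ℝ) • b i := by
  let L' : Submodule ℤ (Fin p → ℝ) := AddSubgroup.toIntSubmodule L
  have : DiscreteTopology L' := by
    change DiscreteTopology L
    rw [discreteTopology_iff_isOpen_singleton_zero]
    have h : ({0} : Set L) = (fun l : L => (l : Fin p → ℝ)) ⁻¹' ball 0 ε := by
      ext l
      constructor
      · rintro rfl
        simpa using hε
      · intro hl
        exact Subtype.ext (hdisc l l.2 (mem_ball_zero_iff.1 hl))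
    rw [h]
    exact isOpen_ball.preimage continuous_subtype_val
  have hspan : Submodule.span ℝ (L' : Set (Fin p → ℝ)) = ⊤ := by
    -- A nonzero functional vanishing on `L` would be bounded, since every vector is within `R` of
    -- `L`; scaling `u` contradicts this.
    by_contra hne
    obtain ⟨f, hf0, hf⟩ := Submodule.exists_le_ker_of_lt_top _ (lt_top_iff_ne_top.2 hne)
    let fc : (Fin p → ℝ) →L[ℝ] ℝ := LinearMap.toContinuousLinearMap f
    obtain ⟨u, hu⟩ : ∃ u, f u ≠ 0 := by
      by_contra! h
      exact hf0 (LinearMap.ext h)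
    have hbound : ∀ t, |f t| ≤ ‖fc‖ * R := by
      intro t
      obtain ⟨l, hl, hlR⟩ := hcoc t
      have h1 : f l = 0 := hf (Submodule.subset_span hl)
      have h2 : f t = fc (t - l) := by
        change f t = f (t - l)
        rw [map_sub, h1, sub_zero]
      rw [h2]
      exact (fc.le_opNorm _).trans (by gcongr)
    obtain ⟨n, hn⟩ := exists_nat_gt (‖fc‖ * R / |f u|)
    have h1 := hbound ((n : ℝ) • u)
    rw [map_smul, smul_eq_mul, abs_mul, Nat.abs_cast] at h1
    rw [div_lt_iff₀ (abs_pos.2 hu)] at hn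
    linarith
  have : IsZLattice ℝ L' := ⟨hspan⟩
  have hfree : Module.Free ℤ L' := ZLattice.module_free ℝ L'
  have hfin : Module.Finite ℤ L' := ZLattice.module_finite ℝ L'
  have hrank : Module.finrank ℤ L' = p := by
    rw [ZLattice.rank ℝ L', Module.finrank_fin_fun]
  let b₀ : Module.Basis (Fin p) ℤ L' := (Module.finBasis ℤ L').reindex (finCongr hrank)
  refine ⟨b₀.ofZLatticeBasis ℝ L', fun t => ?_⟩
  have h1 : t ∈ L ↔ t ∈ Submodule.span ℤ (range (b₀.ofZLatticeBasis ℝ L')) := by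
    rw [b₀.ofZLatticeBasis_span ℝ]
    rfl
  rw [h1, Submodule.mem_span_range_iff_exists_fun]
  refine exists_congr fun k => ?_
  simp only [Int.cast_smul_eq_zsmul]
  exact eq_comm

section Orbit

variable {p q : ℕ} {M : Type*} [TopologicalSpace M]
  [ChartedSpace (EuclideanSpace ℝ (Fin (p + q))) M] [IsManifold (𝓡 (p + q)) ∞ M]
  {X : Fin p → SmoothVF (p + q) M} {F : Fin q → SmoothFun (p + q) M}
  {U : Set M} {ε : ℝ} {A : (Fin p → ℝ) → M → M}

/-- A compact connected level set is one orbit, swept by translations of bounded size. -/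
theorem IsLocalFlow.exists_forall_mem_orbit (hA : IsLocalFlow X F U ε A)
    {c : EuclideanSpace ℝ (Fin q)} (hNU : ∀ x, integralMap F x = c → x ∈ U)
    (hNc : IsCompact {x | integralMap F x = c}) (hNconn : IsPreconnected {x | integralMap F x = c})
    {x₀ : M} (hx₀ : integralMap F x₀ = c) :
    ∃ R : ℝ, ∀ y, integralMap F y = c → ∃ t : Fin p → ℝ, ‖t‖ ≤ R ∧ A t x₀ = y := by
  have horb : ∀ y, integralMap F y = c → ∃ t, A t x₀ = y := by
    intro y hy
    -- Lying on a common orbit is transitive and holds near each point of the level set, so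
    -- connectedness leaves one orbit.
    refine hNconn.induction₂' (fun x y => ∃ t, A t x = y) (fun x hx => ?_) ?_ hx₀ hy
    · filter_upwards [mem_nhdsWithin_of_mem_nhds (hA.eventually_mem_orbit (hNU x hx)),
        self_mem_nhdsWithin] with y hy hyN
      have h1 : integralMap F y = c := hyN
      have h2 : integralMap F x = c := hx
      obtain ⟨v, -, hv⟩ := hy (h1.trans h2.symm)
      exact ⟨⟨v, hv⟩, -v, by rw [← hv, hA.neg_apply]⟩
    · rintro x y z - - - ⟨s, rfl⟩ ⟨t, rfl⟩
      exact ⟨t + s, hA.add t s x⟩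
  have h := hNc.induction_on
    (p := fun S => ∃ R : ℝ, ∀ y ∈ S, integralMap F y = c → ∃ t : Fin p → ℝ, ‖t‖ ≤ R ∧ A t x₀ = y)
    ⟨0, by simp⟩ ?_ ?_ ?_
  · obtain ⟨R, hR⟩ := h
    exact ⟨R, fun y hy => hR y hy hy⟩
  · rintro S T hST ⟨R, hR⟩
    exact ⟨R, fun y hy => hR y (hST hy)⟩
  · rintro S T ⟨R, hR⟩ ⟨R', hR'⟩
    refine ⟨max R R', fun y hy hyc => ?_⟩
    rcases hy with hy | hy
    · obtain ⟨t, ht, h⟩ := hR y hy hyc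
      exact ⟨t, ht.trans (le_max_left _ _), h⟩
    · obtain ⟨t, ht, h⟩ := hR' y hy hyc
      exact ⟨t, ht.trans (le_max_right _ _), h⟩
  · intro x hx
    have hx' : integralMap F x = c := hx
    obtain ⟨t, ht⟩ := horb x hx
    refine ⟨_, mem_nhdsWithin_of_mem_nhds (hA.eventually_mem_orbit (hNU x hx)), ‖t‖ + ε,
      fun y hy hyc => ?_⟩
    obtain ⟨v, hv, hvy⟩ := hy (hyc.trans hx'.symm)
    refine ⟨v + t, (norm_add_le _ _).trans (by linarith), ?_⟩
    rw [hA.add, ht, hvy]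

/-- The isotropy subgroup of a point. -/
def IsLocalFlow.isotropy (hA : IsLocalFlow X F U ε A) (x : M) : AddSubgroup (Fin p → ℝ) where
  carrier := {t | A t x = x}
  zero_mem' := hA.zero x
  add_mem' {s t} hs ht := by
    have h1 : A s x = x := hs
    have h2 : A t x = x := ht
    change A (s + t) x = x
    rw [hA.add, h2, h1]
  neg_mem' {t} ht := by
    have h1 : A t x = x := ht
    change A (-t) x = x
    conv_lhs => rw [← h1]
    exact hA.neg_apply t x

/-- The isotropy group is discrete by injectivity of small translations. It is cocompact because
every point A t x₀ is already reached by a translation of norm at most `R`. -/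
theorem IsLocalFlow.exists_period_basis (hA : IsLocalFlow X F U ε A)
    {c : EuclideanSpace ℝ (Fin q)} (hNU : ∀ x, integralMap F x = c → x ∈ U)
    (hNc : IsCompact {x | integralMap F x = c}) (hNconn : IsPreconnected {x | integralMap F x = c})
    {x₀ : M} (hx₀ : integralMap F x₀ = c) :
    ∃ b : Module.Basis (Fin p) ℝ (Fin p → ℝ), ∀ t, A t x₀ = x₀ ↔
      ∃ k : Fin p → ℤ, t = ∑ i, (k i : ℝ) • b i := by
  obtain ⟨R, hR⟩ := hA.exists_forall_mem_orbit hNU hNc hNconn hx₀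
  refine exists_basis_of_discrete_cocompact (hA.isotropy x₀) (R := R) hA.pos
    (fun l hl hlε => hA.eq_zero_of_apply_eq (hNU _ hx₀) hlε hl) fun t => ?_
  have h1 : integralMap F (A t x₀) = c := by rw [hA.integralMap_apply t (hNU _ hx₀), hx₀]
  obtain ⟨s, hs, hst⟩ := hR _ h1
  refine ⟨t - s, ?_, by rwa [sub_sub_cancel]⟩
  change A (t - s) x₀ = x₀
  rw [sub_eq_neg_add, hA.add, ← hst, hA.neg_apply]

end Orbit

/-! ### Descending from ℝ^p × B^q to 𝕋^p × B^q. -/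

section Torus

variable {p q : ℕ}

/-- The covering `ℝ^p × ℝ^q → 𝕋^p × ℝ^q`. -/
def torusProj (z : AngleModel p q) : UnitAddTorus (Fin p) × EuclideanSpace ℝ (Fin q) :=
  (fun i => (z.1 i : UnitAddCircle), z.2)

theorem unitAddCircle_coe_eq_coe_iff {a b : ℝ} :
    (a : UnitAddCircle) = b ↔ ∃ k : ℤ, a - b = k := by
  rw [← sub_eq_zero, ← AddCircle.coe_sub, AddCircle.coe_eq_zero_iff]
  refine exists_congr fun k => ?_
  rw [zsmul_one, eq_comm]

theorem torusProj_surjective : Function.Surjective (torusProj (p := p) (q := q)) := by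
  rintro ⟨ρ, r⟩
  choose θ hθ using fun i => QuotientAddGroup.mk_surjective (ρ i)
  exact ⟨(θ, r), Prod.ext (funext hθ) rfl⟩

theorem continuous_torusProj : Continuous (torusProj (p := p) (q := q)) := by
  refine Continuous.prodMk (continuous_pi fun i => ?_) continuous_snd
  exact (AddCircle.continuous_mk' 1).comp ((continuous_apply i).comp continuous_fst)

theorem map_torusProj_nhds (z : AngleModel p q) : map torusProj (𝓝 z) = 𝓝 (torusProj z) := by
  have h1 : IsOpenMap (Pi.map fun _ : Fin p => ((↑) : ℝ → UnitAddCircle)) :=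
    IsOpenMap.piMap (fun _ => QuotientAddGroup.isOpenMap_coe)
      (Eventually.of_forall fun _ => QuotientAddGroup.mk_surjective)
  have h2 : IsOpenMap (torusProj (p := p) (q := q)) :=
    h1.prodMap (IsOpenMap.id (X := EuclideanSpace ℝ (Fin q)))
  exact le_antisymm continuous_torusProj.continuousAt (h2.nhds_le z)

variable {M : Type*} [TopologicalSpace M]

/-- A local homeomorphism from `ℝ^p × B` whose fibres are the `ℤ^p`-orbits is the lift of a chart
with values in `𝕋^p × B`. -/
theorem exists_chart_of_lift {Ξ : AngleModel p q → M} {B : Set (EuclideanSpace ℝ (Fin q))}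
    (hB : IsOpen B)
    (hfib : ∀ z z' : AngleModel p q, z.2 ∈ B → z'.2 ∈ B →
      (Ξ z = Ξ z' ↔ z.2 = z'.2 ∧ ∀ i, ∃ k : ℤ, z.1 i - z'.1 i = k))
    (hloc : ∀ z : AngleModel p q, z.2 ∈ B → map Ξ (𝓝 z) = 𝓝 (Ξ z)) :
    ∃ e : OpenPartialHomeomorph M (UnitAddTorus (Fin p) × EuclideanSpace ℝ (Fin q)),
      e.source = Ξ '' (univ ×ˢ B) ∧ e.target = univ ×ˢ B ∧
      ∀ z : AngleModel p q, z.2 ∈ B → coverLift e z = Ξ z := by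
  -- A set-theoretic section of the covering is enough: over `B`, the value of `Ξ` does not depend
  -- on the chosen lift.
  let l := Function.surjInv (torusProj_surjective (p := p) (q := q))
  have hl : ∀ y, torusProj (l y) = y := Function.surjInv_eq _
  have hl2 : ∀ y, (l y).2 = y.2 := fun y => congrArg Prod.snd (hl y)
  let Ψ : UnitAddTorus (Fin p) × EuclideanSpace ℝ (Fin q) → M := fun y => Ξ (l y)
  have hproj : ∀ z z' : AngleModel p q, torusProj z = torusProj z' ↔
      z.2 = z'.2 ∧ ∀ i, ∃ k : ℤ, z.1 i - z'.1 i = k := by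
    intro z z'
    rw [torusProj, torusProj, Prod.mk.injEq, funext_iff, and_comm]
    simp only [unitAddCircle_coe_eq_coe_iff]
  have hΨ : ∀ z : AngleModel p q, z.2 ∈ B → Ψ (torusProj z) = Ξ z := by
    intro z hz
    have h1 : (l (torusProj z)).2 = z.2 := hl2 _
    exact (hfib _ _ (by rw [h1]; exact hz) hz).2 ((hproj _ _).1 (hl _))
  -- Continuity and openness pass to the quotient together, as an equality of neighbourhood filters
  -- pushed forward along the covering.
  have hΨn : ∀ y ∈ (univ ×ˢ B : Set (UnitAddTorus (Fin p) × EuclideanSpace ℝ (Fin q))),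
      map Ψ (𝓝 y) = 𝓝 (Ψ y) := by
    intro y hy
    obtain ⟨z, rfl⟩ := torusProj_surjective y
    have hz : z.2 ∈ B := hy.2
    rw [← map_torusProj_nhds, Filter.map_map, hΨ z hz, ← hloc z hz]
    refine Filter.map_congr ?_
    filter_upwards [(hB.preimage continuous_snd).mem_nhds hz] with w hw using hΨ w hw
  have hΨi : InjOn Ψ (univ ×ˢ B) := by
    intro y hy y' hy' h
    have := (hproj _ _).2 ((hfib _ _ (by rw [hl2]; exact hy.2) (by rw [hl2]; exact hy'.2)).1 h)
    rwa [hl, hl] at this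
  have hopen : IsOpen (univ ×ˢ B : Set (UnitAddTorus (Fin p) × EuclideanSpace ℝ (Fin q))) :=
    isOpen_univ.prod hB
  let P : PartialEquiv (UnitAddTorus (Fin p) × EuclideanSpace ℝ (Fin q)) M :=
    hΨi.toPartialEquiv Ψ (univ ×ˢ B)
  have hc : ContinuousOn P P.source := fun y hy =>
    ContinuousAt.continuousWithinAt (hΨn y hy).le
  have ho : IsOpenMap (P.source.domRestrict P) := by
    rw [isOpenMap_iff_nhds_le]
    rintro ⟨y, hy⟩
    have h1 : map Ψ (𝓝 y) = map (P.source.domRestrict P) (𝓝 ⟨y, hy⟩) := by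
      have : 𝓝 y = map ((↑) : P.source → _) (𝓝 ⟨y, hy⟩) :=
        (hopen.isOpenEmbedding_subtypeVal.map_nhds_eq ⟨y, hy⟩).symm
      rw [this, Filter.map_map]
      rfl
    rw [← h1]
    exact (hΨn y hy).ge
  let e := (OpenPartialHomeomorph.ofContinuousOpenRestrict P hc ho hopen).symm
  refine ⟨e, ?_, rfl, fun z hz => hΨ z hz⟩
  change Ψ '' (univ ×ˢ B) = Ξ '' (univ ×ˢ B)
  ext x
  constructor
  · rintro ⟨y, hy, rfl⟩
    exact ⟨l y, ⟨mem_univ _, by rw [hl2]; exact hy.2⟩, rfl⟩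
  · rintro ⟨z, hz, rfl⟩
    exact ⟨torusProj z, ⟨mem_univ _, hz.2⟩, hΨ z hz.2⟩

end Torus

/-! ### Smooth families of periods. -/

section Periods

variable {p q : ℕ} {M : Type*} [TopologicalSpace M]
  [ChartedSpace (EuclideanSpace ℝ (Fin (p + q))) M] [IsManifold (𝓡 (p + q)) ∞ M]
  {X : Fin p → SmoothVF (p + q) M} {F : Fin q → SmoothFun (p + q) M}
  {U : Set M} {ε : ℝ} {A : (Fin p → ℝ) → M → M}

/-- Periods depending smoothly on the parameters: `P r` maps `ℤ^p` to the isotropy group of the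
point of the section over `r`. -/
theorem IsLocalFlow.exists_period_family (hA : IsLocalFlow X F U ε A)
    {ψ₀ : OpenPartialHomeomorph (AngleModel p q) M} (hψ₀ : IsFlowBox X F ψ₀) {s₀ : Fin p → ℝ}
    {c : EuclideanSpace ℝ (Fin q)} (hc : (s₀, c) ∈ ψ₀.source) (hcU : ψ₀ (s₀, c) ∈ U)
    {b : Module.Basis (Fin p) ℝ (Fin p → ℝ)} (hb : ∀ t, A t (ψ₀ (s₀, c)) = ψ₀ (s₀, c) ↔
      ∃ k : Fin p → ℤ, t = ∑ i, (k i : ℝ) • b i) :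
    ∃ (S : Set (EuclideanSpace ℝ (Fin q)))
      (P : EuclideanSpace ℝ (Fin q) → (Fin p → ℝ) →L[ℝ] (Fin p → ℝ)),
      IsOpen S ∧ c ∈ S ∧ (∀ r ∈ S, (s₀, r) ∈ ψ₀.source ∧ ψ₀ (s₀, r) ∈ U) ∧ ContDiffOn ℝ ∞ P S ∧
      (∀ r ∈ S, (P r).IsInvertible) ∧
      (∀ r ∈ S, ∀ k : Fin p → ℤ, A (P r fun i => (k i : ℝ)) (ψ₀ (s₀, r)) = ψ₀ (s₀, r)) ∧
      ∀ t, A (P c t) (ψ₀ (s₀, c)) = ψ₀ (s₀, c) → ∃ k : Fin p → ℤ, t = fun i => (k i : ℝ) := by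
  let σ : EuclideanSpace ℝ (Fin q) → M := fun r => ψ₀ (s₀, r)
  let S₀ : Set (EuclideanSpace ℝ (Fin q)) := {r | (s₀, r) ∈ ψ₀.source}
  have hS₀ : IsOpen S₀ := ψ₀.open_source.preimage (Continuous.prodMk_right s₀)
  have hσ : ContMDiffOn 𝓘(ℝ, EuclideanSpace ℝ (Fin q)) (𝓡 (p + q)) ∞ σ S₀ :=
    hψ₀.contMDiffOn.comp ((contMDiff_iff_contDiff.2 (contDiff_prodMk_right s₀)).contMDiffOn)
      fun r hr => hr
  have hbj : ∀ j, A (b j) (σ c) = σ c := fun j => (hb _).2 ⟨Pi.single j 1, by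
    rw [Finset.sum_eq_single j]
    · simp
    · intro i _ hi; simp [hi]
    · simp⟩
  choose ψ hψ hψm hψΦ using fun j => hA.exists_isFlowBox_orbitMap hψ₀ hc hcU (b j)
  have hψc : ∀ j, ψ j (b j, c) = σ c := fun j => (hψΦ j _ (hψm j)).trans (hbj j)
  let S₁ : Set (EuclideanSpace ℝ (Fin q)) := S₀ ∩ σ ⁻¹' (U ∩ ⋂ j, (ψ j).target)
  have hS₁ : IsOpen S₁ := hσ.continuousOn.isOpen_inter_preimage hS₀
    (hA.isOpen.inter (isOpen_iInter_of_finite fun j => (ψ j).open_target))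
  have hcS₁ : c ∈ S₁ := ⟨hc, hcU, mem_iInter.2 fun j => by
    rw [← hψc j]; exact (ψ j).map_source (hψm j)⟩
  -- The box `ψ j` is the orbit map near (b_j, c). Reading σ r in it therefore solves A (l j r) (σ
  -- r) = σ r smoothly, with value b_j at r = c.
  let l : Fin p → EuclideanSpace ℝ (Fin q) → (Fin p → ℝ) := fun j r => ((ψ j).symm (σ r)).1
  have hl : ∀ j, ContDiffOn ℝ ∞ (l j) S₁ := by
    intro j
    refine contDiff_fst.comp_contDiffOn ?_
    rw [← contMDiffOn_iff_contDiffOn]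
    exact (hψ j).contMDiffOn_symm.comp (hσ.mono inter_subset_left)
      fun r hr => mem_iInter.1 hr.2.2 j
  have hlper : ∀ j, ∀ r ∈ S₁, A (l j r) (σ r) = σ r := by
    intro j r hr
    have h1 : σ r ∈ (ψ j).target := mem_iInter.1 hr.2.2 j
    have h2 : ((ψ j).symm (σ r)).2 = r := by
      rw [(hψ j).symm_snd h1, hψ₀.integralMap_eq hr.1]
    have h3 := hψΦ j _ ((ψ j).map_target h1)
    rw [(ψ j).right_inv h1, h2] at h3
    exact h3.symm
  have hlc : ∀ j, l j c = b j := by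
    intro j
    change ((ψ j).symm (σ c)).1 = b j
    rw [← hψc j, (ψ j).left_inv (hψm j)]
  let P : EuclideanSpace ℝ (Fin q) → (Fin p → ℝ) →L[ℝ] (Fin p → ℝ) := fun r => columnMap fun j => l j r
  have hP : ContDiffOn ℝ ∞ P S₁ := by
    refine ContDiffOn.sum fun i _ => ?_
    exact ((ContinuousLinearMap.smulRightL ℝ (Fin p → ℝ) (Fin p → ℝ)
      (ContinuousLinearMap.proj (R := ℝ) (φ := fun _ : Fin p => ℝ) i)).contDiff).comp_contDiffOn (hl i)
  have hPc : ∀ t, P c t = ∑ i, t i • b i := by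
    intro t
    change columnMap _ t = _
    rw [columnMap_apply]
    simp only [hlc]
  let e₀ : (Fin p → ℝ) ≃L[ℝ] (Fin p → ℝ) := b.equivFun.symm.toContinuousLinearEquiv
  have he₀ : (e₀ : (Fin p → ℝ) →L[ℝ] (Fin p → ℝ)) = P c := by
    ext1 t
    rw [hPc]
    exact b.equivFun_symm_apply t
  let S : Set (EuclideanSpace ℝ (Fin q)) := S₁ ∩ P ⁻¹'
    range ((↑) : ((Fin p → ℝ) ≃L[ℝ] (Fin p → ℝ)) → (Fin p → ℝ) →L[ℝ] (Fin p → ℝ))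
  refine ⟨S, P, hP.continuousOn.isOpen_inter_preimage hS₁ (ContinuousLinearEquiv.isOpen (𝕜 := ℝ)),
    ⟨hcS₁, e₀, he₀⟩, fun r hr => ⟨hr.1.1, hr.1.2.1⟩, hP.mono inter_subset_left, fun r hr => ?_,
    fun r hr k => ?_, fun t ht => ?_⟩
  · obtain ⟨e, he⟩ := hr.2
    exact ⟨e, he⟩
  · have h1 : P r (fun i => (k i : ℝ)) ∈ hA.isotropy (σ r) := by
      change columnMap _ _ ∈ _
      rw [columnMap_apply]
      refine AddSubgroup.sum_mem _ fun j _ => ?_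
      rw [Int.cast_smul_eq_zsmul]
      exact AddSubgroup.zsmul_mem _ (hlper j r hr.1) _
    exact h1
  · obtain ⟨k, hk⟩ := (hb _).1 ht
    refine ⟨k, ?_⟩
    have h1 : e₀ t = e₀ fun i => (k i : ℝ) := by
      have h2 : ∀ u, e₀ u = P c u := fun u => congrArg (fun B => B u) he₀
      rw [h2, h2, hk, hPc]
    exact e₀.injective h1

end Periods

section UniformPeriods

variable {p q : ℕ} {M : Type*} [TopologicalSpace M] [T2Space M]
  [ChartedSpace (EuclideanSpace ℝ (Fin (p + q))) M] [IsManifold (𝓡 (p + q)) ∞ M]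
  {X : Fin p → SmoothVF (p + q) M} {F : Fin q → SmoothFun (p + q) M}
  {U : Set M} {ε : ℝ} {A : (Fin p → ℝ) → M → M}

/-- Over a small ball of parameters, the smooth family of periods exhausts the isotropy groups. -/
theorem IsLocalFlow.exists_ball_forall_period_iff (hA : IsLocalFlow X F U ε A)
    {ψ₀ : OpenPartialHomeomorph (AngleModel p q) M} (hψ₀ : IsFlowBox X F ψ₀) {s₀ : Fin p → ℝ}
    {c : EuclideanSpace ℝ (Fin q)} {S : Set (EuclideanSpace ℝ (Fin q))}
    {P : EuclideanSpace ℝ (Fin q) → (Fin p → ℝ) →L[ℝ] (Fin p → ℝ)} (hS : IsOpen S) (hcS : c ∈ S)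
    (hSU : ∀ r ∈ S, (s₀, r) ∈ ψ₀.source ∧ ψ₀ (s₀, r) ∈ U) (hP : ContDiffOn ℝ ∞ P S)
    (hPi : ∀ r ∈ S, (P r).IsInvertible)
    (hper : ∀ r ∈ S, ∀ k : Fin p → ℤ, A (P r fun i => (k i : ℝ)) (ψ₀ (s₀, r)) = ψ₀ (s₀, r))
    (hPc : ∀ t, A (P c t) (ψ₀ (s₀, c)) = ψ₀ (s₀, c) → ∃ k : Fin p → ℤ, t = fun i => (k i : ℝ)) :
    ∃ ρ > 0, ball c ρ ⊆ S ∧ ∀ r ∈ ball c ρ, ∀ θ, A (P r θ) (ψ₀ (s₀, r)) = ψ₀ (s₀, r) ↔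
      ∃ k : Fin p → ℤ, θ = fun i => (k i : ℝ) := by
  have hcP : ContinuousAt P c := hP.continuousOn.continuousAt (hS.mem_nhds hcS)
  have hcT : ∀ θ₀ : Fin p → ℝ, ContinuousAt
      (fun z : EuclideanSpace ℝ (Fin q) × (Fin p → ℝ) => ((P z.1 z.2, z.1) : AngleModel p q))
      (c, θ₀) := by
    intro θ₀
    have h1 : ContinuousAt (fun z : EuclideanSpace ℝ (Fin q) × (Fin p → ℝ) => P z.1) (c, θ₀) :=
      hcP.comp_of_eq continuousAt_fst rfl
    exact (h1.clm_apply continuousAt_snd).prodMk continuousAt_fst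
  -- Near an integral θ₀ the orbit map is injective in a box, so only the known period occurs. Near
  -- any other θ₀ the endpoints stay distinct, by continuity and separation.
  have key : ∀ θ₀ ∈ Icc (0 : Fin p → ℝ) 1, ∀ᶠ z : EuclideanSpace ℝ (Fin q) × (Fin p → ℝ) in
      𝓝 (c, θ₀), z.1 ∈ S → A (P z.1 z.2) (ψ₀ (s₀, z.1)) = ψ₀ (s₀, z.1) →
        ∃ k : Fin p → ℤ, z.2 = fun i => (k i : ℝ) := by
    intro θ₀ _
    obtain ⟨ψ, hψ, hψm, hψΦ⟩ := hA.exists_isFlowBox_orbitMap hψ₀ (hSU c hcS).1 (hSU c hcS).2 (P c θ₀)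
    have hev : ∀ᶠ z : EuclideanSpace ℝ (Fin q) × (Fin p → ℝ) in 𝓝 (c, θ₀),
        (P z.1 z.2, z.1) ∈ ψ.source :=
      (hcT θ₀).eventually_mem (ψ.open_source.mem_nhds hψm)
    by_cases h0 : A (P c θ₀) (ψ₀ (s₀, c)) = ψ₀ (s₀, c)
    · obtain ⟨k, rfl⟩ := hPc θ₀ h0
      have hev' : ∀ᶠ z : EuclideanSpace ℝ (Fin q) × (Fin p → ℝ) in 𝓝 (c, fun i => (k i : ℝ)),
          (P z.1 (fun i => (k i : ℝ)), z.1) ∈ ψ.source := by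
        have h1 : Tendsto (fun z : EuclideanSpace ℝ (Fin q) × (Fin p → ℝ) =>
            (z.1, fun i => (k i : ℝ))) (𝓝 (c, fun i => (k i : ℝ))) (𝓝 (c, fun i => (k i : ℝ))) :=
          (Continuous.prodMk continuous_fst continuous_const).tendsto' _ _ rfl
        exact h1.eventually hev
      filter_upwards [hev, hev'] with z hz hz' hzS h
      refine ⟨k, ?_⟩
      have h2 : ψ (P z.1 z.2, z.1) = ψ (P z.1 (fun i => (k i : ℝ)), z.1) := by
        rw [hψΦ _ hz, hψΦ _ hz']
        exact h.trans (hper _ hzS k).symm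
      have h3 : P z.1 z.2 = P z.1 (fun i => (k i : ℝ)) := congrArg Prod.fst (ψ.injOn hz hz' h2)
      obtain ⟨e, he⟩ := hPi _ hzS
      rw [← he] at h3
      exact e.injective h3
    · have h1 : ContinuousAt (fun z : EuclideanSpace ℝ (Fin q) × (Fin p → ℝ) =>
          A (P z.1 z.2) (ψ₀ (s₀, z.1))) (c, θ₀) := by
        have h2 : ContinuousAt (fun z : EuclideanSpace ℝ (Fin q) × (Fin p → ℝ) =>
          ψ (P z.1 z.2, z.1)) (c, θ₀) :=
          ContinuousAt.comp (f := fun z : EuclideanSpace ℝ (Fin q) × (Fin p → ℝ) =>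
            ((P z.1 z.2, z.1) : AngleModel p q)) (g := ψ) (ψ.continuousAt hψm) (hcT θ₀)
        exact h2.congr (hev.mono fun z hz => hψΦ _ hz)
      have h2 : ContinuousAt (fun z : EuclideanSpace ℝ (Fin q) × (Fin p → ℝ) =>
          ψ₀ (s₀, z.1)) (c, θ₀) :=
        ContinuousAt.comp (f := fun z : EuclideanSpace ℝ (Fin q) × (Fin p → ℝ) =>
            ((s₀, z.1) : AngleModel p q)) (g := ψ₀) (ψ₀.continuousAt (hSU c hcS).1)
          (by fun_prop)
      filter_upwards [(h1.ne_iff_eventually_ne h2).1 h0] with z hz _ h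
      exact absurd h hz
  have h1 := (isCompact_Icc (a := (0 : Fin p → ℝ)) (b := 1)).eventually_forall_of_forall_eventually
    (P := fun r θ => r ∈ S → A (P r θ) (ψ₀ (s₀, r)) = ψ₀ (s₀, r) →
        ∃ k : Fin p → ℤ, θ = fun i => (k i : ℝ)) key
  obtain ⟨ρ, hρ, hball⟩ := Metric.eventually_nhds_iff_ball.1 (h1.and (hS.mem_nhds hcS))
  refine ⟨ρ, hρ, fun r hr => (hball r hr).2, fun r hr θ => ⟨fun h => ?_, ?_⟩⟩
  · have hrS := (hball r hr).2
    -- Subtracting integer parts, which are known periods, brings θ into the compact unit cube.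
    obtain ⟨k, hk⟩ := (hball r hr).1 (fun i => Int.fract (θ i))
      ⟨fun i => Int.fract_nonneg _, fun i => (Int.fract_lt_one _).le⟩ hrS (by
        have h2 : (fun i => Int.fract (θ i)) = θ + fun i => ((-⌊θ i⌋ : ℤ) : ℝ) := by
          funext i
          simp [Int.fract, sub_eq_add_neg]
        rw [h2, map_add, hA.add, hper r hrS, h])
    refine ⟨fun i => k i + ⌊θ i⌋, ?_⟩
    funext i
    have := congrFun hk i
    push_cast
    rw [← this, Int.fract_add_floor]
  · rintro ⟨k, rfl⟩
    exact hper r (hball r hr).2 k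

end UniformPeriods

/-! ### Normalisation of the periods and construction of Liouville charts. -/

section Shear

variable {V R : Type*} [NormedAddCommGroup V] [NormedSpace ℝ V] [CompleteSpace V]
  [NormedAddCommGroup R] [NormedSpace ℝ R]

/-- The linear change of fibre coordinates `(θ, w) ↦ (P (c + ρ w) θ, c + ρ w)`. -/
theorem exists_linear_shear {c : R} {ρ : ℝ} (hρ : 0 < ρ) {P : R → V →L[ℝ] V}
    (hP : ContDiffOn ℝ ∞ P (ball c ρ)) (hPi : ∀ r ∈ ball c ρ, (P r).IsInvertible) :
    ∃ s : OpenPartialHomeomorph (V × R) (V × R), s.source = univ ×ˢ ball 0 1 ∧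
      (∀ z, s z = (P (c + ρ • z.2) z.1, c + ρ • z.2)) ∧
      ContDiffOn ℝ ∞ s s.source ∧ ContDiffOn ℝ ∞ s.symm s.target := by
  have hin : ∀ w : R, w ∈ ball (0 : R) 1 → c + ρ • w ∈ ball c ρ := by
    intro w hw
    rw [mem_ball_zero_iff] at hw
    rw [mem_ball_iff_norm, add_sub_cancel_left, norm_smul, Real.norm_of_nonneg hρ.le]
    nlinarith
  have hout : ∀ r : R, r ∈ ball c ρ → ρ⁻¹ • (r - c) ∈ ball (0 : R) 1 := by
    intro r hr
    rw [mem_ball_iff_norm] at hr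
    rw [mem_ball_zero_iff, norm_smul, norm_inv, Real.norm_of_nonneg hρ.le,
      inv_mul_lt_iff₀ hρ, mul_one]
    exact hr
  have hcancel : ∀ r : R, c + ρ • ρ⁻¹ • (r - c) = r := fun r => by
    rw [smul_inv_smul₀ hρ.ne', add_sub_cancel]
  have hPinv : ContDiffOn ℝ ∞ (fun r => (P r).inverse) (ball c ρ) := by
    intro r hr
    obtain ⟨e, he⟩ := hPi r hr
    refine ContDiffAt.contDiffWithinAt ?_
    have h1 := contDiffAt_map_inverse (𝕜 := ℝ) (n := ∞) e
    rw [he] at h1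
    exact h1.comp r (hP.contDiffAt (isOpen_ball.mem_nhds hr))
  have hs : ContDiffOn ℝ ∞ (fun z : V × R => (P (c + ρ • z.2) z.1, c + ρ • z.2))
      (univ ×ˢ ball 0 1) := by
    have h1 : ContDiffOn ℝ ∞ (fun z : V × R => P (c + ρ • z.2)) (univ ×ˢ ball 0 1) :=
      hP.comp (by fun_prop) fun z hz => hin _ hz.2
    exact (h1.clm_apply contDiffOn_fst).prodMk (by fun_prop)
  have hs' : ContDiffOn ℝ ∞ (fun z : V × R => ((P z.2).inverse z.1, ρ⁻¹ • (z.2 - c)))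
      (univ ×ˢ ball c ρ) := by
    have h1 : ContDiffOn ℝ ∞ (fun z : V × R => (P z.2).inverse) (univ ×ˢ ball c ρ) :=
      hPinv.comp contDiffOn_snd fun z hz => hz.2
    exact (h1.clm_apply contDiffOn_fst).prodMk (by fun_prop)
  let s : OpenPartialHomeomorph (V × R) (V × R) :=
    { toFun := fun z => (P (c + ρ • z.2) z.1, c + ρ • z.2)
      invFun := fun z => ((P z.2).inverse z.1, ρ⁻¹ • (z.2 - c))
      source := univ ×ˢ ball 0 1
      target := univ ×ˢ ball c ρ
      map_source' := fun z hz => ⟨mem_univ _, hin _ hz.2⟩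
      map_target' := fun z hz => ⟨mem_univ _, hout _ hz.2⟩
      left_inv' := fun z hz => by
        obtain ⟨e, he⟩ := hPi _ (hin _ hz.2)
        refine Prod.ext ?_ ?_
        · simp [← he]
        · simp [inv_smul_smul₀ hρ.ne']
      right_inv' := fun z hz => by
        obtain ⟨e, he⟩ := hPi _ hz.2
        refine Prod.ext ?_ (hcancel _)
        simp only [hcancel]
        simp [← he]
      open_source := isOpen_univ.prod isOpen_ball
      open_target := isOpen_univ.prod isOpen_ball
      continuousOn_toFun := hs.continuousOn
      continuousOn_invFun := hs'.continuousOn }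
  exact ⟨s, rfl, fun _ => rfl, hs, hs'⟩

end Shear

section Existence

variable {p q : ℕ} {M : Type*} [TopologicalSpace M]
  [ChartedSpace (EuclideanSpace ℝ (Fin (p + q))) M] [IsManifold (𝓡 (p + q)) ∞ M]
  {X : Fin p → SmoothVF (p + q) M} {F : Fin q → SmoothFun (p + q) M}

theorem sum_smul_apply_single {E : Type*} [NormedAddCommGroup E] [NormedSpace ℝ E]
    (D : AngleModel p q →L[ℝ] E) (v : Fin p → ℝ) :
    ∑ j, v j • D (Pi.single j 1, 0) = D (v, 0) := by
  have h4 : (v, (0 : EuclideanSpace ℝ (Fin q))) =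
      ∑ j, v j • ((Pi.single j 1, 0) : AngleModel p q) := by
    refine Prod.ext ?_ ?_
    · rw [Prod.fst_sum]
      exact pi_eq_sum_univ' v
    · rw [Prod.snd_sum]
      simp
  rw [h4, map_sum]
  simp only [map_smul]

/-- Chain rule: the box sends the i-th basis vector to X_i, so in the coordinates ψ ∘ s the
coefficients of X_i form the vector that the derivative of `s` maps to that basis vector. -/
theorem IsFlowBox.vectorField_eq_sum {ψ : OpenPartialHomeomorph (AngleModel p q) M}
    (hψ : IsFlowBox X F ψ) {s : AngleModel p q → AngleModel p q} {Ψ : AngleModel p q → M}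
    {z : AngleModel p q} (hΨ : Ψ =ᶠ[𝓝 z] ψ ∘ s) (hz : s z ∈ ψ.source)
    {Q : AngleModel p q →L[ℝ] AngleModel p q} (hsz : HasFDerivAt s Q z) {i : Fin p} {v : Fin p → ℝ}
    (hv : Q (v, 0) = (Pi.single i 1, 0)) :
    X i (Ψ z) = ∑ j, v j • (mfderiv 𝓘(ℝ, AngleModel p q) (𝓡 (p + q)) Ψ z
      (Pi.single j (1 : ℝ), (0 : EuclideanSpace ℝ (Fin q))) : TangentSpace (𝓡 (p + q)) (Ψ z)) := by
  let D : AngleModel p q →L[ℝ] EuclideanSpace ℝ (Fin (p + q)) :=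
    mfderiv 𝓘(ℝ, AngleModel p q) (𝓡 (p + q)) Ψ z
  let D' : AngleModel p q →L[ℝ] EuclideanSpace ℝ (Fin (p + q)) :=
    mfderiv 𝓘(ℝ, AngleModel p q) (𝓡 (p + q)) ψ (s z)
  have hD : D = D'.comp Q := by
    have h2 := ((hψ.mdifferentiableAt hz).hasMFDerivAt.comp z hsz.hasMFDerivAt).mfderiv
    exact (Filter.EventuallyEq.mfderiv_eq (I := 𝓘(ℝ, AngleModel p q)) (I' := 𝓡 (p + q)) hΨ).trans h2
  have hXi : (X i (Ψ z) : EuclideanSpace ℝ (Fin (p + q))) = D' (Pi.single i 1, 0) := by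
    rw [hΨ.self_of_nhds]
    exact (hψ.mfderiv_single _ hz i).symm
  refine Eq.trans hXi ?_
  change _ = ∑ j, v j • D (Pi.single j 1, 0)
  rw [sum_smul_apply_single, hD]
  change _ = D' (Q _)
  rw [hv]


/-- Everything is checked on the covering space. The hypothesis `ha` quantifies over all `Ψ` with
the germ of `Ξ` because the lift of the resulting chart agrees with `Ξ` only over the ball. -/
theorem nonempty_liouvilleChart_of_lift {Ξ : AngleModel p q → M} {N : Set M}
    (hfib : ∀ z z' : AngleModel p q, z.2 ∈ ball (0 : EuclideanSpace ℝ (Fin q)) 1 →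
      z'.2 ∈ ball (0 : EuclideanSpace ℝ (Fin q)) 1 →
      (Ξ z = Ξ z' ↔ z.2 = z'.2 ∧ ∀ i, ∃ k : ℤ, z.1 i - z'.1 i = k))
    (hloc : ∀ z : AngleModel p q, z.2 ∈ ball (0 : EuclideanSpace ℝ (Fin q)) 1 →
      ∃ χ : OpenPartialHomeomorph (AngleModel p q) M, IsSmoothParam (E := EuclideanSpace ℝ (Fin (p + q))) χ ∧
        z ∈ χ.source ∧ ∀ w ∈ χ.source, w.2 ∈ ball (0 : EuclideanSpace ℝ (Fin q)) 1 ∧ χ w = Ξ w)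
    (hN : ∀ y ∈ N, ∃ z : AngleModel p q, z.2 ∈ ball (0 : EuclideanSpace ℝ (Fin q)) 1 ∧ Ξ z = y)
    {a : Fin p → Fin p → EuclideanSpace ℝ (Fin q) → ℝ}
    (ha : ∀ i θ, ∀ r ∈ ball (0 : EuclideanSpace ℝ (Fin q)) 1, ∀ Ψ : AngleModel p q → M,
      Ψ =ᶠ[𝓝 (θ, r)] Ξ → X i (Ψ (θ, r)) = ∑ j, a i j r •
        (mfderiv 𝓘(ℝ, AngleModel p q) (𝓡 (p + q)) Ψ (θ, r)
          (Pi.single j (1 : ℝ), (0 : EuclideanSpace ℝ (Fin q))) :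
            TangentSpace (𝓡 (p + q)) (Ψ (θ, r))))
    {f : Fin q → EuclideanSpace ℝ (Fin q) → ℝ}
    (hf : ∀ j θ, ∀ r ∈ ball (0 : EuclideanSpace ℝ (Fin q)) 1, F j (Ξ (θ, r)) = f j r) :
    Nonempty (LiouvilleChart X F N) := by
  have hmap : ∀ z : AngleModel p q, z.2 ∈ ball (0 : EuclideanSpace ℝ (Fin q)) 1 →
      map Ξ (𝓝 z) = 𝓝 (Ξ z) := by
    intro z hz
    obtain ⟨χ, -, hzχ, hχΞ⟩ := hloc z hz
    rw [← (hχΞ z hzχ).2, ← χ.map_nhds_eq hzχ]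
    refine Filter.map_congr ?_
    filter_upwards [χ.open_source.mem_nhds hzχ] with w hw using (hχΞ w hw).2.symm
  obtain ⟨e, heS, heT, he⟩ := exists_chart_of_lift isOpen_ball hfib hmap
  have hev : ∀ θ, ∀ r ∈ ball (0 : EuclideanSpace ℝ (Fin q)) 1, coverLift e =ᶠ[𝓝 (θ, r)] Ξ := by
    intro θ r hr
    filter_upwards [(isOpen_ball.preimage continuous_snd).mem_nhds hr] with w hw using he w hw
  have hX := fun i θ r hr => ha i θ r hr (coverLift e) (hev θ r hr)
  have hF : ∀ j θ, ∀ r ∈ ball (0 : EuclideanSpace ℝ (Fin q)) 1, F j (coverLift e (θ, r)) = f j r :=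
    fun j θ r hr => (congrArg (F j) (he (θ, r) hr)).trans (hf j θ r hr)
  refine ⟨{ toOpenPartialHomeomorph := e, subset_source := ?_, target_eq := heT,
            isLocalDiffeomorphOn_lift := ?_, vectorField_eq := ⟨a, hX⟩,
            firstIntegral_eq := ⟨f, hF⟩ }⟩
  · intro y hy
    obtain ⟨z, hz, rfl⟩ := hN y hy
    rw [heS]
    exact ⟨z, ⟨mem_univ _, hz⟩, rfl⟩
  · rintro ⟨z, hz⟩
    obtain ⟨χ, hχ, hzχ, hχΞ⟩ := hloc z hz.2
    exact ⟨⟨χ.toPartialEquiv, χ.open_source, χ.open_target, hχ.contMDiffOn, hχ.contMDiffOn_symm⟩,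
      hzχ, fun w hw => (he w (hχΞ w hw).1).trans (hχΞ w hw).2.symm⟩

variable {U : Set M} {ε : ℝ} {A : (Fin p → ℝ) → M → M}

/-- The substitution r = c + ρw, t = P r θ normalises the ball to radius 1 and the period lattice to
ℤ^p. The level then determines w, and equality of points on one level means integral differences of
angles. The coefficients of X_i are those of (P r)⁻¹ applied to the i-th basis vector, hence free of
θ. -/
theorem IsLocalFlow.nonempty_liouvilleChart (hA : IsLocalFlow X F U ε A)
    {ψ₀ : OpenPartialHomeomorph (AngleModel p q) M} (hψ₀ : IsFlowBox X F ψ₀) {s₀ : Fin p → ℝ}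
    {c : EuclideanSpace ℝ (Fin q)} {ρ : ℝ} (hρ : 0 < ρ)
    {P : EuclideanSpace ℝ (Fin q) → (Fin p → ℝ) →L[ℝ] (Fin p → ℝ)}
    (hSU : ∀ r ∈ ball c ρ, (s₀, r) ∈ ψ₀.source ∧ ψ₀ (s₀, r) ∈ U) (hP : ContDiffOn ℝ ∞ P (ball c ρ))
    (hPi : ∀ r ∈ ball c ρ, (P r).IsInvertible)
    (hper : ∀ r ∈ ball c ρ, ∀ θ, A (P r θ) (ψ₀ (s₀, r)) = ψ₀ (s₀, r) ↔
      ∃ k : Fin p → ℤ, θ = fun i => (k i : ℝ))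
    {N : Set M} (hN : ∀ y ∈ N, ∃ t, A t (ψ₀ (s₀, c)) = y) :
    Nonempty (LiouvilleChart X F N) := by
  obtain ⟨s, hsS, hs, hsd, hsd'⟩ := exists_linear_shear hρ hP hPi
  have hin : ∀ z ∈ s.source, c + ρ • z.2 ∈ ball c ρ := by
    intro z hz
    rw [hsS] at hz
    have hw := mem_ball_zero_iff.1 hz.2
    rw [mem_ball_iff_norm, add_sub_cancel_left, norm_smul, Real.norm_of_nonneg hρ.le]
    nlinarith
  have hsrc : ∀ z : AngleModel p q, z.2 ∈ ball (0 : EuclideanSpace ℝ (Fin q)) 1 → z ∈ s.source := by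
    intro z hz
    rw [hsS]
    exact ⟨mem_univ _, hz⟩
  let Ξ : AngleModel p q → M := fun z => A (s z).1 (ψ₀ (s₀, (s z).2))
  have hΞF : ∀ z ∈ s.source, integralMap F (Ξ z) = c + ρ • z.2 := by
    intro z hz
    have h1 := hSU _ (hin z hz)
    change integralMap F (A (s z).1 (ψ₀ (s₀, (s z).2))) = _
    rw [hs]
    rw [hA.integralMap_apply _ h1.2, hψ₀.integralMap_eq h1.1]
  have hbox : ∀ z ∈ s.source, ∃ ψ : OpenPartialHomeomorph (AngleModel p q) M, IsFlowBox X F ψ ∧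
      z ∈ (s.trans ψ).source ∧ ∀ w ∈ (s.trans ψ).source, s.trans ψ w = Ξ w := by
    intro z hz
    have h1 := hSU _ (hin z hz)
    obtain ⟨ψ, hψ, hψm, hψΦ⟩ := hA.exists_isFlowBox_orbitMap hψ₀ h1.1 h1.2 (s z).1
    refine ⟨ψ, hψ, ⟨hz, ?_⟩, fun w hw => hψΦ _ hw.2⟩
    change s z ∈ ψ.source
    rw [hs] at hψm ⊢
    exact hψm
  have hfib : ∀ z z' : AngleModel p q, z.2 ∈ ball (0 : EuclideanSpace ℝ (Fin q)) 1 →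
      z'.2 ∈ ball (0 : EuclideanSpace ℝ (Fin q)) 1 →
      (Ξ z = Ξ z' ↔ z.2 = z'.2 ∧ ∀ i, ∃ k : ℤ, z.1 i - z'.1 i = k) := by
    rintro ⟨θ, r⟩ ⟨θ', r'⟩ hz hz'
    have key : Ξ (θ, r) = Ξ (θ', r) ↔ ∀ i, ∃ k : ℤ, θ i - θ' i = k := by
      have h1 : Ξ (θ, r) = Ξ (θ', r) ↔
          A (P (c + ρ • r) (θ - θ')) (ψ₀ (s₀, c + ρ • r)) = ψ₀ (s₀, c + ρ • r) := by
        change A (s _).1 (ψ₀ (s₀, (s _).2)) = A (s _).1 (ψ₀ (s₀, (s _).2)) ↔ _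
        rw [hs, hs]
        have h2 : P (c + ρ • r) (θ - θ') = -(P (c + ρ • r) θ') + P (c + ρ • r) θ := by
          rw [map_sub]; abel
        rw [h2, hA.add]
        constructor
        · intro h
          rw [h, hA.neg_apply]
        · intro h
          have := congrArg (A (P (c + ρ • r) θ')) h
          rwa [← hA.add, add_neg_cancel, hA.zero] at this
      rw [h1, hper _ (hin _ (hsrc _ hz))]
      simp only [funext_iff, Pi.sub_apply]
      exact ⟨fun ⟨k, hk⟩ i => ⟨k i, hk i⟩, fun h => ⟨fun i => (h i).choose, fun i => (h i).choose_spec⟩⟩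
    constructor
    · intro h
      have h1 := congrArg (integralMap F) h
      rw [hΞF _ (hsrc _ hz), hΞF _ (hsrc _ hz')] at h1
      have h2 : r = r' := smul_right_injective _ hρ.ne' (add_left_cancel h1)
      subst h2
      exact ⟨rfl, key.1 h⟩
    · rintro ⟨h1, h2⟩
      have h1 : r = r' := h1
      subst h1
      exact key.2 h2
  refine nonempty_liouvilleChart_of_lift (X := X) (F := F) (Ξ := Ξ) hfib (fun z hz => ?_)
    (fun y hy => ?_) (a := fun i j w => (P (c + ρ • w)).inverse (Pi.single i 1) j)
    (fun i θ r hr Ψ hΨ => ?_) (f := fun j w => (c + ρ • w) j) (fun j θ r hr => ?_)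
  · obtain ⟨ψ, hψ, hzψ, hψΞ⟩ := hbox z (hsrc z hz)
    refine ⟨s.trans ψ, hψ.toIsSmoothParam.comp hsd hsd', hzψ, fun w hw => ⟨?_, hψΞ w hw⟩⟩
    have this : w ∈ s.source := hw.1
    rw [hsS] at this
    exact this.2
  · obtain ⟨t, rfl⟩ := hN y hy
    obtain ⟨E, hE⟩ := hPi c (mem_ball_self hρ)
    refine ⟨(E.symm t, 0), mem_ball_self one_pos, ?_⟩
    change A (s _).1 (ψ₀ (s₀, (s _).2)) = _
    rw [hs]
    simp [← hE]
  · have hz : ((θ, r) : AngleModel p q) ∈ s.source := hsrc (θ, r) hr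
    obtain ⟨ψ, hψ, hzψ, hψΞ⟩ := hbox (θ, r) hz
    obtain ⟨E, hE⟩ := hPi _ (hin _ hz)
    have hsz : HasFDerivAt s (fderiv ℝ s (θ, r)) (θ, r) :=
      ((hsd.contDiffAt (s.open_source.mem_nhds hz)).differentiableAt (by simp)).hasFDerivAt
    have hs0 : ∀ v, fderiv ℝ s (θ, r) (v, 0) = (P (c + ρ • r) v, 0) := by
      have h1 : HasFDerivAt (fun t => s (t, r)) ((fderiv ℝ s (θ, r)).comp
          ((ContinuousLinearMap.id ℝ _).prod 0)) θ :=
        HasFDerivAt.comp (f := fun t : Fin p → ℝ => (t, r)) θ hsz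
          ((hasFDerivAt_id θ).prodMk (hasFDerivAt_const r θ))
      have h2 : HasFDerivAt (fun t => s (t, r)) ((P (c + ρ • r)).prod 0) θ := by
        have : (fun t => s (t, r)) = fun t => (P (c + ρ • r) t, c + ρ • r) := funext fun t => hs _
        rw [this]
        exact (P (c + ρ • r)).hasFDerivAt.prodMk (hasFDerivAt_const _ _)
      exact fun v => congrArg (fun B : (Fin p → ℝ) →L[ℝ] AngleModel p q => B v) (h1.unique h2)
    have h1 : Ψ =ᶠ[𝓝 ((θ, r) : AngleModel p q)] ψ ∘ s := by
      refine hΨ.trans ?_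
      filter_upwards [(s.trans ψ).open_source.mem_nhds hzψ] with w hw using (hψΞ w hw).symm
    refine hψ.vectorField_eq_sum h1 hzψ.2 hsz ?_
    rw [hs0]
    simp [← hE]
  · have h1 : integralMap F (Ξ (θ, r)) = c + ρ • r := hΞF (θ, r) (hsrc (θ, r) hr)
    rw [← h1]
    rfl

variable [T2Space M]

/-- Liouville charts exist near a regular compact connected level set. -/
theorem nonempty_liouvilleChart
    (hcomm : ∀ i j x, VectorField.mlieBracket (𝓡 (p + q)) (X i) (X j) x = 0)
    (hFI : ∀ i j, applyVF (X i) (F j) = 0) {c : Fin q → ℝ}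
    (hconn : IsConnected (levelSet F c)) (hcomp : IsCompact (levelSet F c))
    (hreg : ∀ x ∈ levelSet F c, IsRegularPoint X F x) :
    Nonempty (LiouvilleChart X F (levelSet F c)) := by
  have hN : levelSet F c = {x | integralMap F x = WithLp.toLp 2 c} := by
    ext x
    refine ⟨fun h => PiLp.ext h, fun h j => ?_⟩
    exact congrFun (congrArg WithLp.ofLp h) j
  rw [hN] at hconn hcomp hreg ⊢
  obtain ⟨x₀, hx₀⟩ := hconn.nonempty
  obtain ⟨U, ε, A, hA, hNU⟩ := exists_action (X := X) (F := F) (fun x hx => by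
      obtain ⟨ψ, h1, h2, -⟩ := exists_isFlowBox hcomm hFI hx isOpen_univ (mem_univ x)
      exact ⟨ψ, h1, h2⟩) hcomp hreg ⟨x₀, hx₀⟩
  obtain ⟨ψ₀, hψ₀, hx₀ψ, -⟩ := exists_isFlowBox hcomm hFI (hreg x₀ hx₀) isOpen_univ (mem_univ x₀)
  have hz₀ : ψ₀.symm x₀ = ((ψ₀.symm x₀).1, WithLp.toLp 2 c) :=
    Prod.ext rfl (by rw [hψ₀.symm_snd hx₀ψ]; exact hx₀)
  have hmem : ((ψ₀.symm x₀).1, WithLp.toLp 2 c) ∈ ψ₀.source := by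
    rw [← hz₀]; exact ψ₀.map_target hx₀ψ
  have hψx : ψ₀ ((ψ₀.symm x₀).1, WithLp.toLp 2 c) = x₀ := by
    rw [← hz₀, ψ₀.right_inv hx₀ψ]
  obtain ⟨b, hb⟩ := hA.exists_period_basis hNU hcomp hconn.isPreconnected hx₀
  obtain ⟨S, P, hS, hcS, hSU, hP, hPi, hper, hPc⟩ := hA.exists_period_family hψ₀ hmem
    (by rw [hψx]; exact hNU _ hx₀) (b := b) (by rw [hψx]; exact hb)
  obtain ⟨ρ, hρ, hρS, hball⟩ := hA.exists_ball_forall_period_iff hψ₀ hS hcS hSU hP hPi hper hPc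
  obtain ⟨R, hR⟩ := hA.exists_forall_mem_orbit hNU hcomp hconn.isPreconnected hx₀
  refine hA.nonempty_liouvilleChart hψ₀ hρ (fun r hr => hSU r (hρS hr)) (hP.mono hρS)
    (fun r hr => hPi r (hρS hr)) hball fun y hy => ?_
  obtain ⟨t, -, ht⟩ := hR y hy
  exact ⟨t, by rw [hψx]; exact ht⟩

end Existence

/-! ### Extension of germs, and vanishing orders along a subspace. -/

section Extension

variable {E : Type*} [NormedAddCommGroup E] [NormedSpace ℝ E] [FiniteDimensional ℝ E]
  {M : Type*} [TopologicalSpace M] [ChartedSpace E M] [IsManifold 𝓘(ℝ, E) ∞ M] [T2Space M]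
  {G : Type*} [NormedAddCommGroup G] [NormedSpace ℝ G]

/-- Every germ of a smooth function extends to a global smooth function. -/
theorem exists_contMDiff_eventuallyEq {u : M → G} {O : Set M} (hO : IsOpen O)
    (hu : ContMDiffOn 𝓘(ℝ, E) 𝓘(ℝ, G) ∞ u O) {x : M} (hx : x ∈ O) :
    ∃ v : M → G, ContMDiff 𝓘(ℝ, E) 𝓘(ℝ, G) ∞ v ∧ v =ᶠ[𝓝 x] u := by
  obtain ⟨f, -, hfO⟩ := (SmoothBumpFunction.nhds_basis_tsupport (I := 𝓘(ℝ, E)) x).mem_iff.1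
    (hO.mem_nhds hx)
  refine ⟨fun y => f y • u y, ?_, ?_⟩
  · refine contMDiff_of_tsupport fun y hy => ?_
    have hyf : y ∈ tsupport f := closure_mono (Function.support_smul_subset_left _ _) hy
    exact f.contMDiffAt.smul (hu.contMDiffAt (hO.mem_nhds (hfO hyf)))
  · filter_upwards [f.eventuallyEq_one] with y hy
    rw [hy]
    simp

end Extension

section IteratedDerivatives

variable {E : Type*} [NormedAddCommGroup E] [NormedSpace ℝ E]

theorem contDiff_fderiv_apply {u : E → ℝ} (hu : ContDiff ℝ ∞ u) (v : E) :
    ContDiff ℝ ∞ fun x => fderiv ℝ u x v :=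
  (hu.fderiv_right (m := ∞) (by simp)).clm_apply contDiff_const

theorem fderiv_fderiv_apply_comm {u : E → ℝ} (hu : ContDiff ℝ ∞ u) (v w x : E) :
    fderiv ℝ (fun y => fderiv ℝ u y v) x w = fderiv ℝ (fun y => fderiv ℝ u y w) x v := by
  have h1 : DifferentiableAt ℝ (fderiv ℝ u) x :=
    (hu.fderiv_right (m := ∞) (by simp)).differentiable (by simp) x
  rw [fderiv_clm_apply h1 (by fun_prop), fderiv_clm_apply h1 (by fun_prop)]
  simpa using (hu.contDiffAt.isSymmSndFDerivAt (by simp; norm_cast)) w v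

theorem iteratedFDeriv_succ_apply_eq {u : E → ℝ} (hu : ContDiff ℝ ∞ u) {k : ℕ} (x : E)
    (m : Fin (k + 1) → E) :
    iteratedFDeriv ℝ (k + 1) u x m =
      iteratedFDeriv ℝ k (fun y => fderiv ℝ u y (m (Fin.last k))) x (Fin.init m) := by
  rw [iteratedFDeriv_succ_apply_right]
  have h1 := (ContinuousLinearMap.apply ℝ ℝ (m (Fin.last k))).iteratedFDeriv_comp_left
    (f := fun y => fderiv ℝ u y) (x := x) (n := ∞)
    (hu.fderiv_right (m := ∞) (by simp)).contDiffAt (i := k) (by exact_mod_cast le_top)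
  exact (congrArg (fun B => B (Fin.init m)) h1).symm

theorem differentiable_iteratedFDeriv_apply {u : E → ℝ} (hu : ContDiff ℝ ∞ u) {k : ℕ}
    (m : Fin k → E) : Differentiable ℝ fun y => iteratedFDeriv ℝ k u y m :=
  (hu.differentiable_iteratedFDeriv (by exact_mod_cast WithTop.coe_lt_top _)).continuousMultilinear_apply_const m

theorem fderiv_iteratedFDeriv_apply {u : E → ℝ} (hu : ContDiff ℝ ∞ u) {k : ℕ} (m : Fin k → E)
    (x v : E) : fderiv ℝ (fun y => iteratedFDeriv ℝ k u y m) x v =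
      iteratedFDeriv ℝ k (fun y => fderiv ℝ u y v) x m := by
  induction k generalizing u with
  | zero => simp
  | succ k ih =>
    simp only [iteratedFDeriv_succ_apply_eq hu]
    rw [ih (contDiff_fderiv_apply hu _), iteratedFDeriv_succ_apply_eq (contDiff_fderiv_apply hu _)]
    congr 2
    funext y
    exact fderiv_fderiv_apply_comm hu _ _ _

end IteratedDerivatives

section Vanishing

variable {E : Type*} [NormedAddCommGroup E] [NormedSpace ℝ E]

/-- The function `u` is smooth and vanishes to order at least `n` along the subspace `K`. -/
def VanishesToOrder (K : Submodule ℝ E) : ℕ → (E → ℝ) → Prop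
  | 0, u => ContDiff ℝ ∞ u
  | n + 1, u => ContDiff ℝ ∞ u ∧ (∀ x ∈ K, u x = 0) ∧
      ∀ v, VanishesToOrder K n fun x => fderiv ℝ u x v

variable {K : Submodule ℝ E}

theorem VanishesToOrder.contDiff {n : ℕ} {u : E → ℝ} (hu : VanishesToOrder K n u) :
    ContDiff ℝ ∞ u := by
  cases n with
  | zero => exact hu
  | succ n => exact hu.1

theorem VanishesToOrder.add {n : ℕ} {u w : E → ℝ} (hu : VanishesToOrder K n u)
    (hw : VanishesToOrder K n w) : VanishesToOrder K n fun x => u x + w x := by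
  induction n generalizing u w with
  | zero => exact ContDiff.add hu hw
  | succ n ih =>
    refine ⟨hu.1.add hw.1, fun x hx => by simp [hu.2.1 x hx, hw.2.1 x hx], fun v => ?_⟩
    have h1 : (fun x => fderiv ℝ (fun x => u x + w x) x v) =
        fun x => fderiv ℝ u x v + fderiv ℝ w x v := by
      funext x
      rw [fderiv_fun_add (hu.1.differentiable (by simp) x) (hw.1.differentiable (by simp) x)]
      rfl
    rw [h1]
    exact ih (hu.2.2 v) (hw.2.2 v)

theorem vanishesToOrder_zero_fun (n : ℕ) : VanishesToOrder K n fun _ => 0 := by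
  induction n with
  | zero => exact contDiff_const
  | succ n ih => exact ⟨contDiff_const, fun _ _ => rfl, fun v => by simpa using ih⟩

theorem VanishesToOrder.sum {ι : Type*} (s : Finset ι) {n : ℕ} {u : ι → E → ℝ}
    (hu : ∀ i ∈ s, VanishesToOrder K n (u i)) : VanishesToOrder K n fun x => ∑ i ∈ s, u i x := by
  classical
  induction s using Finset.induction_on with
  | empty => simpa using vanishesToOrder_zero_fun n
  | insert i s hi ih =>
    simp only [Finset.sum_insert hi]
    exact (hu i (Finset.mem_insert_self _ _)).add (ih fun j hj => hu j (Finset.mem_insert_of_mem hj))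

theorem fderiv_mul_apply {b u : E → ℝ} (hb : ContDiff ℝ ∞ b) (hu : ContDiff ℝ ∞ u) (v : E) :
    (fun x => fderiv ℝ (fun x => b x * u x) x v) =
      fun x => b x * fderiv ℝ u x v + fderiv ℝ b x v * u x := by
  funext x
  rw [fderiv_fun_mul (hb.differentiable (by simp) x) (hu.differentiable (by simp) x)]
  simp [mul_comm]

theorem VanishesToOrder.of_succ {n : ℕ} {u : E → ℝ} (hu : VanishesToOrder K (n + 1) u) :
    VanishesToOrder K n u := by
  induction n generalizing u with
  | zero => exact hu.1
  | succ n ih => exact ⟨hu.1, hu.2.1, fun v => ih (hu.2.2 v)⟩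

theorem VanishesToOrder.smooth_mul {n : ℕ} {b u : E → ℝ} (hb : ContDiff ℝ ∞ b)
    (hu : VanishesToOrder K n u) : VanishesToOrder K n fun x => b x * u x := by
  induction n generalizing b u with
  | zero => exact ContDiff.mul hb hu
  | succ n ih =>
    refine ⟨hb.mul hu.1, fun x hx => by simp [hu.2.1 x hx], fun v => ?_⟩
    rw [fderiv_mul_apply hb hu.1]
    exact (ih hb (hu.2.2 v)).add (ih (contDiff_fderiv_apply hb v) hu.of_succ)

/-- By the Leibniz rule, a derivative falling on b leaves u intact, and one falling on u leaves the
factor b, which regains the lost order by induction. -/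
theorem VanishesToOrder.mul_of_forall_eq_zero {n : ℕ} {b u : E → ℝ} (hb : ContDiff ℝ ∞ b)
    (hb0 : ∀ x ∈ K, b x = 0) (hu : VanishesToOrder K n u) :
    VanishesToOrder K (n + 1) fun x => b x * u x := by
  induction n generalizing u with
  | zero =>
    exact ⟨hb.mul hu, fun x hx => by simp [hb0 x hx], fun v =>
      contDiff_fderiv_apply (hb.mul hu) v⟩
  | succ n ih =>
    refine ⟨hb.mul hu.1, fun x hx => by simp [hb0 x hx], fun v => ?_⟩
    rw [fderiv_mul_apply hb hu.1]
    exact (ih (hu.2.2 v)).add (hu.smooth_mul (contDiff_fderiv_apply hb v))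

/-- Differentiation along K costs no order: u is zero on whole lines in K, and the derivative along
K commutes with the other derivatives. -/
theorem VanishesToOrder.fderiv_apply_of_mem {n : ℕ} {u : E → ℝ} (hu : VanishesToOrder K n u)
    {v : E} (hv : v ∈ K) : VanishesToOrder K n fun x => fderiv ℝ u x v := by
  induction n generalizing u with
  | zero => exact contDiff_fderiv_apply hu v
  | succ n ih =>
    refine ⟨contDiff_fderiv_apply hu.1 v, fun x hx => ?_, fun w => ?_⟩
    · have h1 : HasDerivAt (fun t : ℝ => u (x + t • v)) (fderiv ℝ u x v) 0 := by
        have h2 : HasDerivAt (fun t : ℝ => x + t • v) v 0 := by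
          simpa using ((hasDerivAt_id (0 : ℝ)).smul_const v).const_add x
        have h3 : HasFDerivAt u (fderiv ℝ u x) (x + (0 : ℝ) • v) := by
          rw [zero_smul, add_zero]
          exact (hu.1.differentiable (by simp) x).hasFDerivAt
        exact h3.comp_hasDerivAt 0 h2
      have h4 : (fun t : ℝ => u (x + t • v)) = fun _ => 0 :=
        funext fun t => hu.2.1 _ (K.add_mem hx (K.smul_mem t hv))
      rw [h4] at h1
      exact h1.unique (hasDerivAt_const _ _)
    · have h1 : (fun x => fderiv ℝ (fun y => fderiv ℝ u y v) x w) =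
          fun x => fderiv ℝ (fun y => fderiv ℝ u y w) x v :=
        funext fun x => fderiv_fderiv_apply_comm hu.1 v w x
      rw [h1]
      exact ih (hu.2.2 w)

theorem VanishesToOrder.iteratedFDeriv_apply_eq_zero {n k : ℕ} {u : E → ℝ}
    (hu : VanishesToOrder K n u) (hk : k < n) {x : E} (hx : x ∈ K) (m : Fin k → E) :
    iteratedFDeriv ℝ k u x m = 0 := by
  induction k generalizing n u with
  | zero =>
    obtain ⟨n, rfl⟩ := Nat.exists_eq_succ_of_ne_zero hk.ne'
    exact hu.2.1 x hx
  | succ k ih =>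
    obtain ⟨n, rfl⟩ := Nat.exists_eq_succ_of_ne_zero (Nat.ne_zero_of_lt hk)
    rw [iteratedFDeriv_succ_apply_eq hu.contDiff]
    exact ih (hu.2.2 _) (Nat.lt_of_succ_lt_succ hk) _

end Vanishing

section Transport

variable {p q : ℕ}

/-- The derivation `∑ b_j(r) ∂/∂θ_j` on functions of `(θ, r)`. -/
def transportOp (b : EuclideanSpace ℝ (Fin q) → (Fin p → ℝ)) (u : AngleModel p q → ℝ) :
    AngleModel p q → ℝ := fun x => fderiv ℝ u x (b x.2, 0)

theorem transportOp_eq_sum (b : EuclideanSpace ℝ (Fin q) → (Fin p → ℝ)) (u : AngleModel p q → ℝ) :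
    transportOp b u = fun x => ∑ j, b x.2 j * fderiv ℝ u x (Pi.single j 1, 0) :=
  funext fun x => (sum_smul_apply_single (fderiv ℝ u x) (b x.2)).symm

/-- The θ-derivatives are tangent to {r = 0} and preserve the order; the coefficients b_j vanish
there and add one. This gain drives the induction in `germValue_add_smul`. -/
theorem VanishesToOrder.transportOp {b : EuclideanSpace ℝ (Fin q) → (Fin p → ℝ)}
    (hb : ContDiff ℝ ∞ b) (hb0 : b 0 = 0) {n : ℕ} {u : AngleModel p q → ℝ}
    (hu : VanishesToOrder (LinearMap.ker (LinearMap.snd ℝ (Fin p → ℝ) (EuclideanSpace ℝ (Fin q)))) n u) :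
    VanishesToOrder (LinearMap.ker (LinearMap.snd ℝ (Fin p → ℝ) (EuclideanSpace ℝ (Fin q)))) (n + 1)
      (transportOp b u) := by
  rw [transportOp_eq_sum]
  refine VanishesToOrder.sum _ fun j _ => VanishesToOrder.mul_of_forall_eq_zero ?_ ?_ ?_
  · exact ((contDiff_pi.1 hb) j).comp contDiff_snd
  · intro x hx
    have hx : x.2 = 0 := hx
    rw [hx, hb0]
    rfl
  · refine hu.fderiv_apply_of_mem ?_
    rfl

end Transport

/-! ### Functions, fields and operators on the cover of a Liouville chart. -/

namespace LiouvilleChart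

variable {p q : ℕ} {M : Type*} [TopologicalSpace M]
  [ChartedSpace (EuclideanSpace ℝ (Fin (p + q))) M] [IsManifold (𝓡 (p + q)) ∞ M]
  {X : Fin p → SmoothVF (p + q) M} {F : Fin q → SmoothFun (p + q) M} {N : Set M}

/-- The covering map `ℝ^p × B^q → M` of a Liouville chart. -/
def lift (L : LiouvilleChart X F N) : AngleModel p q → M := coverLift L.toOpenPartialHomeomorph

variable (L : LiouvilleChart X F N)

theorem torusProj_mem_target {z : AngleModel p q}
    (hz : z.2 ∈ ball (0 : EuclideanSpace ℝ (Fin q)) 1) :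
    torusProj z ∈ L.toOpenPartialHomeomorph.target := by
  rw [L.target_eq]
  exact ⟨mem_univ _, hz⟩

theorem apply_lift {z : AngleModel p q} (hz : z.2 ∈ ball (0 : EuclideanSpace ℝ (Fin q)) 1) :
    L.toOpenPartialHomeomorph (L.lift z) = torusProj z :=
  L.toOpenPartialHomeomorph.right_inv (L.torusProj_mem_target hz)

theorem lift_mem_source {z : AngleModel p q}
    (hz : z.2 ∈ ball (0 : EuclideanSpace ℝ (Fin q)) 1) : L.lift z ∈ L.source :=
  L.toOpenPartialHomeomorph.map_target (L.torusProj_mem_target hz)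

theorem lift_eq_of_torusProj_eq {z z' : AngleModel p q} (h : torusProj z = torusProj z') :
    L.lift z = L.lift z' :=
  congrArg L.toOpenPartialHomeomorph.symm h

theorem torusProj_eq_of_lift_eq {z z' : AngleModel p q}
    (hz : z.2 ∈ ball (0 : EuclideanSpace ℝ (Fin q)) 1)
    (hz' : z'.2 ∈ ball (0 : EuclideanSpace ℝ (Fin q)) 1) (h : L.lift z = L.lift z') :
    torusProj z = torusProj z' := by
  rw [← L.apply_lift hz, h, L.apply_lift hz']

theorem exists_lift_eq {x : M} (hx : x ∈ L.source) :
    ∃ z : AngleModel p q, z.2 ∈ ball (0 : EuclideanSpace ℝ (Fin q)) 1 ∧ L.lift z = x := by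
  obtain ⟨z, hz⟩ := torusProj_surjective (L.toOpenPartialHomeomorph x)
  have h1 : L.toOpenPartialHomeomorph x ∈ L.target := L.toOpenPartialHomeomorph.map_source hx
  rw [L.target_eq] at h1
  refine ⟨z, ?_, ?_⟩
  · have h2 : z.2 = (L.toOpenPartialHomeomorph x).2 := congrArg Prod.snd hz
    rw [h2]
    exact h1.2
  · change L.toOpenPartialHomeomorph.symm (torusProj z) = x
    rw [hz]
    exact L.toOpenPartialHomeomorph.left_inv hx

theorem act_lift {z : AngleModel p q} (hz : z.2 ∈ ball (0 : EuclideanSpace ℝ (Fin q)) 1)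
    (σ : Fin p → ℝ) : L.act (fun i => (σ i : UnitAddCircle)) (L.lift z) = L.lift (z + (σ, 0)) := by
  change L.toOpenPartialHomeomorph.symm _ = L.toOpenPartialHomeomorph.symm _
  rw [L.apply_lift hz]
  congr 1
  refine Prod.ext ?_ ?_
  · funext i
    change (σ i : UnitAddCircle) + (z.1 i : UnitAddCircle) = ((z.1 i + σ i : ℝ) : UnitAddCircle)
    rw [AddCircle.coe_add, add_comm]
  · change z.2 = z.2 + 0
    rw [add_zero]

theorem exists_isSmoothParam {z : AngleModel p q}
    (hz : z.2 ∈ ball (0 : EuclideanSpace ℝ (Fin q)) 1) :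
    ∃ χ : OpenPartialHomeomorph (AngleModel p q) M,
      IsSmoothParam (E := EuclideanSpace ℝ (Fin (p + q))) χ ∧ z ∈ χ.source ∧
      ∀ w ∈ χ.source, w.2 ∈ ball (0 : EuclideanSpace ℝ (Fin q)) 1 ∧ χ w = L.lift w := by
  obtain ⟨Φ, hzΦ, hΦ⟩ := L.isLocalDiffeomorphOn_lift ⟨z, mem_univ _, hz⟩
  have hχ : IsSmoothParam (E := EuclideanSpace ℝ (Fin (p + q))) Φ.toOpenPartialHomeomorph :=
    ⟨Φ.contMDiffOn_toFun, Φ.contMDiffOn_invFun⟩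
  have ho : IsOpen {w : AngleModel p q | w.2 ∈ ball (0 : EuclideanSpace ℝ (Fin q)) 1} :=
    isOpen_ball.preimage continuous_snd
  exact ⟨Φ.toOpenPartialHomeomorph.restrOpen _ ho, hχ.restrOpen ho, ⟨hzΦ, hz⟩,
    fun w hw => ⟨hw.2, (hΦ hw.1).symm⟩⟩

theorem contMDiffAt_lift {z : AngleModel p q}
    (hz : z.2 ∈ ball (0 : EuclideanSpace ℝ (Fin q)) 1) :
    ContMDiffAt 𝓘(ℝ, AngleModel p q) (𝓡 (p + q)) ∞ L.lift z := by
  obtain ⟨χ, hχ, hzχ, h⟩ := L.exists_isSmoothParam hz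
  refine (hχ.contMDiffOn.contMDiffAt (χ.open_source.mem_nhds hzχ)).congr_of_eventuallyEq ?_
  filter_upwards [χ.open_source.mem_nhds hzχ] with w hw using (h w hw).2.symm

theorem contDiffAt_comp_lift (f : SmoothFun (p + q) M) {z : AngleModel p q}
    (hz : z.2 ∈ ball (0 : EuclideanSpace ℝ (Fin q)) 1) :
    ContDiffAt ℝ ∞ (fun w => f (L.lift w)) z :=
  contMDiffAt_iff_contDiffAt.1 (f.contMDiff.contMDiffAt.comp z (L.contMDiffAt_lift hz))

/-- The action of the vector fields of the system in a Liouville chart. -/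
theorem exists_applyVF_lift : ∃ a : Fin p → EuclideanSpace ℝ (Fin q) → (Fin p → ℝ),
    ∀ i, ∀ z : AngleModel p q, z.2 ∈ ball (0 : EuclideanSpace ℝ (Fin q)) 1 →
      mfderiv 𝓘(ℝ, AngleModel p q) (𝓡 (p + q)) L.lift z (a i z.2, 0) = X i (L.lift z) ∧
      ∀ f : SmoothFun (p + q) M,
      applyVF (X i) f (L.lift z) = fderiv ℝ (fun w => f (L.lift w)) z (a i z.2, 0) := by
  obtain ⟨a, ha⟩ := L.vectorField_eq
  refine ⟨fun i r j => a i j r, fun i z hz => ?_⟩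
  let D : AngleModel p q →L[ℝ] EuclideanSpace ℝ (Fin (p + q)) :=
    mfderiv 𝓘(ℝ, AngleModel p q) (𝓡 (p + q)) L.lift z
  have h1 : X i (L.lift z) = D (fun j => a i j z.2, 0) :=
    (ha i z.1 z.2 hz).trans (sum_smul_apply_single D fun j => a i j z.2)
  refine ⟨h1.symm, fun f => ?_⟩
  have h2 := ((f.contMDiff.mdifferentiable (by simp) (L.lift z)).hasMFDerivAt.comp z
    ((L.contMDiffAt_lift hz).mdifferentiableAt (by simp)).hasMFDerivAt).mfderiv
  rw [mfderiv_eq_fderiv] at h2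
  have h3 := congrArg (fun B : AngleModel p q →L[ℝ] ℝ => B (fun j => a i j z.2, 0)) h2
  refine Eq.trans ?_ h3.symm
  exact congrArg (differential f (L.lift z)) h1

/-- In a Liouville chart, a differential operator has smooth coefficients. -/
theorem exists_local_formula {Λ : SmoothFun (p + q) M →ₗ[ℝ] SmoothFun (p + q) M} {m : ℕ}
    (hΛ : HasOrderLE Λ m) {z₀ : AngleModel p q}
    (hz₀ : z₀.2 ∈ ball (0 : EuclideanSpace ℝ (Fin q)) 1) :
    ∃ (O : Set (AngleModel p q)) (C : (k : ℕ) → (Fin k → Fin (p + q)) → AngleModel p q → ℝ)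
      (e : Fin (p + q) → AngleModel p q), IsOpen O ∧ z₀ ∈ O ∧
      (∀ z ∈ O, z.2 ∈ ball (0 : EuclideanSpace ℝ (Fin q)) 1) ∧
      (∀ k J, ContDiffOn ℝ ∞ (C k J) O) ∧
      ∀ f : SmoothFun (p + q) M, ∀ z ∈ O, Λ f (L.lift z) =
        ∑ k ∈ Finset.range (m + 1), ∑ J : Fin k → Fin (p + q),
          C k J z * iteratedFDeriv ℝ k (fun w => f (L.lift w)) z fun i => e (J i) := by
  obtain ⟨χ, hχ, hzχ, hl⟩ := L.exists_isSmoothParam hz₀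
  -- Charts of `M` take values in ℝ^{p+q}. A linear identification with ℝ^p × ℝ^q turns a local
  -- inverse of the lift into a member of the maximal atlas, where the coefficients of `Λ` are
  -- available.
  let ι : EuclideanSpace ℝ (Fin (p + q)) ≃L[ℝ] AngleModel p q :=
    ContinuousLinearEquiv.ofFinrankEq finrank_angleModel
  let s : OpenPartialHomeomorph (EuclideanSpace ℝ (Fin (p + q))) (AngleModel p q) :=
    ι.toHomeomorph.toOpenPartialHomeomorph
  have hp : IsSmoothParam (E := EuclideanSpace ℝ (Fin (p + q))) (s.trans χ) :=
    hχ.comp ι.contDiff.contDiffOn ι.symm.contDiff.contDiffOn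
  have hat : (s.trans χ).symm ∈ IsManifold.maximalAtlas (𝓡 (p + q)) ∞ M :=
    (s.trans χ).symm.mem_maximalAtlas_of_contMDiffOn hp.contMDiffOn_symm hp.contMDiffOn
  obtain ⟨c, hc, hcΛ⟩ := hΛ _ hat
  have hmem : ∀ z ∈ χ.source, ι.symm z ∈ (s.trans χ).symm.target := by
    intro z hz
    refine ⟨mem_univ _, ?_⟩
    change ι (ι.symm z) ∈ χ.source
    rw [ι.apply_symm_apply]
    exact hz
  refine ⟨χ.source, fun k J z => c k J (ι.symm z), fun i => ι (EuclideanSpace.single i 1),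
    χ.open_source, hzχ, fun z hz => (hl z hz).1,
    fun k J => (hc k J).comp ι.symm.contDiff.contDiffOn hmem, fun f z hz => ?_⟩
  have h1 := hcΛ f _ (hmem z hz)
  have h2 : (s.trans χ).symm.symm (ι.symm z) = L.lift z := by
    change χ (ι (ι.symm z)) = _
    rw [ι.apply_symm_apply]
    exact (hl z hz).2
  rw [h2] at h1
  rw [h1]
  refine Finset.sum_congr rfl fun k _ => Finset.sum_congr rfl fun J _ => ?_
  congr 1
  have h3 : (fun w => f ((s.trans χ).symm.symm w)) = (fun w => f (χ w)) ∘ ι := rfl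
  have h4 := ι.iteratedFDerivWithin_comp_right (fun w => f (χ w)) uniqueDiffOn_univ
    (x := ι.symm z) (mem_univ _) k
  rw [preimage_univ, iteratedFDerivWithin_univ, iteratedFDerivWithin_univ] at h4
  rw [h3, h4, ι.apply_symm_apply]
  have h5 : (fun w => f (χ w)) =ᶠ[𝓝 z] fun w => f (L.lift w) := by
    filter_upwards [χ.open_source.mem_nhds hz] with w hw
    rw [(hl w hw).2]
  rw [(h5.iteratedFDeriv ℝ k).self_of_nhds]
  rfl

variable [T2Space M]

theorem exists_smoothFun_comp_lift {h : AngleModel p q → ℝ} (hh : ContDiff ℝ ∞ h)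
    {z : AngleModel p q} (hz : z.2 ∈ ball (0 : EuclideanSpace ℝ (Fin q)) 1) :
    ∃ f : SmoothFun (p + q) M, (fun w => f (L.lift w)) =ᶠ[𝓝 z] h := by
  obtain ⟨χ, hχ, hzχ, hl⟩ := L.exists_isSmoothParam hz
  obtain ⟨v, hv, hvu⟩ := exists_contMDiff_eventuallyEq (u := h ∘ χ.symm) χ.open_target
    ((contMDiff_iff_contDiff.2 hh).comp_contMDiffOn hχ.contMDiffOn_symm) (χ.map_source hzχ)
  refine ⟨⟨v, hv⟩, ?_⟩
  filter_upwards [(χ.continuousAt hzχ).eventually hvu, χ.open_source.mem_nhds hzχ] with w hw hwχ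
  change v (L.lift w) = h w
  rw [← (hl w hwχ).2, hw, Function.comp, χ.left_inv hwχ]

end LiouvilleChart

/-! ### The operator on translated test germs. -/

namespace LiouvilleChart

variable {p q : ℕ} {M : Type*} [TopologicalSpace M]
  [ChartedSpace (EuclideanSpace ℝ (Fin (p + q))) M] [IsManifold (𝓡 (p + q)) ∞ M]
  {X : Fin p → SmoothVF (p + q) M} {F : Fin q → SmoothFun (p + q) M} {N : Set M}
  (L : LiouvilleChart X F N) {Λ : SmoothFun (p + q) M →ₗ[ℝ] SmoothFun (p + q) M} {m : ℕ}

open Classical in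
/-- The value at `lift z` of `Λ` on any function whose lift has the germ of `h (· - z)` at `z`. -/
def germValue (Λ : SmoothFun (p + q) M →ₗ[ℝ] SmoothFun (p + q) M) (h : AngleModel p q → ℝ)
    (z : AngleModel p q) : ℝ :=
  -- The chosen f is immaterial by `apply_eq_germValue`. For smooth h and z over the ball one exists
  -- by `exists_smoothFun_comp_lift`, so the default value 0 does not occur.
  if H : ∃ f : SmoothFun (p + q) M, (fun w => f (L.lift w)) =ᶠ[𝓝 z] fun w => h (w - z) then
    Λ H.choose (L.lift z) else 0

theorem apply_eq_of_eventuallyEq (hΛ : HasOrderLE Λ m) {z : AngleModel p q}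
    (hz : z.2 ∈ ball (0 : EuclideanSpace ℝ (Fin q)) 1) {f g : SmoothFun (p + q) M}
    (hfg : (fun w => f (L.lift w)) =ᶠ[𝓝 z] fun w => g (L.lift w)) :
    Λ f (L.lift z) = Λ g (L.lift z) := by
  obtain ⟨O, C, e, -, hzO, -, -, hform⟩ := L.exists_local_formula hΛ hz
  rw [hform f z hzO, hform g z hzO]
  refine Finset.sum_congr rfl fun k _ => Finset.sum_congr rfl fun J _ => ?_
  rw [(hfg.iteratedFDeriv ℝ k).self_of_nhds]

theorem apply_eq_germValue (hΛ : HasOrderLE Λ m) {z : AngleModel p q}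
    (hz : z.2 ∈ ball (0 : EuclideanSpace ℝ (Fin q)) 1) {f : SmoothFun (p + q) M}
    {h : AngleModel p q → ℝ} (hf : (fun w => f (L.lift w)) =ᶠ[𝓝 z] fun w => h (w - z)) :
    Λ f (L.lift z) = L.germValue Λ h z := by
  have H : ∃ f : SmoothFun (p + q) M, (fun w => f (L.lift w)) =ᶠ[𝓝 z] fun w => h (w - z) :=
    ⟨f, hf⟩
  rw [germValue, dif_pos H]
  exact L.apply_eq_of_eventuallyEq hΛ hz (hf.trans H.choose_spec.symm)

/-- Lifted functions are ℤ^p-periodic, so a function with the required germ at z has it at every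
integral translate of z. -/
theorem germValue_periodic (hΛ : HasOrderLE Λ m) {h : AngleModel p q → ℝ} {z z' : AngleModel p q}
    (hz : z.2 ∈ ball (0 : EuclideanSpace ℝ (Fin q)) 1) (hzz' : torusProj z = torusProj z') :
    L.germValue Λ h z = L.germValue Λ h z' := by
  have key : ∀ z z' : AngleModel p q, torusProj z = torusProj z' →
      ∀ f : SmoothFun (p + q) M, (fun w => f (L.lift w)) =ᶠ[𝓝 z] (fun w => h (w - z)) →
      (fun w => f (L.lift w)) =ᶠ[𝓝 z'] (fun w => h (w - z')) := by
    intro z z' hzz' f hf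
    have h1 : Tendsto (fun w : AngleModel p q => w - z' + z) (𝓝 z') (𝓝 z) :=
      Continuous.tendsto' (by fun_prop) _ _ (by simp)
    filter_upwards [h1.eventually hf] with w hw
    rw [add_sub_cancel_right] at hw
    rw [← hw]
    refine congrArg f (L.lift_eq_of_torusProj_eq ?_)
    have h2 : z.2 = z'.2 := (Prod.ext_iff.1 hzz').2
    refine Prod.ext ?_ ?_
    · funext i
      have h3 : (z.1 i : UnitAddCircle) = z'.1 i := congrFun (Prod.ext_iff.1 hzz').1 i
      change (w.1 i : UnitAddCircle) = ((w.1 i - z'.1 i + z.1 i : ℝ) : UnitAddCircle)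
      rw [AddCircle.coe_add, AddCircle.coe_sub, h3, sub_add_cancel]
    · change w.2 = w.2 - z'.2 + z.2
      rw [h2, sub_add_cancel]
  by_cases H : ∃ f : SmoothFun (p + q) M, (fun w => f (L.lift w)) =ᶠ[𝓝 z] fun w => h (w - z)
  · obtain ⟨f, hf⟩ := H
    have hz' : z'.2 ∈ ball (0 : EuclideanSpace ℝ (Fin q)) 1 := by
      rw [← show z.2 = z'.2 from (Prod.ext_iff.1 hzz').2]
      exact hz
    rw [← L.apply_eq_germValue hΛ hz hf, ← L.apply_eq_germValue hΛ hz' (key z z' hzz' f hf),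
      L.lift_eq_of_torusProj_eq hzz']
  · have H' : ¬ ∃ f : SmoothFun (p + q) M, (fun w => f (L.lift w)) =ᶠ[𝓝 z'] fun w => h (w - z') :=
      fun ⟨f, hf⟩ => H ⟨f, key z' z hzz'.symm f hf⟩
    rw [germValue, germValue, dif_neg H, dif_neg H']

variable [T2Space M]

/-- Moving h along with z freezes its jet at 0, so the dependence on z lies in the coefficients of
`Λ` alone. -/
theorem exists_germValue_formula (hΛ : HasOrderLE Λ m) {z₀ : AngleModel p q}
    (hz₀ : z₀.2 ∈ ball (0 : EuclideanSpace ℝ (Fin q)) 1) :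
    ∃ (O : Set (AngleModel p q)) (C : (k : ℕ) → (Fin k → Fin (p + q)) → AngleModel p q → ℝ)
      (e : Fin (p + q) → AngleModel p q), IsOpen O ∧ z₀ ∈ O ∧
      (∀ z ∈ O, z.2 ∈ ball (0 : EuclideanSpace ℝ (Fin q)) 1) ∧
      (∀ k J, ContDiffOn ℝ ∞ (C k J) O) ∧
      (∀ f : SmoothFun (p + q) M, ∀ z ∈ O, Λ f (L.lift z) =
        ∑ k ∈ Finset.range (m + 1), ∑ J : Fin k → Fin (p + q),
          C k J z * iteratedFDeriv ℝ k (fun w => f (L.lift w)) z fun i => e (J i)) ∧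
      ∀ h, ContDiff ℝ ∞ h → ∀ z ∈ O, L.germValue Λ h z =
        ∑ k ∈ Finset.range (m + 1), ∑ J : Fin k → Fin (p + q),
          C k J z * iteratedFDeriv ℝ k h 0 fun i => e (J i) := by
  obtain ⟨O, C, e, hO, hzO, hOB, hC, hform⟩ := L.exists_local_formula hΛ hz₀
  refine ⟨O, C, e, hO, hzO, hOB, hC, hform, fun h hh z hz => ?_⟩
  obtain ⟨f, hf⟩ := L.exists_smoothFun_comp_lift (h := fun w => h (w - z)) (by fun_prop) (hOB z hz)
  rw [← L.apply_eq_germValue hΛ (hOB z hz) hf, hform f z hz]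
  refine Finset.sum_congr rfl fun k _ => Finset.sum_congr rfl fun J _ => ?_
  rw [(hf.iteratedFDeriv ℝ k).self_of_nhds, iteratedFDeriv_comp_sub, sub_self]

theorem contDiffAt_germValue (hΛ : HasOrderLE Λ m) {h : AngleModel p q → ℝ} (hh : ContDiff ℝ ∞ h)
    {z : AngleModel p q} (hz : z.2 ∈ ball (0 : EuclideanSpace ℝ (Fin q)) 1) :
    ContDiffAt ℝ ∞ (L.germValue Λ h) z := by
  obtain ⟨O, C, e, hO, hzO, -, hC, -, hform⟩ := L.exists_germValue_formula hΛ hz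
  have h1 : ContDiffAt ℝ ∞ (fun z => ∑ k ∈ Finset.range (m + 1), ∑ J : Fin k → Fin (p + q),
      C k J z * iteratedFDeriv ℝ k h 0 fun i => e (J i)) z :=
    ContDiffAt.sum fun k _ => ContDiffAt.sum fun J _ =>
      ((hC k J).contDiffAt (hO.mem_nhds hzO)).mul contDiffAt_const
  refine h1.congr_of_eventuallyEq ?_
  filter_upwards [hO.mem_nhds hzO] with w hw using hform h hh w hw

theorem germValue_add (hΛ : HasOrderLE Λ m) {h h' : AngleModel p q → ℝ} (hh : ContDiff ℝ ∞ h)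
    (hh' : ContDiff ℝ ∞ h') {z : AngleModel p q}
    (hz : z.2 ∈ ball (0 : EuclideanSpace ℝ (Fin q)) 1) :
    L.germValue Λ (fun w => h w + h' w) z = L.germValue Λ h z + L.germValue Λ h' z := by
  obtain ⟨O, C, e, hO, hzO, -, hC, -, hform⟩ := L.exists_germValue_formula hΛ hz
  rw [hform _ (hh.add hh') z hzO, hform _ hh z hzO, hform _ hh' z hzO, ← Finset.sum_add_distrib]
  refine Finset.sum_congr rfl fun k _ => ?_
  rw [← Finset.sum_add_distrib]
  refine Finset.sum_congr rfl fun J _ => ?_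
  change C k J z * iteratedFDeriv ℝ k (h + h') 0 _ = _
  rw [← mul_add, iteratedFDeriv_add_apply (hh.contDiffAt.of_le (by exact_mod_cast le_top))
    (hh'.contDiffAt.of_le (by exact_mod_cast le_top))]
  rfl

/-- Only derivatives of h at 0 of order at most m enter, and 0 lies in the subspace. The finite
order of `Λ` is what starts the induction. -/
theorem germValue_eq_zero (hΛ : HasOrderLE Λ m) {h : AngleModel p q → ℝ}
    (hh : VanishesToOrder (LinearMap.ker (LinearMap.snd ℝ (Fin p → ℝ) (EuclideanSpace ℝ (Fin q))))
      (m + 1) h) {z : AngleModel p q} (hz : z.2 ∈ ball (0 : EuclideanSpace ℝ (Fin q)) 1) :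
    L.germValue Λ h z = 0 := by
  obtain ⟨O, C, e, hO, hzO, -, hC, -, hform⟩ := L.exists_germValue_formula hΛ hz
  rw [hform _ hh.contDiff z hzO]
  refine Finset.sum_eq_zero fun k hk => Finset.sum_eq_zero fun J _ => ?_
  rw [hh.iteratedFDeriv_apply_eq_zero (Finset.mem_range.1 hk) (Submodule.zero_mem _), mul_zero]

/-- The derivative of the lift of `Λ f` splits into the derivative of the coefficients and the
derivative of `f`. -/
theorem fderiv_apply_lift (hΛ : HasOrderLE Λ m) {h : AngleModel p q → ℝ} (hh : ContDiff ℝ ∞ h)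
    {z : AngleModel p q} (hz : z.2 ∈ ball (0 : EuclideanSpace ℝ (Fin q)) 1)
    {f : SmoothFun (p + q) M} (hf : (fun w => f (L.lift w)) =ᶠ[𝓝 z] fun w => h (w - z))
    (v : AngleModel p q) :
    fderiv ℝ (fun w => Λ f (L.lift w)) z v =
      fderiv ℝ (L.germValue Λ h) z v + L.germValue Λ (fun w => fderiv ℝ h w v) z := by
  obtain ⟨O, C, e, hO, hzO, -, hC, hform', hform⟩ := L.exists_germValue_formula hΛ hz
  have hCz : ∀ k J, HasFDerivAt (C k J) (fderiv ℝ (C k J) z) z := fun k J =>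
    (((hC k J).contDiffAt (hO.mem_nhds hzO)).differentiableAt (by simp)).hasFDerivAt
  -- Here f is fixed while the point w varies, so the jet of h is taken at w - z; in `germValue` it
  -- stays at 0. The difference is the second summand of the conclusion.
  have h1 : (fun w => Λ f (L.lift w)) =ᶠ[𝓝 z] fun w =>
      ∑ k ∈ Finset.range (m + 1), ∑ J : Fin k → Fin (p + q),
        C k J w * iteratedFDeriv ℝ k h (w - z) fun i => e (J i) := by
    filter_upwards [hO.mem_nhds hzO, hf.eventuallyEq_nhds] with w hw hfw
    rw [hform' f w hw]
    refine Finset.sum_congr rfl fun k _ => Finset.sum_congr rfl fun J _ => ?_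
    rw [(hfw.iteratedFDeriv ℝ k).self_of_nhds, iteratedFDeriv_comp_sub]
  have h2 : L.germValue Λ h =ᶠ[𝓝 z] fun w =>
      ∑ k ∈ Finset.range (m + 1), ∑ J : Fin k → Fin (p + q),
        C k J w * iteratedFDeriv ℝ k h 0 fun i => e (J i) := by
    filter_upwards [hO.mem_nhds hzO] with w hw using hform h hh w hw
  have hD : ∀ k (J : Fin k → Fin (p + q)),
      HasFDerivAt (fun w => iteratedFDeriv ℝ k h (w - z) fun i => e (J i))
        (fderiv ℝ (fun w => iteratedFDeriv ℝ k h w fun i => e (J i)) 0) z := by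
    intro k J
    have h3 := (differentiable_iteratedFDeriv_apply hh (fun i => e (J i)) (z - z)).hasFDerivAt
    have h4 := HasFDerivAt.comp (f := fun w => w - z) z h3 ((hasFDerivAt_id z).sub_const z)
    rw [sub_self] at h4
    exact h4
  have h5 : HasFDerivAt (fun w => ∑ k ∈ Finset.range (m + 1), ∑ J : Fin k → Fin (p + q),
        C k J w * iteratedFDeriv ℝ k h (w - z) fun i => e (J i)) _ z :=
    HasFDerivAt.fun_sum fun k _ => HasFDerivAt.fun_sum fun J _ => (hCz k J).mul (hD k J)
  have h6 : HasFDerivAt (fun w => ∑ k ∈ Finset.range (m + 1), ∑ J : Fin k → Fin (p + q),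
        C k J w * iteratedFDeriv ℝ k h 0 fun i => e (J i)) _ z :=
    HasFDerivAt.fun_sum fun k _ => HasFDerivAt.fun_sum fun J _ => (hCz k J).mul_const _
  rw [h1.fderiv_eq, h2.fderiv_eq, h5.fderiv, h6.fderiv,
    hform _ (contDiff_fderiv_apply hh v) z hzO]
  simp only [_root_.sum_apply, _root_.add_apply, _root_.smul_apply, sub_self, smul_eq_mul,
    fderiv_iteratedFDeriv_apply hh, Finset.sum_add_distrib]
  rw [add_comm]

end LiouvilleChart

/-- A function with constant derivative is affine, and a bounded affine function on the line has
slope zero. -/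
theorem deriv_eq_zero_of_bounded_affine {g : ℝ → ℝ} {C K : ℝ} (hg : ∀ t, HasDerivAt g C t)
    (hK : ∀ t, |g t| ≤ K) : C = 0 := by
  have h1 : ∀ t, g t = g 0 + t * C := by
    intro t
    have h2 : ∀ s, HasDerivAt (fun s => g s - s * C) 0 s := fun s => by
      have := (hg s).fun_sub ((hasDerivAt_id s).mul_const C)
      rwa [one_mul, sub_self] at this
    have h3 := is_const_of_deriv_eq_zero (fun s => (h2 s).differentiableAt) (fun s => (h2 s).deriv) t 0
    simp only [zero_mul, sub_zero] at h3
    linarith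
  by_contra hC
  have h2 := hK ((2 * K + 1) / C)
  rw [h1, div_mul_cancel₀ _ hC] at h2
  have h3 := hK 0
  rw [abs_le] at h2 h3
  linarith [h2.2, h3.1]

/-! ### Constancy along an invariant vector field. -/

namespace LiouvilleChart

variable {p q : ℕ} {M : Type*} [TopologicalSpace M] [T2Space M]
  [ChartedSpace (EuclideanSpace ℝ (Fin (p + q))) M] [IsManifold (𝓡 (p + q)) ∞ M]
  {X : Fin p → SmoothVF (p + q) M} {F : Fin q → SmoothFun (p + q) M} {N : Set M}
  (L : LiouvilleChart X F N) {Λ : SmoothFun (p + q) M →ₗ[ℝ] SmoothFun (p + q) M} {m : ℕ}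
  {Z : SmoothVF (p + q) M} {a : EuclideanSpace ℝ (Fin q) → (Fin p → ℝ)}

/-- A Liouville chart does not postulate smooth coefficients; a_j is recovered locally as Z applied
to a function whose lift is θ_j. -/
theorem contDiffOn_coefficients (ha : ∀ z : AngleModel p q,
      z.2 ∈ ball (0 : EuclideanSpace ℝ (Fin q)) 1 → ∀ f : SmoothFun (p + q) M,
      applyVF Z f (L.lift z) = fderiv ℝ (fun w => f (L.lift w)) z (a z.2, 0)) :
    ContDiffOn ℝ ∞ a (ball 0 1) := by
  refine contDiffOn_pi.2 fun j r hr => ContDiffAt.contDiffWithinAt ?_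
  let π : AngleModel p q →L[ℝ] ℝ :=
    (ContinuousLinearMap.proj j).comp (ContinuousLinearMap.fst ℝ (Fin p → ℝ) (EuclideanSpace ℝ (Fin q)))
  obtain ⟨f, hf⟩ := L.exists_smoothFun_comp_lift (z := (0, r)) π.contDiff hr
  have hcont : Tendsto (fun r' : EuclideanSpace ℝ (Fin q) => ((0, r') : AngleModel p q)) (𝓝 r)
      (𝓝 (0, r)) := (Continuous.prodMk_right 0).tendsto r
  have h1 : (fun r' => a r' j) =ᶠ[𝓝 r] fun r' => applyVF Z f (L.lift (0, r')) := by
    filter_upwards [hcont.eventually hf.eventuallyEq_nhds, isOpen_ball.mem_nhds hr] with r' h hr'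
    rw [ha (0, r') hr' f, h.fderiv_eq, ContinuousLinearMap.fderiv]
    rfl
  refine ContDiffAt.congr_of_eventuallyEq ?_ h1
  exact (L.contDiffAt_comp_lift (applyVF Z f) (z := (0, r)) hr).comp r (contDiff_prodMk_right 0).contDiffAt

/-- Evaluate Z(Λf) = Λ(Zf) at z, with f the translate of h. The left side differentiates both
coefficients and h. On the right, the coefficient of Z is its value a(z.2) at z plus the variation
b. The terms with a(z.2) acting on h cancel. -/
theorem fderiv_germValue_apply (hΛ : HasOrderLE Λ m) (hZ : InvariantUnderVF Λ Z)
    (ha : ∀ z : AngleModel p q,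
      z.2 ∈ ball (0 : EuclideanSpace ℝ (Fin q)) 1 → ∀ f : SmoothFun (p + q) M,
      applyVF Z f (L.lift z) = fderiv ℝ (fun w => f (L.lift w)) z (a z.2, 0))
    {z : AngleModel p q} (hz : z.2 ∈ ball (0 : EuclideanSpace ℝ (Fin q)) 1)
    {b : EuclideanSpace ℝ (Fin q) → (Fin p → ℝ)} (hb : ContDiff ℝ ∞ b)
    (hba : b =ᶠ[𝓝 0] fun r => a (z.2 + r) - a z.2)
    {h : AngleModel p q → ℝ} (hh : ContDiff ℝ ∞ h) :
    fderiv ℝ (L.germValue Λ h) z (a z.2, 0) = L.germValue Λ (transportOp b h) z := by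
  obtain ⟨f, hf⟩ := L.exists_smoothFun_comp_lift (h := fun w => h (w - z)) (by fun_prop) hz
  have hT : ContDiff ℝ ∞ (transportOp b h) := by
    rw [transportOp_eq_sum]
    refine ContDiff.sum fun j _ => ContDiff.mul ?_ (contDiff_fderiv_apply hh _)
    exact ((contDiff_pi.1 hb) j).comp contDiff_snd
  have h1 : applyVF Z (Λ f) (L.lift z) = Λ (applyVF Z f) (L.lift z) := by
    have := congrArg (fun g : SmoothFun (p + q) M => g (L.lift z)) (hZ f)
    exact sub_eq_zero.1 this
  have h2 : (fun w => applyVF Z f (L.lift w)) =ᶠ[𝓝 z]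
      fun w => (fun u => fderiv ℝ h u (a z.2, 0) + transportOp b h u) (w - z) := by
    have hc : Tendsto (fun w : AngleModel p q => (w - z).2) (𝓝 z) (𝓝 0) :=
      Continuous.tendsto' (by fun_prop) _ _ (by simp)
    filter_upwards [hf.eventuallyEq_nhds, hc.eventually hba,
      (isOpen_ball.preimage continuous_snd).mem_nhds hz] with w hw hbw hwB
    have h3 : a w.2 = a z.2 + b (w - z).2 := by
      rw [hbw, Prod.snd_sub, add_sub_cancel, add_sub_cancel]
    have h4 : fderiv ℝ (fun w => h (w - z)) w = fderiv ℝ h (w - z) := fderiv_comp_sub z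
    have h5 : ((a w.2, 0) : AngleModel p q) = (a z.2, 0) + (b (w - z).2, 0) := by
      rw [h3, Prod.mk_add_mk, add_zero]
    rw [ha w hwB f, hw.fderiv_eq, h4, h5, map_add]
    rfl
  have h6 := L.apply_eq_germValue hΛ hz (f := applyVF Z f)
    (h := fun u => fderiv ℝ h u (a z.2, 0) + transportOp b h u) h2
  rw [L.germValue_add hΛ (contDiff_fderiv_apply hh _) hT hz, ← h1, ha z hz,
    L.fderiv_apply_lift hΛ hh hz hf, add_comm] at h6
  exact add_left_cancel h6

theorem exists_forall_abs_germValue_le (hΛ : HasOrderLE Λ m) {h : AngleModel p q → ℝ}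
    (hh : ContDiff ℝ ∞ h) {r : EuclideanSpace ℝ (Fin q)} (hr : r ∈ ball 0 1) :
    ∃ K, ∀ θ, |L.germValue Λ h (θ, r)| ≤ K := by
  have hc : Continuous fun θ => L.germValue Λ h (θ, r) := by
    rw [continuous_iff_continuousAt]
    intro θ
    exact ContinuousAt.comp (f := fun θ : Fin p → ℝ => ((θ, r) : AngleModel p q))
      (L.contDiffAt_germValue hΛ hh (z := (θ, r)) hr).continuousAt (by fun_prop)
  obtain ⟨K, hK⟩ := (isCompact_Icc (a := (0 : Fin p → ℝ)) (b := 1)).exists_bound_of_continuousOn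
    hc.continuousOn
  refine ⟨K, fun θ => ?_⟩
  have h1 : torusProj (θ, r) = torusProj ((fun i => Int.fract (θ i)), r) := by
    refine Prod.ext (funext fun i => ?_) rfl
    refine unitAddCircle_coe_eq_coe_iff.2 ⟨⌊θ i⌋, ?_⟩
    exact Int.self_sub_fract _
  rw [L.germValue_periodic hΛ (z := (θ, r)) hr h1]
  exact hK _ ⟨fun i => Int.fract_nonneg _, fun i => (Int.fract_lt_one _).le⟩

/-- The transported values are constant along an invariant vector field. -/
theorem germValue_add_smul (hΛ : HasOrderLE Λ m) (hZ : InvariantUnderVF Λ Z)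
    (ha : ∀ z : AngleModel p q,
      z.2 ∈ ball (0 : EuclideanSpace ℝ (Fin q)) 1 → ∀ f : SmoothFun (p + q) M,
      applyVF Z f (L.lift z) = fderiv ℝ (fun w => f (L.lift w)) z (a z.2, 0))
    {r : EuclideanSpace ℝ (Fin q)} (hr : r ∈ ball 0 1) {h : AngleModel p q → ℝ}
    (hh : ContDiff ℝ ∞ h) (θ : Fin p → ℝ) (t : ℝ) :
    L.germValue Λ h (θ + t • a r, r) = L.germValue Λ h (θ, r) := by
  have has := L.contDiffOn_coefficients ha
  obtain ⟨b, hb, hba⟩ : ∃ b : EuclideanSpace ℝ (Fin q) → (Fin p → ℝ), ContDiff ℝ ∞ b ∧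
      b =ᶠ[𝓝 0] fun y => a (r + y) - a r := by
    have ho : IsOpen ((fun y => r + y) ⁻¹' ball (0 : EuclideanSpace ℝ (Fin q)) 1) :=
      isOpen_ball.preimage (by fun_prop)
    have h1 : ContDiffOn ℝ ∞ (fun y => a (r + y) - a r) ((fun y => r + y) ⁻¹' ball 0 1) :=
      (ContDiffOn.comp (f := fun y => r + y) has (by fun_prop) fun y hy => hy).sub contDiffOn_const
    obtain ⟨b, hb, hba⟩ := exists_contMDiff_eventuallyEq (x := (0 : EuclideanSpace ℝ (Fin q))) ho
      h1.contMDiffOn (by simpa using hr)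
    exact ⟨b, hb.contDiff, hba⟩
  have hb0 : b 0 = 0 := by rw [hba.self_of_nhds]; simp
  -- Induction from high to low order of vanishing: at n = 0 both values are zero, and at n = m + 1
  -- no vanishing is required.
  have key : ∀ n, ∀ h : AngleModel p q → ℝ, VanishesToOrder
      (LinearMap.ker (LinearMap.snd ℝ (Fin p → ℝ) (EuclideanSpace ℝ (Fin q)))) (m + 1 - n) h →
      ∀ (θ : Fin p → ℝ) (t : ℝ), L.germValue Λ h (θ + t • a r, r) = L.germValue Λ h (θ, r) := by
    intro n
    induction n with
    | zero =>
      intro h hh θ t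
      rw [L.germValue_eq_zero hΛ hh (z := (θ, r)) hr,
        L.germValue_eq_zero hΛ hh (z := (θ + t • a r, r)) hr]
    | succ n ih =>
      intro h hh θ t
      have hT : VanishesToOrder
          (LinearMap.ker (LinearMap.snd ℝ (Fin p → ℝ) (EuclideanSpace ℝ (Fin q)))) (m + 1 - n)
          (transportOp b h) := by
        have h1 := hh.transportOp hb hb0
        -- The subtraction is truncated: once n exceeds m the required order is 0, and smoothness
        -- suffices.
        by_cases hn : n ≤ m
        · rwa [show m + 1 - (n + 1) + 1 = m + 1 - n by omega] at h1
        · rw [show m + 1 - n = 0 by omega]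
          exact h1.contDiff
      -- The derivative at s is the value of the transported germ at the moved point, which the
      -- induction hypothesis makes independent of s.
      have hder : ∀ s : ℝ, HasDerivAt (fun s : ℝ => L.germValue Λ h (θ + s • a r, r))
          (L.germValue Λ (transportOp b h) (θ, r)) s := by
        intro s
        have h1 : HasDerivAt (fun s : ℝ => ((θ + s • a r, r) : AngleModel p q)) (a r, 0) s := by
          have h2 : HasDerivAt (fun s : ℝ => θ + s • a r) (a r) s := by
            simpa using ((hasDerivAt_id s).smul_const (a r)).const_add θ
          exact h2.prodMk (hasDerivAt_const s r)
        have h2 := ((L.contDiffAt_germValue hΛ hh.contDiff (z := (θ + s • a r, r)) hr).differentiableAt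
          (by simp)).hasFDerivAt.comp_hasDerivAt s h1
        rw [L.fderiv_germValue_apply hΛ hZ ha (z := (θ + s • a r, r)) hr hb hba hh.contDiff,
          ih _ hT θ s] at h2
        exact h2
      obtain ⟨K, hK⟩ := L.exists_forall_abs_germValue_le hΛ hh.contDiff hr
      have h0 := deriv_eq_zero_of_bounded_affine hder fun s => hK _
      have h1 := is_const_of_deriv_eq_zero (fun s => (hder s).differentiableAt)
        (fun s => (hder s).deriv.trans h0) t 0
      simpa using h1
  exact key (m + 1) h (by rw [Nat.sub_self]; exact hh) θ t

end LiouvilleChart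

/-! ### Torus invariance under either condition. -/

namespace LiouvilleChart

variable {p q : ℕ} {M : Type*} [TopologicalSpace M] [T2Space M]
  [ChartedSpace (EuclideanSpace ℝ (Fin (p + q))) M] [IsManifold (𝓡 (p + q)) ∞ M]
  {X : Fin p → SmoothVF (p + q) M} {F : Fin q → SmoothFun (p + q) M} {N : Set M}
  (L : LiouvilleChart X F N) {Λ : SmoothFun (p + q) M →ₗ[ℝ] SmoothFun (p + q) M} {m : ℕ}
  {Z : SmoothVF (p + q) M} {a : EuclideanSpace ℝ (Fin q) → (Fin p → ℝ)}

/-- If the transported values are independent of the angles over an open set of parameters, then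
the operator is invariant under the torus action. -/
theorem invariantNear_of_germValue_eq (hΛ : HasOrderLE Λ m) {R : Set (EuclideanSpace ℝ (Fin q))}
    (hR : IsOpen R) (hNR : ∀ x ∈ N, (L.toOpenPartialHomeomorph x).2 ∈ R)
    (h : ∀ u, ContDiff ℝ ∞ u → ∀ r ∈ R, ∀ θ θ',
      L.germValue Λ u (θ, r) = L.germValue Λ u (θ', r)) : L.InvariantNear Λ := by
  refine ⟨L.source ∩ L.toOpenPartialHomeomorph ⁻¹' (Prod.snd ⁻¹' R),
    L.toOpenPartialHomeomorph.isOpen_inter_preimage (hR.preimage continuous_snd),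
    fun x hx => ⟨L.subset_source hx, hNR x hx⟩, inter_subset_left, ?_, ?_⟩
  · rintro ρ x ⟨hx, hxR⟩
    obtain ⟨z, hz, rfl⟩ := L.exists_lift_eq hx
    obtain ⟨⟨σ, s⟩, hσ⟩ := torusProj_surjective (ρ, (0 : EuclideanSpace ℝ (Fin q)))
    obtain rfl : (fun i => (σ i : UnitAddCircle)) = ρ := (Prod.ext_iff.1 hσ).1
    have hz' : (z + (σ, 0)).2 ∈ ball (0 : EuclideanSpace ℝ (Fin q)) 1 := by simpa using hz
    rw [L.act_lift hz]
    refine ⟨L.lift_mem_source hz', ?_⟩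
    rw [mem_preimage, mem_preimage, L.apply_lift hz] at hxR
    rw [mem_preimage, mem_preimage, L.apply_lift hz']
    simpa [torusProj] using hxR
  · rintro ρ x ⟨hx, hxR⟩ f g hfg
    obtain ⟨z, hz, rfl⟩ := L.exists_lift_eq hx
    obtain ⟨⟨σ, s⟩, hσ⟩ := torusProj_surjective (ρ, (0 : EuclideanSpace ℝ (Fin q)))
    obtain rfl : (fun i => (σ i : UnitAddCircle)) = ρ := (Prod.ext_iff.1 hσ).1
    have hz' : (z + (σ, 0)).2 ∈ ball (0 : EuclideanSpace ℝ (Fin q)) 1 := by simpa using hz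
    rw [mem_preimage, mem_preimage, L.apply_lift hz] at hxR
    have hO : IsOpen {w : AngleModel p q | (w + z).2 ∈ ball (0 : EuclideanSpace ℝ (Fin q)) 1} :=
      isOpen_ball.preimage (by fun_prop)
    have hu : ContDiffOn ℝ ∞ (fun w => g (L.lift (w + z)))
        {w : AngleModel p q | (w + z).2 ∈ ball (0 : EuclideanSpace ℝ (Fin q)) 1} := fun w hw =>
      ((L.contDiffAt_comp_lift g hw).comp w (f := fun w => w + z) (by fun_prop)).contDiffWithinAt
    -- `v` is the germ of the lift of g at z, recentred at 0. Since g is the pullback of f, the lift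
    -- of f has the same recentred germ at z + (σ, 0), so both sides are values of one `germValue`
    -- on the same torus.
    obtain ⟨v, hv, hvu⟩ := exists_contMDiff_eventuallyEq (x := (0 : AngleModel p q)) hO
      hu.contMDiffOn (by simpa using hz)
    have hg : (fun w => g (L.lift w)) =ᶠ[𝓝 z] fun w => v (w - z) := by
      have hc : Tendsto (fun w : AngleModel p q => w - z) (𝓝 z) (𝓝 0) :=
        Continuous.tendsto' (by fun_prop) _ _ (by simp)
      filter_upwards [hc.eventually hvu] with w hw
      rw [hw, sub_add_cancel]
    have hf : (fun w => f (L.lift w)) =ᶠ[𝓝 (z + (σ, 0))] fun w => v (w - (z + (σ, 0))) := by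
      have hc : Tendsto (fun w : AngleModel p q => w - (σ, 0)) (𝓝 (z + (σ, 0))) (𝓝 z) :=
        Continuous.tendsto' (by fun_prop) _ _ (by simp)
      have hfg' := (L.contMDiffAt_lift hz).continuousAt.eventually hfg
      filter_upwards [hc.eventually hg, hc.eventually hfg',
        hc.eventually ((isOpen_ball.preimage continuous_snd).mem_nhds hz)] with w hw hw' hwB
      rw [L.act_lift hwB, sub_add_cancel] at hw'
      rw [← hw', hw, sub_sub, add_comm z]
    rw [L.act_lift hz, L.apply_eq_germValue hΛ hz hg, L.apply_eq_germValue hΛ hz' hf]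
    have h1 : z + (σ, 0) = (z.1 + σ, z.2) := Prod.ext rfl (add_zero _)
    rw [h1]
    exact h v hv.contDiff z.2 hxR _ _

/-- Regularity on N makes the vectors a_i(r) independent for r in the image of N, an open condition
on r. They then span ℝ^p, so invariance along each of them is invariance under all angle
translations. -/
theorem invariantNear_of_invariantUnderVF (hΛ : HasOrderLE Λ m)
    (hreg : ∀ x ∈ N, IsRegularPoint X F x) (hinv : ∀ i, InvariantUnderVF Λ (X i)) :
    L.InvariantNear Λ := by
  obtain ⟨a, ha⟩ := L.exists_applyVF_lift
  have ha' := fun i z hz => (ha i z hz).2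
  have has := fun i => L.contDiffOn_coefficients (ha' i)
  have hR : IsOpen (ball (0 : EuclideanSpace ℝ (Fin q)) 1 ∩
      (fun r i => a i r) ⁻¹' {v : Fin p → Fin p → ℝ | LinearIndependent ℝ v}) :=
    (continuousOn_pi.2 fun i => (has i).continuousOn).isOpen_inter_preimage isOpen_ball
      isOpen_setOfPred_linearIndependent
  refine L.invariantNear_of_germValue_eq hΛ hR (fun x hx => ?_)
    fun u hu r hr θ θ' => ?_
  · obtain ⟨z, hz, rfl⟩ := L.exists_lift_eq (L.subset_source hx)
    rw [L.apply_lift hz]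
    refine ⟨hz, ?_⟩
    let D : AngleModel p q →L[ℝ] EuclideanSpace ℝ (Fin (p + q)) :=
      mfderiv 𝓘(ℝ, AngleModel p q) (𝓡 (p + q)) L.lift z
    let B : (Fin p → ℝ) →ₗ[ℝ] EuclideanSpace ℝ (Fin (p + q)) :=
      (D : AngleModel p q →ₗ[ℝ] _).comp (LinearMap.inl ℝ _ _)
    have h1 : (fun i => X i (L.lift z)) = B ∘ fun i => a i z.2 :=
      funext fun i => (ha i z hz).1.symm
    have h2 := (hreg _ hx).1
    rw [h1] at h2
    exact LinearIndependent.of_comp B h2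
  · have hspan : Submodule.span ℝ (range fun i => a i r) = ⊤ :=
      hr.2.span_eq_top_of_card_eq_finrank' (by simp)
    have key : ∀ v ∈ Submodule.span ℝ (range fun i => a i r), ∀ (t : ℝ) (θ : Fin p → ℝ),
        L.germValue Λ u (θ + t • v, r) = L.germValue Λ u (θ, r) := by
      intro v hv
      induction hv using Submodule.span_induction with
      | mem v hv =>
        obtain ⟨i, rfl⟩ := hv
        exact fun t θ => L.germValue_add_smul hΛ (hinv i) (ha' i) hr.1 hu θ t
      | zero => simp
      | add v w _ _ hv hw =>
        intro t θ
        rw [smul_add, ← add_assoc, hw, hv]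
      | smul c v _ hv =>
        intro t θ
        rw [smul_smul, hv]
    have h1 := key (θ' - θ) (by rw [hspan]; trivial) 1 θ
    rw [one_smul, add_sub_cancel] at h1
    exact h1.symm

/-- Orbits of a vector field that is constant on tori are contained in straight lines. -/
theorem vfOrbit_subset (ha : ∀ z : AngleModel p q, z.2 ∈ ball (0 : EuclideanSpace ℝ (Fin q)) 1 →
      mfderiv 𝓘(ℝ, AngleModel p q) (𝓡 (p + q)) L.lift z (a z.2, 0) = Z (L.lift z))
    {z : AngleModel p q} (hz : z.2 ∈ ball (0 : EuclideanSpace ℝ (Fin q)) 1) :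
    vfOrbit Z (L.lift z) ⊆ range fun t : ℝ => L.lift (z.1 + t • a z.2, z.2) := by
  rintro y ⟨γ, α, β, t, hα, hβ, ht, hγ, hγ0, rfl⟩
  have hcurve : IsMIntegralCurveOn (I := 𝓡 (p + q))
      (fun t : ℝ => L.lift (z.1 + t • a z.2, z.2)) (fun x => Z x) (Ioo α β) := by
    intro t _
    refine HasMFDerivAt.hasMFDerivWithinAt ?_
    have h1 : HasFDerivAt (fun t : ℝ => ((z.1 + t • a z.2, z.2) : AngleModel p q))
        ((1 : ℝ →L[ℝ] ℝ).smulRight ((a z.2, 0) : AngleModel p q)) t := by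
      have h2 : HasDerivAt (fun s : ℝ => z.1 + s • a z.2) (a z.2) t := by
        simpa using ((hasDerivAt_id t).smul_const (a z.2)).const_add z.1
      exact (h2.prodMk (hasDerivAt_const t z.2)).hasFDerivAt
    have hz' : ((z.1 + t • a z.2, z.2) : AngleModel p q).2 ∈
      ball (0 : EuclideanSpace ℝ (Fin q)) 1 := hz
    have h2 := (((L.contMDiffAt_lift hz').mdifferentiableAt (by simp)).hasMFDerivAt).comp t
      h1.hasMFDerivAt
    have h3 : (mfderiv 𝓘(ℝ, AngleModel p q) (𝓡 (p + q)) L.lift (z.1 + t • a z.2, z.2)).comp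
        ((1 : ℝ →L[ℝ] ℝ).smulRight ((a z.2, 0) : AngleModel p q)) = (1 : ℝ →L[ℝ] ℝ).smulRight
          (Z (L.lift (z.1 + t • a z.2, z.2))) := by
      ext
      change mfderiv 𝓘(ℝ, AngleModel p q) (𝓡 (p + q)) L.lift _
        ((1 : ℝ) • ((a z.2, 0) : AngleModel p q)) = (1 : ℝ) • Z (L.lift (z.1 + t • a z.2, z.2))
      rw [one_smul, one_smul]
      exact ha _ hz'
    exact h3 ▸ h2
  -- The straight line is an integral curve for all times, so uniqueness identifies any integral
  -- curve from the same point with it.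
  have h1 := isMIntegralCurveOn_Ioo_eqOn_of_contMDiff_boundaryless (I := 𝓡 (p + q)) (t₀ := 0)
    (v := fun x => Z x) ⟨hα, hβ⟩ (Z.contMDiff_toFun.of_le (by norm_cast)) hcurve hγ
    (by rw [hγ0, zero_smul, add_zero])
  exact ⟨t, h1 ht⟩

/-- Values are constant along the orbit of Z and continuous, hence constant on the torus it fills
densely. Approximation takes place in `M`, so nearby points are lifted by a local inverse and
compared with the line through periodicity. -/
theorem germValue_eq_of_orbit_subset_closure (hΛ : HasOrderLE Λ m) (hZ : InvariantUnderVF Λ Z)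
    (ha : ∀ z : AngleModel p q, z.2 ∈ ball (0 : EuclideanSpace ℝ (Fin q)) 1 →
      mfderiv 𝓘(ℝ, AngleModel p q) (𝓡 (p + q)) L.lift z (a z.2, 0) = Z (L.lift z) ∧
      ∀ f : SmoothFun (p + q) M,
      applyVF Z f (L.lift z) = fderiv ℝ (fun w => f (L.lift w)) z (a z.2, 0))
    {z : AngleModel p q} (hz : z.2 ∈ ball (0 : EuclideanSpace ℝ (Fin q)) 1)
    (horb : L.orbit (L.lift z) ⊆ closure (vfOrbit Z (L.lift z))) {u : AngleModel p q → ℝ}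
    (hu : ContDiff ℝ ∞ u) (θ : Fin p → ℝ) :
    L.germValue Λ u (θ, z.2) = L.germValue Λ u z := by
  have hz' : ((θ, z.2) : AngleModel p q).2 ∈ ball (0 : EuclideanSpace ℝ (Fin q)) 1 := hz
  have h1 : L.lift (θ, z.2) ∈ L.orbit (L.lift z) := by
    refine ⟨fun i => ((θ - z.1) i : UnitAddCircle), ?_⟩
    change L.act _ _ = _
    rw [L.act_lift hz]
    congr 1
    exact Prod.ext (add_sub_cancel _ _) (add_zero _)
  have h2 := closure_mono (L.vfOrbit_subset (fun z hz => (ha z hz).1) hz) (horb h1)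
  obtain ⟨χ, -, hzχ, hl⟩ := L.exists_isSmoothParam hz'
  have hy : χ (θ, z.2) = L.lift (θ, z.2) := (hl _ hzχ).2
  have hyt : L.lift (θ, z.2) ∈ χ.target := by rw [← hy]; exact χ.map_source hzχ
  have hsymm : χ.symm (L.lift (θ, z.2)) = (θ, z.2) := by rw [← hy, χ.left_inv hzχ]
  have hcont : ContinuousAt (fun y => L.germValue Λ u (χ.symm y)) (L.lift (θ, z.2)) := by
    refine ContinuousAt.comp (g := L.germValue Λ u) ?_ (χ.continuousAt_symm hyt)
    rw [hsymm]
    exact (L.contDiffAt_germValue hΛ hu hz').continuousAt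
  by_contra hne
  have h3 : ∀ᶠ y in 𝓝 (L.lift (θ, z.2)), L.germValue Λ u (χ.symm y) ≠ L.germValue Λ u z := by
    refine hcont.eventually_ne ?_
    rw [hsymm]
    exact hne
  obtain ⟨_, ⟨t, rfl⟩, h4, h5⟩ := ((mem_closure_iff_frequently.1 h2).and_eventually
    (h3.and (χ.open_target.mem_nhds hyt))).exists
  have hw := hl _ (χ.map_target h5)
  have h6 := hw.2
  rw [χ.right_inv h5] at h6
  have h7 := L.torusProj_eq_of_lift_eq (z' := (z.1 + t • a z.2, z.2)) hw.1 hz h6.symm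
  refine h4 ?_
  rw [L.germValue_periodic hΛ hw.1 h7]
  exact L.germValue_add_smul hΛ hZ (fun z hz => (ha z hz).2) hz hu z.1 t

/-- If the values at two angles differed over some r, they would by continuity differ on all nearby
tori, including one with a dense orbit. -/
theorem invariantNear_of_denseOrbitsNear (hΛ : HasOrderLE Λ m) {i : Fin p}
    (hinv : InvariantUnderVF Λ (X i)) (hdense : L.DenseOrbitsNear (X i)) :
    L.InvariantNear Λ := by
  obtain ⟨a, ha⟩ := L.exists_applyVF_lift
  obtain ⟨W, hW, hNW, hWs, hWc⟩ := hdense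
  have hsnd : ∀ x ∈ L.source, (L.toOpenPartialHomeomorph x).2 ∈
      ball (0 : EuclideanSpace ℝ (Fin q)) 1 := by
    intro x hx
    have h1 : L.toOpenPartialHomeomorph x ∈ L.target := L.toOpenPartialHomeomorph.map_source hx
    rw [L.target_eq] at h1
    exact h1.2
  have hR : IsOpen (Prod.snd '' (L.toOpenPartialHomeomorph '' W)) :=
    isOpenMap_snd _ (L.toOpenPartialHomeomorph.isOpen_image_of_subset_source hW hWs)
  refine L.invariantNear_of_germValue_eq hΛ hR
    (fun x hx => ⟨_, ⟨x, hNW hx, rfl⟩, rfl⟩) ?_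
  · rintro u hu _ ⟨_, ⟨x, hx, rfl⟩, rfl⟩ θ θ'
    have hxB := hsnd x (hWs hx)
    have hc : ContinuousAt (fun y => (L.toOpenPartialHomeomorph y).2) x :=
      continuous_snd.continuousAt.comp (L.toOpenPartialHomeomorph.continuousAt (hWs hx))
    have hG : ∀ θ, ContinuousAt (fun y => L.germValue Λ u (θ, (L.toOpenPartialHomeomorph y).2)) x :=
      fun θ => ContinuousAt.comp (g := L.germValue Λ u)
        (f := fun y => (θ, (L.toOpenPartialHomeomorph y).2))
        (L.contDiffAt_germValue hΛ hu (z := (θ, (L.toOpenPartialHomeomorph x).2)) hxB).continuousAt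
        (continuousAt_const.prodMk hc)
    by_contra hne
    obtain ⟨y, ⟨hy, horb⟩, hyne⟩ := ((mem_closure_iff_frequently.1 (hWc hx)).and_eventually
      (((hG θ).ne_iff_eventually_ne (hG θ')).1 hne)).exists
    obtain ⟨z, hz, rfl⟩ := L.exists_lift_eq hy
    rw [L.apply_lift hz] at hyne
    refine hyne ?_
    change L.germValue Λ u (θ, z.2) = L.germValue Λ u (θ', z.2)
    exact (L.germValue_eq_of_orbit_subset_closure hΛ hinv (ha i) hz horb hu θ).trans
      (L.germValue_eq_of_orbit_subset_closure hΛ hinv (ha i) hz horb hu θ').symm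

end LiouvilleChart

end LiouvilleTorus

end

theorem mainTheorem3 {p q : ℕ} {M : Type*} [TopologicalSpace M] [T2Space M]
    [ChartedSpace (EuclideanSpace ℝ (Fin (p + q))) M] [IsManifold (𝓡 (p + q)) ∞ M]
    (X : Fin p → LiouvilleTorus.SmoothVF (p + q) M)
    (F : Fin q → LiouvilleTorus.SmoothFun (p + q) M)
    (hXF : LiouvilleTorus.IsIntegrableSystem X F)
    (c : Fin q → ℝ) (N : Set M) (hN : N = LiouvilleTorus.levelSet F c)
    (hN_connected : IsConnected N) (hN_compact : IsCompact N)
    (hN_regular : ∀ x ∈ N, LiouvilleTorus.IsRegularPoint X F x)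
    (Λ : LiouvilleTorus.SmoothFun (p + q) M →ₗ[ℝ] LiouvilleTorus.SmoothFun (p + q) M)
    (hΛ : LiouvilleTorus.IsDiffOp Λ) :
    Nonempty (LiouvilleTorus.LiouvilleChart X F N) ∧
    ∀ L : LiouvilleTorus.LiouvilleChart X F N,
      ((∀ i, LiouvilleTorus.InvariantUnderVF Λ (X i)) ∨
        (LiouvilleTorus.InvariantUnderVF Λ (X ⟨0, hXF.one_le⟩) ∧
          L.DenseOrbitsNear (X ⟨0, hXF.one_le⟩))) →
      L.InvariantNear Λ := by
  subst hN
  refine ⟨LiouvilleTorus.nonempty_liouvilleChart hXF.commute hXF.firstIntegral hN_connected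
    hN_compact hN_regular, fun L h => ?_⟩
  obtain ⟨m, hm⟩ := hΛ
  rcases h with h | ⟨h, hdense⟩
  · exact L.invariantNear_of_invariantUnderVF hm hN_regular h
  · exact L.invariantNear_of_denseOrbitsNear hm h hdense
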